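/- Let $m\ge 1$ be an integer. For $k\in\mathbb N$ and $x\in\mathbb R$ let $f_k(x)=\mathrm{Re}\big(\mathrm i\,\tfrac{x-\mathrm i}{x+\mathrm i}\big)^k$ and $g_k(x)=\mathrm{Im}\big(\mathrm i\,\tfrac{x-\mathrm i}{x+\mathrm i}\big)^k$, and let $\mathbf Q=\mathbf Q_m=(f_m,g_m,0):\mathbb R\to\mathbb S^2$. Let $|\nabla|$ be the Fourier multiplier on $\mathbb R$ with symbol $|\xi|$, and set $$L_+=|\nabla|-|\partial_x\mathbf Q|,\qquad L_-=|\nabla|-|\partial_x\mathbf Q|+R,\qquad (Rf)(x)=\frac1{2\pi}\int_{\mathbb R}\frac{|\mathbf Q(x)-\mathbf Q(y)|^2}{|x-y|^2}f(y)\,dy,$$ where $|\partial_x\mathbf Q(x)|=\frac{2m}{1+x^2}$. On complex $L^2(\mathbb R)$ take both operators with domain $H^1(\mathbb R)$. Consider $$\mathcal L=\begin{bmatrix}0&-L_-\\ L_+&0\end{bmatrix}\quad\text{on }L^2(\mathbb R)\times L^2(\mathbb R)\text{ with domain }H^1(\mathbb R)\times H^1(\mathbb R).$$ Let $\dot H^{1/2}(\mathbb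 R)$ be the space of functions $f$ with $\int\frac{|f(x)|}{1+x^2}\,dx<\infty$ and $\iint\frac{|f(x)-f(y)|^2}{|x-y|^2}\,dx\,dy<\infty$. By a zero-energy solution we mean a pair $(u,v)\in\dot H^{1/2}(\mathbb R)\times\dot H^{1/2}(\mathbb R)$ with $\mathcal L(u,v)=0$ in the sense of distributions; it is called a resonance if it does not belong to $L^2(\mathbb R)\times L^2(\mathbb R)$. Then the following hold. (i) The spectrum is $\sigma(\mathcal L)=\mathrm i\mathbb R$. (ii) $0$ is the only eigenvalue of $\mathcal L$, and $\dim\ker\mathcal L=2m+1$. In particular, $\mathcal L$ has no embedded eigenvalue in $\mathrm i\mathbb R\setminus\{0\}$. (iii) The operator $L_+$ has exactly $2m$ eigenvalues $E_0<E_1<\dots<E_{2m-1}=0$, and each of them is simple. If $\varphi_0,\dots,\varphi_{2m-1}$ are corresponding $L^2$-orthonormalized eigenfunctions, then $$\bigcup_{n\ge1}\ker(\mathcal L^n)=\ker(\mathcal L^2)=\mathrm{span}\big\{(\varphi_k,0),\,(0,\varphi_k):0\le k\le 2m-1\big\}.$$ (iv) Let $\varphi=g_m$ if $m$ is odd and $\varphi=f_m$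 if $m$ is even. Then $\varphi\in\dot H^{1/2}(\mathbb R)\setminus L^2(\mathbb R)$, and $(\varphi,0)$ and $(0,\varphi)$ are two linearly independent resonances of $\mathcal L$. Every zero-energy solution differs from a linear combination of these two by an element of $L^2(\mathbb R)\times L^2(\mathbb R)$. -/

import Mathlib

open MeasureTheory FourierTransform
open scoped SchwartzMap ENNReal

noncomputable section

namespace HalfHarmonic

/-! ### Unbounded operators: kernel, powers, eigenvalues, spectrum -/

section Unbounded

variable {E : Type*} [NormedAddCommGroup E] [NormedSpace ℂ E]

/-- The kernel `{x ∈ dom T | T x = 0}` of an unbounded operator. -/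
def pker (T : E →ₗ.[ℂ] E) : Submodule ℂ E :=
  (LinearMap.ker T.toFun).map T.domain.subtype

/-- The composition `S T` with its natural domain `{x ∈ dom T | T x ∈ dom S}`. -/
def pcomp (S T : E →ₗ.[ℂ] E) : E →ₗ.[ℂ] E where
  domain :=
    { carrier := {x | ∃ h : x ∈ T.domain, T ⟨x, h⟩ ∈ S.domain}
      add_mem' := by
        rintro x y ⟨hx, hx'⟩ ⟨hy, hy'⟩
        refine ⟨T.domain.add_mem hx hy, ?_⟩
        have h := T.map_add ⟨x, hx⟩ ⟨y, hy⟩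
        rw [show (⟨x + y, T.domain.add_mem hx hy⟩ : T.domain) = ⟨x, hx⟩ + ⟨y, hy⟩ from rfl, h]
        exact S.domain.add_mem hx' hy'
      zero_mem' := by
        refine ⟨T.domain.zero_mem, ?_⟩
        rw [show (⟨0, T.domain.zero_mem⟩ : T.domain) = 0 from rfl, T.map_zero]
        exact S.domain.zero_mem
      smul_mem' := by
        rintro c x ⟨hx, hx'⟩
        refine ⟨T.domain.smul_mem c hx, ?_⟩
        rw [show (⟨c • x, T.domain.smul_mem c hx⟩ : T.domain) = c • ⟨x, hx⟩ from rfl, T.map_smul]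
        exact S.domain.smul_mem c hx' }
  toFun :=
    { toFun := fun x => S ⟨T ⟨x.1, x.2.1⟩, x.2.2⟩
      map_add' := by
        rintro ⟨x, hx, hx'⟩ ⟨y, hy, hy'⟩
        rw [← S.map_add]
        congr 1
        exact Subtype.ext (T.map_add ⟨x, hx⟩ ⟨y, hy⟩)
      map_smul' := by
        rintro c ⟨x, hx, hx'⟩
        rw [RingHom.id_apply, ← S.map_smul]
        congr 1
        exact Subtype.ext (T.map_smul c ⟨x, hx⟩) }

/-- The powers `T ^ n` of an unbounded operator, with their natural domains. -/
def ppow (T : E →ₗ.[ℂ] E) : ℕ → (E →ₗ.[ℂ] E)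
  | 0 => ⟨⊤, (⊤ : Submodule ℂ E).subtype⟩
  | n + 1 => pcomp (ppow T n) T

/-- `x` lies in the domain of `T`, and `T x = z x`. -/
def EigenEq (T : E →ₗ.[ℂ] E) (z : ℂ) (x : E) : Prop :=
  ∃ h : x ∈ T.domain, T ⟨x, h⟩ = z • x

/-- The set of eigenvalues of `T`. -/
def pointSpectrum (T : E →ₗ.[ℂ] E) : Set ℂ :=
  {z | ∃ x : E, x ≠ 0 ∧ EigenEq T z x}

/-- The resolvent set of `T`: those `z` for which `z - T` is a bijection from `dom T` onto the
whole space with a bounded inverse. -/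
def presolventSet (T : E →ₗ.[ℂ] E) : Set ℂ :=
  {z | ∃ B : E →L[ℂ] E,
    (∀ y : E, ∃ h : B y ∈ T.domain, z • B y - T ⟨B y, h⟩ = y) ∧
    (∀ x : T.domain, B (z • (x : E) - T x) = x)}

/-- The spectrum of `T`. -/
def pspectrum (T : E →ₗ.[ℂ] E) : Set ℂ := (presolventSet T)ᶜ

end Unbounded

/-! ### The half-harmonic map `𝐐_m` -/

/-- `(i (x - i) / (x + i)) ^ k`. -/
def Qc (k : ℕ) (x : ℝ) : ℂ :=
  (Complex.I * (((x : ℂ) - Complex.I) / ((x : ℂ) + Complex.I))) ^ k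

/-- `f_k = Re (i (x - i) / (x + i)) ^ k`. -/
def fk (k : ℕ) (x : ℝ) : ℝ := (Qc k x).re

/-- `g_k = Im (i (x - i) / (x + i)) ^ k`. -/
def gk (k : ℕ) (x : ℝ) : ℝ := (Qc k x).im

/-- The pure-power half-harmonic map `𝐐_m = (f_m, g_m, 0)` of degree `m`. -/
def Q (m : ℕ) (x : ℝ) : EuclideanSpace ℝ (Fin 3) := !₂[fk m x, gk m x, 0]

/-- The potential `|∂ₓ 𝐐_m|`. -/
def V (m : ℕ) (x : ℝ) : ℝ := ‖deriv (Q m) x‖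

/-- The kernel of the integral operator `R`. -/
def kerR (m : ℕ) (x y : ℝ) : ℝ :=
  1 / (2 * Real.pi) * (‖Q m x - Q m y‖ ^ 2 / |x - y| ^ 2)

/-- The integral operator `R` on functions. -/
def RFun (m : ℕ) (f : ℝ → ℂ) (x : ℝ) : ℂ := ∫ y, (kerR m x y : ℂ) * f y

lemma xaddI_ne (x : ℝ) : (x : ℂ) + Complex.I ≠ 0 := by
  intro h
  have := congrArg Complex.im h
  simp at this

lemma norm_xaddI (x : ℝ) : ‖(x : ℂ) + Complex.I‖ ^ 2 = 1 + x ^ 2 := by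
  rw [← Complex.normSq_eq_norm_sq, Complex.normSq_apply]
  simp
  ring

lemma norm_Qc_one (x : ℝ) :
    ‖Complex.I * (((x : ℂ) - Complex.I) / ((x : ℂ) + Complex.I))‖ = 1 := by
  have h : ‖(x : ℂ) - Complex.I‖ = ‖(x : ℂ) + Complex.I‖ := by
    rw [← Complex.norm_conj]
    simp
  rw [norm_mul, norm_div, h, Complex.norm_I, one_mul,
    div_self (norm_ne_zero_iff.mpr (xaddI_ne x))]

lemma norm_pow_sub_le (m : ℕ) {a b : ℂ} (ha : ‖a‖ = 1) (hb : ‖b‖ = 1) :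
    ‖a ^ m - b ^ m‖ ≤ m * ‖a - b‖ := by
  induction m with
  | zero => simp
  | succ n ih =>
    have h : a ^ (n + 1) - b ^ (n + 1) = a ^ n * (a - b) + (a ^ n - b ^ n) * b := by ring
    rw [h]
    refine (norm_add_le _ _).trans ?_
    rw [norm_mul, norm_mul, norm_pow, ha, hb, one_pow]
    push_cast
    linarith

lemma norm_Q_sub_sq (m : ℕ) (x y : ℝ) : ‖Q m x - Q m y‖ ^ 2 = ‖Qc m x - Qc m y‖ ^ 2 := by
  rw [EuclideanSpace.norm_sq_eq, Fin.sum_univ_three, ← Complex.normSq_eq_norm_sq,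
    Complex.normSq_apply]
  simp [Q, fk, gk, sq]

lemma norm_Q_sub_sq_le (m : ℕ) (x y : ℝ) :
    ‖Q m x - Q m y‖ ^ 2 ≤ 4 * m ^ 2 * |x - y| ^ 2 / ((1 + x ^ 2) * (1 + y ^ 2)) := by
  rw [norm_Q_sub_sq]
  have h1 := norm_pow_sub_le m (norm_Qc_one x) (norm_Qc_one y)
  have h2 : Complex.I * (((x : ℂ) - Complex.I) / ((x : ℂ) + Complex.I)) -
      Complex.I * (((y : ℂ) - Complex.I) / ((y : ℂ) + Complex.I)) =
      -2 * ((x - y : ℝ) : ℂ) / (((x : ℂ) + Complex.I) * ((y : ℂ) + Complex.I)) := by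
    have hx := xaddI_ne x
    have hy := xaddI_ne y
    have hI : Complex.I ^ 2 = -1 := Complex.I_sq
    push_cast
    field_simp
    linear_combination (2 * ((x : ℂ) - y)) * hI
  rw [h2] at h1
  calc ‖Qc m x - Qc m y‖ ^ 2 ≤ _ := pow_le_pow_left₀ (norm_nonneg _) h1 2
    _ = _ := by
      rw [mul_pow, norm_div, norm_mul, norm_mul, div_pow, mul_pow, mul_pow, norm_xaddI,
        norm_xaddI, Complex.norm_real, Real.norm_eq_abs]
      norm_num
      ring

lemma kerR_nonneg (m : ℕ) (x y : ℝ) : 0 ≤ kerR m x y := by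
  unfold kerR
  have := Real.pi_pos
  positivity

lemma kerR_le (m : ℕ) (x y : ℝ) :
    kerR m x y ≤ 4 * m ^ 2 * ((1 + x ^ 2)⁻¹ * (1 + y ^ 2)⁻¹) := by
  have hx : (0 : ℝ) < 1 + x ^ 2 := by positivity
  have hy : (0 : ℝ) < 1 + y ^ 2 := by positivity
  have h1 : ‖Q m x - Q m y‖ ^ 2 / |x - y| ^ 2 ≤
      4 * m ^ 2 * ((1 + x ^ 2)⁻¹ * (1 + y ^ 2)⁻¹) := by
    rcases eq_or_ne x y with rfl | h
    · simp
      positivity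
    · have : 0 < |x - y| ^ 2 := by
        have := abs_pos.mpr (sub_ne_zero.mpr h)
        positivity
      rw [div_le_iff₀ this]
      refine (norm_Q_sub_sq_le m x y).trans (le_of_eq ?_)
      field_simp
  have h2 : 1 / (2 * Real.pi) ≤ 1 := by
    rw [div_le_one (by positivity)]
    linarith [Real.pi_gt_three]
  calc kerR m x y ≤ 1 * (‖Q m x - Q m y‖ ^ 2 / |x - y| ^ 2) :=
        mul_le_mul_of_nonneg_right h2 (by positivity)
    _ ≤ _ := by rw [one_mul]; exact h1

lemma norm_Q_sub_le (m : ℕ) (x y : ℝ) : ‖Q m x - Q m y‖ ≤ 2 * m * |x - y| := by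
  refine le_of_sq_le_sq ?_ (by positivity)
  refine (norm_Q_sub_sq_le m x y).trans ?_
  have hx : (1 : ℝ) ≤ 1 + x ^ 2 := by nlinarith [sq_nonneg x]
  have hy : (1 : ℝ) ≤ 1 + y ^ 2 := by nlinarith [sq_nonneg y]
  have hxy : (1 : ℝ) ≤ (1 + x ^ 2) * (1 + y ^ 2) := by nlinarith
  calc _ ≤ 4 * (m : ℝ) ^ 2 * |x - y| ^ 2 / 1 :=
        div_le_div_of_nonneg_left (by positivity) one_pos hxy
    _ = _ := by ring

lemma continuous_Q (m : ℕ) : Continuous (Q m) := by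
  have : LipschitzWith (Real.toNNReal (2 * m)) (Q m) := by
    refine LipschitzWith.of_dist_le_mul fun x y => ?_
    rw [dist_eq_norm, Real.dist_eq, Real.coe_toNNReal _ (by positivity)]
    exact norm_Q_sub_le m x y
  exact this.continuous

lemma V_le (m : ℕ) (x : ℝ) : ‖V m x‖ ≤ 2 * m := by
  have : LipschitzWith (Real.toNNReal (2 * m)) (Q m) := by
    refine LipschitzWith.of_dist_le_mul fun x y => ?_
    rw [dist_eq_norm, Real.dist_eq, Real.coe_toNNReal _ (by positivity)]
    exact norm_Q_sub_le m x y
  have h := norm_deriv_le_of_lipschitz (x₀ := x) this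
  rw [Real.coe_toNNReal _ (by positivity)] at h
  simpa [V] using h

lemma measurable_V (m : ℕ) : Measurable (V m) := (measurable_deriv (Q m)).norm

lemma measurable_kerR (m : ℕ) : Measurable (fun p : ℝ × ℝ => kerR m p.1 p.2) := by
  unfold kerR
  have h := (continuous_Q m).measurable
  have h1 : Measurable (fun p : ℝ × ℝ => Q m p.1 - Q m p.2) :=
    (h.comp measurable_fst).sub (h.comp measurable_snd)
  have h2 : Measurable (fun p : ℝ × ℝ => |p.1 - p.2|) :=
    (measurable_fst.sub measurable_snd).norm
  exact ((h1.norm.pow_const 2).div (h2.pow_const 2)).const_mul _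

/-! ### The operators on `L²(ℝ)` -/

/-- The complex Hilbert space `L²(ℝ)`. -/
abbrev L2 : Type := Lp ℂ 2 (volume : Measure ℝ)

/-- The Sobolev space `H¹(ℝ)` as a subspace of `L²(ℝ)`. -/
def H1 : Submodule ℂ L2 where
  carrier := {u | TemperedDistribution.MemSobolev 1 2 (u : 𝓢'(ℝ, ℂ))}
  add_mem' := by
    intro u v hu hv
    have := hu.add hv
    rw [← Lp.toTemperedDistributionCLM_apply, ← Lp.toTemperedDistributionCLM_apply,
      ← map_add] at this
    exact this
  zero_mem' := by
    have := TemperedDistribution.memSobolev_fun_zero ℝ ℂ 1 2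
    rw [← map_zero (Lp.toTemperedDistributionCLM ℂ (volume : Measure ℝ) 2)] at this
    exact this
  smul_mem' := by
    intro c u hu
    have := TemperedDistribution.MemSobolev.smul c hu
    rw [← Lp.toTemperedDistributionCLM_apply, ← map_smul] at this
    exact this

/-- The symbol `2 π |ξ|` of `|∇|`; the Fourier transform is
`𝓕 f ξ = ∫ f(x) exp (- 2 π i x ξ) dx`. -/
def absSymbol (ξ : ℝ) : ℂ := ((2 * Real.pi * |ξ| : ℝ) : ℂ)

lemma memLp_absSymbol_mul (u : H1) :
    MemLp (fun ξ : ℝ => absSymbol ξ * (𝓕 (u : L2) : L2) ξ) 2 volume := by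
  obtain ⟨f', hf'⟩ :=
    TemperedDistribution.memSobolev_iff_exists_smulLeftCLM_fourier.mp u.2
  rw [Lp.fourier_toTemperedDistribution_eq] at hf'
  set w : ℝ → ℂ := fun x => (((1 + ‖x‖ ^ 2) ^ (-(1 : ℝ) / 2) : ℝ) : ℂ) with hw
  have hwt : w.HasTemperateGrowth := by fun_prop
  have hwb : ∀ x, ‖w x‖ ≤ 1 := by
    intro x
    rw [hw, Complex.norm_real, Real.norm_eq_abs, abs_eq_self.mpr (by positivity)]
    exact Real.rpow_le_one_of_one_le_of_nonpos (by linarith [sq_nonneg ‖x‖]) (by norm_num)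
  have hwm : MemLp w ∞ (volume : Measure ℝ) :=
    memLp_top_of_bound hwt.1.continuous.aestronglyMeasurable 1 (Filter.Eventually.of_forall hwb)
  have key : ((hwm.toLp w) • f' : L2) = (𝓕 (u : L2) : L2) := by
    have hinj := LinearMap.ker_eq_bot.mp
      (Lp.ker_toTemperedDistributionCLM_eq_bot (F := ℂ) (μ := (volume : Measure ℝ)) (p := 2))
    apply hinj
    change (((hwm.toLp w) • f' : L2) : 𝓢'(ℝ, ℂ)) = ((𝓕 (u : L2) : L2) : 𝓢'(ℝ, ℂ))
    rw [Lp.toTemperedDistribution_smul_eq hwt, ← hf',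
      TemperedDistribution.smulLeftCLM_smulLeftCLM_apply (by fun_prop) hwt]
    convert! TemperedDistribution.smulLeftCLM_const 1 ((𝓕 (u : L2) : L2) : 𝓢'(ℝ, ℂ)) using 1
    · congr
      ext x
      have h0 : (0 : ℝ) < 1 + ‖x‖ ^ 2 := by positivity
      change (((1 + ‖x‖ ^ 2) ^ ((1 : ℝ) / 2) : ℝ) : ℂ) *
        (((1 + ‖x‖ ^ 2) ^ (-(1 : ℝ) / 2) : ℝ) : ℂ) = 1
      rw [← Complex.ofReal_mul, ← Real.rpow_add h0]
      norm_num
    · simp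
  have hae : ∀ᵐ ξ : ℝ, (𝓕 (u : L2) : L2) ξ = w ξ * f' ξ := by
    rw [← key]
    filter_upwards [Lp.coeFn_lpSMul (r := 2) (hwm.toLp w) f', hwm.coeFn_toLp] with ξ h1 h2
    rw [h1]
    simp [h2]
  have hmeas : Measurable absSymbol := by
    unfold absSymbol
    fun_prop
  refine MemLp.of_le_mul (g := fun ξ => f' ξ) (c := 2 * Real.pi) (Lp.memLp f')
    (hmeas.aestronglyMeasurable.mul (Lp.aestronglyMeasurable _)) ?_
  filter_upwards [hae] with ξ h
  rw [h, ← mul_assoc, norm_mul]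
  refine mul_le_mul_of_nonneg_right ?_ (norm_nonneg _)
  have h0 : (0 : ℝ) < 1 + ‖ξ‖ ^ 2 := by positivity
  have h1 : |ξ| ≤ (1 + ‖ξ‖ ^ 2) ^ ((1 : ℝ) / 2) := by
    rw [← Real.sqrt_eq_rpow]
    refine Real.le_sqrt_of_sq_le ?_
    simp
  rw [norm_mul, absSymbol, hw, Complex.norm_real, Complex.norm_real, Real.norm_eq_abs,
    Real.norm_eq_abs, abs_of_nonneg (by positivity : (0 : ℝ) ≤ 2 * Real.pi * |ξ|),
    abs_of_nonneg (by positivity : (0 : ℝ) ≤ (1 + ‖ξ‖ ^ 2) ^ (-(1 : ℝ) / 2)), mul_assoc]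
  refine mul_le_of_le_one_right (by positivity) ?_
  calc |ξ| * (1 + ‖ξ‖ ^ 2) ^ (-(1 : ℝ) / 2)
      ≤ (1 + ‖ξ‖ ^ 2) ^ ((1 : ℝ) / 2) * (1 + ‖ξ‖ ^ 2) ^ (-(1 : ℝ) / 2) := by gcongr
    _ = 1 := by rw [← Real.rpow_add h0]; norm_num

/-- `|∇| : H¹(ℝ) → L²(ℝ)`, the Fourier multiplier with symbol `2 π |ξ|`. -/
def absGrad : H1 →ₗ[ℂ] L2 where
  toFun u := 𝓕⁻ ((memLp_absSymbol_mul u).toLp _ : L2)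
  map_add' u v := by
    rw [← fourierInv_add]
    congr 1
    rw [← MemLp.toLp_add]
    refine MemLp.toLp_congr _ _ ?_
    have h : (𝓕 ((u + v : H1) : L2) : L2) = 𝓕 (u : L2) + 𝓕 (v : L2) := by
      rw [Submodule.coe_add, FourierTransform.fourier_add]
    rw [h]
    filter_upwards [Lp.coeFn_add (𝓕 (u : L2) : L2) (𝓕 (v : L2))] with ξ hξ
    simp only [hξ, Pi.add_apply, mul_add]
  map_smul' c u := by
    rw [RingHom.id_apply, ← fourierInv_smul]
    congr 1
    rw [← MemLp.toLp_const_smul]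
    refine MemLp.toLp_congr _ _ ?_
    have h : (𝓕 ((c • u : H1) : L2) : L2) = c • 𝓕 (u : L2) := by
      rw [Submodule.coe_smul, FourierTransform.fourier_smul]
    rw [h]
    filter_upwards [Lp.coeFn_smul c (𝓕 (u : L2) : L2)] with ξ hξ
    simp only [hξ, Pi.smul_apply, smul_eq_mul]
    ring

lemma memLp_V_mul (m : ℕ) (u : L2) : MemLp (fun x : ℝ => (V m x : ℂ) * u x) 2 volume := by
  refine MemLp.of_le_mul (g := fun x => u x) (c := 2 * m) (Lp.memLp u)
    ((Complex.measurable_ofReal.comp (measurable_V m)).aestronglyMeasurable.mul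
      (Lp.aestronglyMeasurable _)) ?_
  filter_upwards with x
  rw [norm_mul, Complex.norm_real]
  exact mul_le_mul_of_nonneg_right (V_le m x) (norm_nonneg _)

/-- Multiplication by `|∂ₓ 𝐐_m|` on `L²(ℝ)`. -/
def VOp (m : ℕ) : L2 →ₗ[ℂ] L2 where
  toFun u := (memLp_V_mul m u).toLp _
  map_add' u v := by
    rw [← MemLp.toLp_add]
    refine MemLp.toLp_congr _ _ ?_
    filter_upwards [Lp.coeFn_add u v] with x hx
    simp only [hx, Pi.add_apply, mul_add]
  map_smul' c u := by
    rw [RingHom.id_apply, ← MemLp.toLp_const_smul]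
    refine MemLp.toLp_congr _ _ ?_
    filter_upwards [Lp.coeFn_smul c u] with x hx
    simp only [hx, Pi.smul_apply, smul_eq_mul]
    ring

lemma memLp_inv_one_add_sq : MemLp (fun x : ℝ => (1 + x ^ 2)⁻¹) 2 volume := by
  have hm : AEStronglyMeasurable (fun x : ℝ => (1 + x ^ 2)⁻¹) volume :=
    integrable_inv_one_add_sq.aestronglyMeasurable
  rw [memLp_two_iff_integrable_sq hm]
  refine integrable_inv_one_add_sq.mono' (hm.pow 2) ?_
  filter_upwards with x
  have h0 : (0 : ℝ) < 1 + x ^ 2 := by positivity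
  have h1 : (1 + x ^ 2)⁻¹ ≤ 1 := inv_le_one_of_one_le₀ (by nlinarith [sq_nonneg x])
  have h2 : 0 < (1 + x ^ 2)⁻¹ := by positivity
  rw [Real.norm_of_nonneg (by positivity)]
  nlinarith

lemma integrable_weight_mul (u : L2) :
    Integrable (fun y : ℝ => (1 + y ^ 2)⁻¹ * ‖u y‖) volume :=
  memLp_inv_one_add_sq.integrable_mul (Lp.memLp u).norm

lemma aesm_kerR_mul (m : ℕ) (u : L2) :
    AEStronglyMeasurable (fun p : ℝ × ℝ => (kerR m p.1 p.2 : ℂ) * u p.2)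
      ((volume : Measure ℝ).prod volume) :=
  (Complex.measurable_ofReal.comp (measurable_kerR m)).aestronglyMeasurable.mul
    (Lp.aestronglyMeasurable u).comp_snd

lemma norm_kerR_mul_le (m : ℕ) (u : L2) (x y : ℝ) :
    ‖(kerR m x y : ℂ) * u y‖ ≤
      4 * m ^ 2 * (1 + x ^ 2)⁻¹ * ((1 + y ^ 2)⁻¹ * ‖u y‖) := by
  rw [norm_mul, Complex.norm_real, Real.norm_of_nonneg (kerR_nonneg m x y)]
  calc _ ≤ 4 * m ^ 2 * ((1 + x ^ 2)⁻¹ * (1 + y ^ 2)⁻¹) * ‖u y‖ :=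
        mul_le_mul_of_nonneg_right (kerR_le m x y) (norm_nonneg _)
    _ = _ := by ring

lemma integrable_kerR_mul (m : ℕ) (u : L2) (x : ℝ) :
    Integrable (fun y : ℝ => (kerR m x y : ℂ) * u y) volume := by
  refine ((integrable_weight_mul u).const_mul (4 * m ^ 2 * (1 + x ^ 2)⁻¹)).mono' ?_
    (Filter.Eventually.of_forall fun y => norm_kerR_mul_le m u x y)
  have h1 : Measurable (fun y : ℝ => Q m x - Q m y) :=
    measurable_const.sub (continuous_Q m).measurable
  have h2 : Measurable (fun y : ℝ => |x - y|) := (measurable_const.sub measurable_id).norm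
  have h0 : Measurable (fun y : ℝ => kerR m x y) :=
    ((h1.norm.pow_const 2).div (h2.pow_const 2)).const_mul _
  have h : Measurable (fun y : ℝ => (kerR m x y : ℂ)) := Complex.measurable_ofReal.comp h0
  exact h.aestronglyMeasurable.mul (Lp.aestronglyMeasurable u)

lemma memLp_RFun (m : ℕ) (u : L2) : MemLp (RFun m u) 2 volume := by
  refine MemLp.of_le_mul (g := fun x : ℝ => (1 + x ^ 2)⁻¹)
    (c := 4 * m ^ 2 * ∫ y : ℝ, (1 + y ^ 2)⁻¹ * ‖u y‖) memLp_inv_one_add_sq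
    (aesm_kerR_mul m u).integral_prod_right' ?_
  filter_upwards with x
  have h0 : (0 : ℝ) ≤ (1 + x ^ 2)⁻¹ := by positivity
  rw [Real.norm_of_nonneg h0]
  calc ‖RFun m u x‖ ≤ ∫ y : ℝ, 4 * m ^ 2 * (1 + x ^ 2)⁻¹ * ((1 + y ^ 2)⁻¹ * ‖u y‖) :=
        norm_integral_le_of_norm_le ((integrable_weight_mul u).const_mul _)
          (Filter.Eventually.of_forall fun y => norm_kerR_mul_le m u x y)
    _ = _ := by rw [integral_const_mul]; ring

/-- The integral operator `R` on `L²(ℝ)`. -/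
def ROp (m : ℕ) : L2 →ₗ[ℂ] L2 where
  toFun u := (memLp_RFun m u).toLp _
  map_add' u v := by
    rw [← MemLp.toLp_add]
    refine MemLp.toLp_congr _ _ (Filter.Eventually.of_forall fun x => ?_)
    simp only [RFun, Pi.add_apply]
    rw [← integral_add (integrable_kerR_mul m u x) (integrable_kerR_mul m v x)]
    refine integral_congr_ae ?_
    filter_upwards [Lp.coeFn_add u v] with y hy
    simp only [hy, Pi.add_apply, mul_add]
  map_smul' c u := by
    rw [RingHom.id_apply, ← MemLp.toLp_const_smul]
    refine MemLp.toLp_congr _ _ (Filter.Eventually.of_forall fun x => ?_)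
    simp only [RFun, Pi.smul_apply, smul_eq_mul]
    rw [← integral_const_mul]
    refine integral_congr_ae ?_
    filter_upwards [Lp.coeFn_smul c u] with y hy
    simp only [hy, Pi.smul_apply, smul_eq_mul]
    ring

/-- `L₊ = |∇| - |∂ₓ 𝐐_m|` on `L²(ℝ)` with domain `H¹(ℝ)`. -/
def LPlus (m : ℕ) : L2 →ₗ.[ℂ] L2 where
  domain := H1
  toFun := absGrad - (VOp m).comp H1.subtype

/-- `L₋ = |∇| - |∂ₓ 𝐐_m| + R` on `L²(ℝ)` with domain `H¹(ℝ)`. -/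
def LMinus (m : ℕ) : L2 →ₗ.[ℂ] L2 where
  domain := H1
  toFun := absGrad - (VOp m).comp H1.subtype + (ROp m).comp H1.subtype

/-- `𝓛 = [[0, -L₋], [L₊, 0]]` on `L²(ℝ) × L²(ℝ)` with domain `H¹(ℝ) × H¹(ℝ)`. -/
def JL (m : ℕ) : (L2 × L2) →ₗ.[ℂ] (L2 × L2) where
  domain := H1.prod H1
  toFun :=
    { toFun := fun p => (-(LMinus m ⟨p.1.2, p.2.2⟩), LPlus m ⟨p.1.1, p.2.1⟩)
      map_add' := by
        intro p q
        refine Prod.ext ?_ ?_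
        · change -(LMinus m (⟨p.1.2, p.2.2⟩ + ⟨q.1.2, q.2.2⟩)) = _
          rw [LinearPMap.map_add, neg_add]
          rfl
        · exact (LPlus m).map_add ⟨p.1.1, p.2.1⟩ ⟨q.1.1, q.2.1⟩
      map_smul' := by
        intro c p
        refine Prod.ext ?_ ?_
        · change -(LMinus m (c • ⟨p.1.2, p.2.2⟩)) = _
          rw [LinearPMap.map_smul, ← smul_neg]
          rfl
        · exact (LPlus m).map_smul c ⟨p.1.1, p.2.1⟩ }

/-- `E 0 < E 1 < ⋯ < E (2m-1) = 0` is the list of all eigenvalues of `L₊`, every one of them is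
simple, and `φ 0, …, φ (2m-1)` are corresponding `L²`-orthonormalized eigenfunctions. -/
structure IsEigenSystem (m : ℕ) (E : Fin (2 * m) → ℝ) (φ : Fin (2 * m) → L2) : Prop where
  strictMono : StrictMono E
  last : ∀ k : Fin (2 * m), (k : ℕ) + 1 = 2 * m → E k = 0
  pointSpectrum_eq : pointSpectrum (LPlus m) = Set.range fun k => (E k : ℂ)
  eigen : ∀ k, EigenEq (LPlus m) (E k : ℂ) (φ k)
  simple : ∀ k, ∀ ψ : L2, EigenEq (LPlus m) (E k : ℂ) ψ → ∃ c : ℂ, ψ = c • φ k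
  orthonormal : Orthonormal ℂ φ

/-! ### Zero-energy solutions in `Ḣ^{1/2}` and resonances -/

/-- `f ∈ Ḣ^{1/2}(ℝ)`: `∫ |f| / (1 + x²) < ∞` and
`∬ |f(x) - f(y)|² / |x - y|² dx dy < ∞`. -/
def MemHHalf (f : ℝ → ℂ) : Prop :=
  Integrable (fun x : ℝ => f x / (1 + (x : ℂ) ^ 2)) volume ∧
  Integrable (fun p : ℝ × ℝ => ‖f p.1 - f p.2‖ ^ 2 / |p.1 - p.2| ^ 2) (volume.prod volume)

/-- `|∇| ψ` for a Schwartz function `ψ`; this function is `O(1 / (1 + x²))`. -/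
def absGradS (ψ : 𝓢(ℝ, ℂ)) : ℝ → ℂ :=
  𝓕⁻ (fun ξ : ℝ => absSymbol ξ * 𝓕 (ψ : ℝ → ℂ) ξ)

/-- The distribution `L₊ u = |∇| u - |∂ₓ 𝐐_m| u`, with `|∇| u` defined by duality. -/
def LPlusDist (m : ℕ) (u : ℝ → ℂ) (ψ : 𝓢(ℝ, ℂ)) : ℂ :=
  (∫ x, u x * absGradS ψ x) - ∫ x, (V m x : ℂ) * u x * ψ x

/-- The distribution `L₋ u = |∇| u - |∂ₓ 𝐐_m| u + R u`, with `|∇| u` defined by duality. -/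
def LMinusDist (m : ℕ) (u : ℝ → ℂ) (ψ : 𝓢(ℝ, ℂ)) : ℂ :=
  (∫ x, u x * absGradS ψ x) - (∫ x, (V m x : ℂ) * u x * ψ x) + ∫ x, RFun m u x * ψ x

/-- `(u, v) ∈ Ḣ^{1/2} × Ḣ^{1/2}` and `𝓛 (u, v) = (-L₋ v, L₊ u) = 0` as distributions. -/
def IsZeroState (m : ℕ) (p : (ℝ → ℂ) × (ℝ → ℂ)) : Prop :=
  MemHHalf p.1 ∧ MemHHalf p.2 ∧
    ∀ ψ : 𝓢(ℝ, ℂ), (-LMinusDist m p.2 ψ, LPlusDist m p.1 ψ) = 0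

/-- Membership of a pair of functions in `L² × L²`. -/
def MemL2Pair (p : (ℝ → ℂ) × (ℝ → ℂ)) : Prop :=
  MemLp p.1 2 volume ∧ MemLp p.2 2 volume

/-- A resonance of `𝓛` at energy zero. -/
def IsResonance (m : ℕ) (p : (ℝ → ℂ) × (ℝ → ℂ)) : Prop :=
  IsZeroState m p ∧ ¬ MemL2Pair p

/-- The function `φ`: it is `g_m` for odd `m` and `f_m` for even `m`. -/
def resonance (m : ℕ) (x : ℝ) : ℂ := if Odd m then (gk m x : ℂ) else (fk m x : ℂ)

end HalfHarmonic

end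

open HalfHarmonic

namespace HalfHarmonic

open Filter Topology Complex

/-! ### The Cayley transform -/

/-! The Cayley transform `cay` carries the line to the circle with arc length `wt x dx`, and in this
variable the operators are explicit on the characters `cay ^ k`. The operator |∇| sends `cay ^ k -
1` to `|k| wt cay ^ k` (`hasAbsGrad_cay_zpow`), the potential is `m wt` (`V_eq`), and the kernel of
R is a Fejér kernel times the two weights (`kerR_eq`), so R has finite rank and carries the
coefficient `(m - |k|)₊`. Adding these, L₋ sends `cay ^ k - 1` to `(|k| - m)₊ wt cay ^ k`
(`LMinusH_ev`). Hence ker L₋ is the 2m-dimensional space `trigPoly m` of trigonometric polynomials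
of degree at most m vanishing at infinity. The range of R lies in it, so L₋ R = 0, and by symmetry R
L₋ = 0 (`ROp_LMinusH`), while L₊ = L₋ - R.

The analytic core is that eigenfunctions of L₊ are trigonometric polynomials
(`LPlusH_eigen_support`). Pairing the eigenvalue equation with `cay ^ k - 1` gives, beyond the
frequency m, a discrete Coulomb equation for sequences with square summable differences, and this
has no nonzero solution when the eigenvalue is nonzero (`eq_zero_of_recurrence_real`). Such an
eigenfunction is determined by its moment of frequency m (`LPlusH_eigen_eq_zero`), which gives
simplicity. On `trigPoly m` the operator L₊ is -R with R nonnegative, so the finite-dimensional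
spectral theorem yields all eigenfunctions.

An eigenvector of L₋ for a nonzero eigenvalue is killed by R, so it is an eigenvector of L₊, hence
lies in ker L₋ and vanishes. If 𝓛(u, v) = z(u, v) with z nonzero, applying R gives R u = 0; then u ±
i v are eigenvectors of L₋ for nonzero eigenvalues and vanish. The same change of variables builds
the resolvent of 𝓛 off the imaginary axis from those of the self-adjoint operator L₋
(`mem_presolventSet_JL`), and slowly varying wave packets place the whole imaginary axis in the
spectrum (`exists_quasimode`). On `trigPoly m × trigPoly m`, 𝓛 is (u, v) ↦ (0, -R u), whose square
is zero; symmetry of L₋ shows that nothing else is nilpotent.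

For the resonances, the zero-energy equations are tested against Schwartz functions approximating
`cay ^ k - 1` (`exists_approx_cay_zpow`). All moments beyond m vanish, so each component is a
trigonometric polynomial of degree at most m. It is square integrable once its value at infinity is
removed, and a multiple of `resonance m` does that. -/

/-- The Cayley transform `(x - i) / (x + i)` of the real line onto the circle. -/
noncomputable def cay (x : ℝ) : ℂ := ((x : ℂ) - I) / ((x : ℂ) + I)

/-- The density `2 / (1 + x²)` of the arc length of the circle. -/
noncomputable def wt (x : ℝ) : ℝ := 2 / (1 + x ^ 2)

lemma norm_cay (x : ℝ) : ‖cay x‖ = 1 := by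
  have h := norm_Qc_one x
  rwa [norm_mul, Complex.norm_I, one_mul] at h

lemma cay_ne_zero (x : ℝ) : cay x ≠ 0 := by
  rw [← norm_ne_zero_iff, norm_cay]; exact one_ne_zero

lemma norm_cay_zpow (x : ℝ) (k : ℤ) : ‖cay x ^ k‖ = 1 := by
  rw [norm_zpow, norm_cay, one_zpow]

lemma xsubI_ne (x : ℝ) : (x : ℂ) - I ≠ 0 := by
  intro h
  have := congrArg Complex.im h
  simp at this

lemma one_add_sq_ne (x : ℝ) : (1 : ℂ) + (x : ℂ) ^ 2 ≠ 0 := by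
  have h : (1 : ℝ) + x ^ 2 ≠ 0 := by positivity
  exact_mod_cast h

lemma xsubI_mul_xaddI (x : ℝ) : ((x : ℂ) - I) * ((x : ℂ) + I) = 1 + (x : ℂ) ^ 2 := by
  linear_combination (-1 : ℂ) * Complex.I_sq

lemma conj_cay (x : ℝ) : (starRingEnd ℂ) (cay x) = (cay x)⁻¹ := by
  simp [cay, sub_eq_add_neg]

lemma conj_cay_zpow (x : ℝ) (k : ℤ) : (starRingEnd ℂ) (cay x ^ k) = cay x ^ (-k) := by
  rw [map_zpow₀, conj_cay, inv_zpow, zpow_neg]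

lemma wt_pos (x : ℝ) : 0 < wt x := by unfold wt; positivity

lemma wt_le (x : ℝ) : wt x ≤ 2 := by
  unfold wt
  rw [div_le_iff₀ (by positivity)]
  nlinarith [sq_nonneg x]

lemma wt_eq_inv (x : ℝ) : wt x = 2 * (1 + x ^ 2)⁻¹ := by
  rw [wt, div_eq_mul_inv]

/-- The weight is half of |cay - 1|², and so a trigonometric polynomial of degree one. This makes
moments against `wt cay ^ k` second differences of pairings with `cay ^ k - 1`. -/
lemma wt_eq (x : ℝ) : (wt x : ℂ) = 1 - (cay x + (cay x)⁻¹) / 2 := by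
  have h1 := xaddI_ne x
  have h2 := xsubI_ne x
  have h3 := one_add_sq_ne x
  rw [cay, wt]
  push_cast
  rw [inv_div, ← xsubI_mul_xaddI]
  field_simp
  linear_combination (4 : ℂ) * Complex.I_sq

/-- The coefficients 1, -2, 1 sum to zero, so the constants -1 can be inserted for free; they make
each term square integrable. -/
lemma wt_mul_cay_zpow (x : ℝ) (k : ℤ) : (wt x : ℂ) * cay x ^ k =
    -(1 / 2) * ((cay x ^ (k + 1) - 1) - 2 * (cay x ^ k - 1) + (cay x ^ (k - 1) - 1)) := by
  rw [wt_eq, zpow_add_one₀ (cay_ne_zero x), zpow_sub_one₀ (cay_ne_zero x)]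
  ring

lemma hasDerivAt_cay (x : ℝ) : HasDerivAt cay (I * wt x * cay x) x := by
  have h1 := xaddI_ne x
  have h2 := xsubI_ne x
  have hx : HasDerivAt (fun y : ℝ => (y : ℂ)) 1 x := Complex.ofRealCLM.hasDerivAt
  have h := (hx.sub_const I).div (hx.add_const I) h1
  convert! h using 1
  rw [cay, wt]
  push_cast
  rw [← xsubI_mul_xaddI]
  field_simp
  ring

lemma hasDerivAt_cay_zpow (k : ℤ) (x : ℝ) :
    HasDerivAt (fun y => cay y ^ k) (I * k * (wt x * cay x ^ k)) x := by
  have h := (hasDerivAt_zpow k (cay x) (Or.inl (cay_ne_zero x))).comp x (hasDerivAt_cay x)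
  convert! h using 1
  rw [zpow_sub_one₀ (cay_ne_zero x)]
  have := cay_ne_zero x
  field_simp

lemma continuous_cay_zpow (k : ℤ) : Continuous (fun x => cay x ^ k) :=
  continuous_iff_continuousAt.2 fun x => (hasDerivAt_cay_zpow k x).continuousAt

lemma continuous_cay : Continuous cay :=
  continuous_iff_continuousAt.2 fun x => (hasDerivAt_cay x).continuousAt

lemma continuous_wt : Continuous wt := by
  unfold wt
  exact continuous_const.div (by fun_prop) fun x => by positivity

lemma norm_cay_sub_one_sq (x : ℝ) : ‖cay x - 1‖ ^ 2 = 2 * wt x := by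
  have h : cay x - 1 = -2 * I / ((x : ℂ) + I) := by
    have h1 := xaddI_ne x
    rw [cay]
    field_simp
    ring
  rw [h, norm_div, div_pow, norm_xaddI, wt]
  simp
  ring

lemma tendsto_cay_cocompact : Tendsto cay (cocompact ℝ) (𝓝 1) := by
  rw [tendsto_iff_norm_sub_tendsto_zero]
  have h1 : Tendsto (fun x : ℝ => 2 / ‖x‖) (cocompact ℝ) (𝓝 0) :=
    tendsto_const_nhds.div_atTop (tendsto_norm_cocompact_atTop)
  have hev : ∀ᶠ x : ℝ in cocompact ℝ, 1 ≤ ‖x‖ :=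
    (tendsto_norm_cocompact_atTop).eventually_ge_atTop 1
  refine squeeze_zero' (Eventually.of_forall fun x => norm_nonneg _) ?_ h1
  filter_upwards [hev] with x hx
  refine le_of_sq_le_sq ?_ (by positivity)
  rw [norm_cay_sub_one_sq, wt, div_pow, Real.norm_eq_abs, sq_abs, ← mul_div_assoc]
  have : 0 < x ^ 2 := by rw [← sq_abs]; rw [Real.norm_eq_abs] at hx; positivity
  rw [div_le_div_iff₀ (by positivity) this]
  nlinarith

lemma tendsto_cay_zpow_cocompact (k : ℤ) :
    Tendsto (fun x => cay x ^ k) (cocompact ℝ) (𝓝 1) := by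
  have h := tendsto_cay_cocompact.zpow₀ k (Or.inl one_ne_zero)
  rwa [one_zpow] at h

lemma integrable_wt : Integrable wt := by
  have : wt = fun x => 2 * (1 + x ^ 2)⁻¹ := funext wt_eq_inv
  rw [this]
  exact integrable_inv_one_add_sq.const_mul 2

lemma integrable_cay_zpow_mul_wt (k : ℤ) : Integrable (fun x => (wt x : ℂ) * cay x ^ k) :=
  (integrable_wt.ofReal).mul_of_top_left
    (memLp_top_of_bound (continuous_cay_zpow k).aestronglyMeasurable 1
      (Eventually.of_forall fun x => (norm_cay_zpow x k).le))

/-- Orthogonality of the characters: for k ≠ 0 the integrand is, up to the factor i k, the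
derivative of `cay ^ k`, which has the same limit 1 at both ends of the line. -/
lemma integral_wt_mul_cay_zpow (k : ℤ) :
    ∫ x, (wt x : ℂ) * cay x ^ k = if k = 0 then 2 * (Real.pi : ℂ) else 0 := by
  split_ifs with hk
  · subst hk
    simp only [zpow_zero, mul_one]
    rw [integral_complex_ofReal]
    have : wt = fun x => 2 * (1 + x ^ 2)⁻¹ := funext wt_eq_inv
    rw [this, integral_const_mul, integral_univ_inv_one_add_sq]
    push_cast
    ring
  · have h := integral_of_hasDerivAt_of_tendsto (hasDerivAt_cay_zpow k)
      ((integrable_cay_zpow_mul_wt k).const_mul (I * k))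
      ((tendsto_cay_zpow_cocompact k).mono_left atBot_le_cocompact)
      ((tendsto_cay_zpow_cocompact k).mono_left atTop_le_cocompact)
    rw [integral_const_mul, sub_self] at h
    refine (mul_eq_zero.1 h).resolve_left ?_
    simp [hk]

/-! ### Completeness of the trigonometric system -/

lemma cay_injective : Function.Injective cay := by
  intro x y h
  have hx := xaddI_ne x
  have hy := xaddI_ne y
  rw [cay, cay, div_eq_div_iff hx hy] at h
  have : (2 * I) * ((x : ℂ) - y) = 0 := by linear_combination h
  have h2 : (x : ℂ) - y = 0 := (mul_eq_zero.1 this).resolve_left (by simp)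
  exact_mod_cast sub_eq_zero.1 h2

lemma cay_ne_one (x : ℝ) : cay x ≠ 1 := by
  intro h
  have := norm_cay_sub_one_sq x
  rw [h, sub_self, norm_zero] at this
  have h2 := wt_pos x
  norm_num at this
  linarith

/-- The Cayley transform extended to the one-point compactification. -/
noncomputable def cayInfty : C(OnePoint ℝ, ℂ) :=
  OnePoint.continuousMapMk ⟨cay, continuous_cay⟩ 1 (by
    rw [coclosedCompact_eq_cocompact]; exact tendsto_cay_cocompact)

lemma cayInfty_coe (x : ℝ) : cayInfty (x : OnePoint ℝ) = cay x := rfl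

lemma cayInfty_infty : cayInfty (OnePoint.infty : OnePoint ℝ) = 1 := rfl

/-- Stone–Weierstrass: `cay` is injective on the line and never takes the value 1 that is assigned
to infinity, so this single function separates points. -/
lemma adjoin_cayInfty_topologicalClosure :
    (StarAlgebra.adjoin ℂ {cayInfty}).topologicalClosure = ⊤ := by
  apply ContinuousMap.starSubalgebra_topologicalClosure_eq_top_of_separatesPoints
  intro x y hxy
  refine ⟨cayInfty, ⟨cayInfty, StarAlgebra.self_mem_adjoin_singleton ℂ _, rfl⟩, ?_⟩
  induction x using OnePoint.rec with
  | infty =>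
    induction y using OnePoint.rec with
    | infty => exact absurd rfl hxy
    | coe y => rw [cayInfty_coe, cayInfty_infty]; exact (cay_ne_one y).symm
  | coe x =>
    induction y using OnePoint.rec with
    | infty => rw [cayInfty_coe, cayInfty_infty]; exact cay_ne_one x
    | coe y =>
      rw [cayInfty_coe, cayInfty_coe]
      exact fun h => hxy (congrArg _ (cay_injective h))

/-- On the circle conjugation is inversion, so the generated monoid contains only integer powers. -/
lemma exists_zpow_of_mem_closure {h : C(OnePoint ℝ, ℂ)}
    (hh : h ∈ Submonoid.closure ({cayInfty} ∪ star {cayInfty} : Set C(OnePoint ℝ, ℂ))) :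
    ∃ k : ℤ, ∀ x : ℝ, h (x : OnePoint ℝ) = cay x ^ k := by
  induction hh using Submonoid.closure_induction with
  | mem f hf =>
    rcases hf with hf | hf
    · rw [Set.mem_singleton_iff.1 hf]
      exact ⟨1, fun x => by rw [zpow_one, cayInfty_coe]⟩
    · rw [Set.star_singleton, Set.mem_singleton_iff] at hf
      refine ⟨-1, fun x => ?_⟩
      rw [hf, zpow_neg_one, ContinuousMap.star_apply, cayInfty_coe, ← conj_cay]
      rfl
  | one => exact ⟨0, fun x => by simp⟩
  | mul f g _ _ hf hg =>
    obtain ⟨k, hk⟩ := hf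
    obtain ⟨l, hl⟩ := hg
    exact ⟨k + l, fun x => by rw [ContinuousMap.mul_apply, hk, hl, zpow_add₀ (cay_ne_zero x)]⟩

lemma integrable_mul_of_continuousMap {f : ℝ → ℂ} (hf : Integrable f) (h : C(OnePoint ℝ, ℂ)) :
    Integrable (fun x : ℝ => h (x : OnePoint ℝ) * f x) :=
  hf.bdd_mul (c := ‖h‖)
    ((h.continuous.comp OnePoint.continuous_coe).aestronglyMeasurable)
    (Eventually.of_forall fun _ => h.norm_coe_le_norm _)

/-- An integrable function all of whose moments against the powers of the Cayley transform vanish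
is zero. -/
lemma ae_eq_zero_of_integral_cay_zpow {f : ℝ → ℂ} (hf : Integrable f)
    (h : ∀ k : ℤ, ∫ x, cay x ^ k * f x = 0) : ∀ᵐ x, f x = 0 := by
  let Φ : C(OnePoint ℝ, ℂ) →ₗ[ℂ] ℂ :=
    { toFun := fun g => ∫ x : ℝ, g (x : OnePoint ℝ) * f x
      map_add' := fun g₁ g₂ => by
        rw [← integral_add (integrable_mul_of_continuousMap hf g₁)
          (integrable_mul_of_continuousMap hf g₂)]
        simp [add_mul]
      map_smul' := fun c g => by
        rw [RingHom.id_apply, smul_eq_mul, ← integral_const_mul]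
        simp [mul_assoc] }
  have hΦ : Continuous Φ := by
    refine (Φ.mkContinuous (∫ x, ‖f x‖) fun g => ?_).continuous
    calc ‖Φ g‖ ≤ ∫ x, ‖g‖ * ‖f x‖ :=
          norm_integral_le_of_norm_le (hf.norm.const_mul _) (Eventually.of_forall fun x => by
            rw [norm_mul]
            exact mul_le_mul_of_nonneg_right (g.norm_coe_le_norm _) (norm_nonneg _))
      _ = _ := by rw [integral_const_mul, mul_comm]
  have h0 : ∀ g : C(OnePoint ℝ, ℂ), Φ g = 0 := by
    intro g
    have hg : g ∈ closure ((StarAlgebra.adjoin ℂ {cayInfty} : StarSubalgebra ℂ _) : Set _) := by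
      rw [← StarSubalgebra.topologicalClosure_coe, adjoin_cayInfty_topologicalClosure]
      trivial
    refine closure_minimal (t := {g | Φ g = 0}) ?_ (isClosed_eq hΦ continuous_const) hg
    intro p hp
    have hp' : p ∈ Submodule.span ℂ (Submonoid.closure
        ({cayInfty} ∪ star {cayInfty} : Set C(OnePoint ℝ, ℂ)) : Set C(OnePoint ℝ, ℂ)) := by
      rw [← StarAlgebra.adjoin_eq_span]; exact hp
    have hle : Submodule.span ℂ (Submonoid.closure
        ({cayInfty} ∪ star {cayInfty} : Set C(OnePoint ℝ, ℂ)) : Set C(OnePoint ℝ, ℂ)) ≤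
        LinearMap.ker Φ := by
      rw [Submodule.span_le]
      intro q hq
      obtain ⟨k, hk⟩ := exists_zpow_of_mem_closure hq
      change (∫ x : ℝ, q (x : OnePoint ℝ) * f x) = 0
      simp_rw [hk]
      exact h k
    exact hle hp'
  -- A compactly supported test function extends by 0 to the compactification, where `h0` applies.
  refine ae_eq_zero_of_integral_contDiff_smul_eq_zero hf.locallyIntegrable fun g hg hgs => ?_
  have ht : Tendsto (fun x => (g x : ℂ)) (coclosedCompact ℝ) (𝓝 0) := by
    rw [coclosedCompact_eq_cocompact]
    have := hgs.is_zero_at_infty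
    exact (Complex.continuous_ofReal.tendsto 0).comp this
  have := h0 (OnePoint.continuousMapMk
    ⟨fun x => (g x : ℂ), Complex.continuous_ofReal.comp hg.continuous⟩ 0 ht)
  refine Eq.trans ?_ this
  rfl

/-! ### The potential and the kernel -/

lemma Qc_eq (k : ℕ) (x : ℝ) : Qc k x = I ^ k * cay x ^ (k : ℤ) := by
  rw [Qc, mul_pow, zpow_natCast]; rfl

/-- The point `cay x` moves on the circle with angular speed `wt x`, and its m-th power m times as
fast. -/
lemma V_eq (m : ℕ) (x : ℝ) : V m x = m * wt x := by
  have h : HasDerivAt (Qc m) (I ^ m * (I * m * (wt x * cay x ^ (m : ℤ)))) x := by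
    have h1 := (hasDerivAt_cay_zpow (m : ℤ) x).const_mul (I ^ m)
    have h2 : Qc m = fun y => I ^ m * cay y ^ (m : ℤ) := funext (Qc_eq m)
    rw [h2]
    convert! h1 using 1
  set D := I ^ m * (I * m * (wt x * cay x ^ (m : ℤ))) with hD
  have hre : HasDerivAt (fk m) D.re x := (Complex.reCLM.hasFDerivAt.comp_hasDerivAt x h)
  have him : HasDerivAt (gk m) D.im x := (Complex.imCLM.hasFDerivAt.comp_hasDerivAt x h)
  have hQ : HasDerivAt (Q m) (!₂[D.re, D.im, 0] : EuclideanSpace ℝ (Fin 3)) x := by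
    have h3 : HasDerivAt (fun y => ![fk m y, gk m y, 0]) ![D.re, D.im, 0] x := by
      rw [hasDerivAt_pi]
      intro i
      fin_cases i
      · exact hre
      · exact him
      · exact hasDerivAt_const x (0 : ℝ)
    exact ((PiLp.continuousLinearEquiv 2 ℝ (fun _ : Fin 3 => ℝ)).symm.hasFDerivAt.comp_hasDerivAt
      x h3)
  rw [V, hQ.deriv]
  have h4 : ‖(!₂[D.re, D.im, 0] : EuclideanSpace ℝ (Fin 3))‖ = ‖D‖ := by
    rw [EuclideanSpace.norm_eq, Fin.sum_univ_three, Complex.norm_eq_sqrt_sq_add_sq]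
    simp
  rw [h4, hD]
  simp [norm_cay, abs_of_pos (wt_pos x)]

lemma V_eq_cast (m : ℕ) (x : ℝ) : (V m x : ℂ) = m * wt x := by
  rw [V_eq]; push_cast; rfl

/-- The kernel of `R` is a Fejér kernel in the variable of the circle. -/
lemma kerR_eq (m : ℕ) {x y : ℝ} (hxy : x ≠ y) : (kerR m x y : ℂ) =
    ∑ j ∈ Finset.range m, ∑ l ∈ Finset.range m, 1 / (2 * (Real.pi : ℂ)) *
      ((wt x * cay x ^ ((j : ℤ) - l)) * (wt y * cay y ^ (-((j : ℤ) - l)))) := by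
  have hd : cay x - cay y = 2 * I * ((x - y : ℝ) : ℂ) / (((x : ℂ) + I) * ((y : ℂ) + I)) := by
    have hx := xaddI_ne x
    have hy := xaddI_ne y
    rw [cay, cay]
    push_cast
    field_simp
    ring
  -- Factor a^m - b^m by the geometric sum; the remaining factor satisfies |cay x - cay y|² = |x -
  -- y|² wt x wt y and cancels the singular denominator.
  have h1 : ‖Q m x - Q m y‖ ^ 2 = ‖∑ j ∈ Finset.range m, cay x ^ j * cay y ^ (m - 1 - j)‖ ^ 2 *
      (|x - y| ^ 2 * (wt x * wt y)) := by
    rw [norm_Q_sub_sq, Qc_eq, Qc_eq, ← mul_sub, zpow_natCast, zpow_natCast,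
      ← (Commute.all (cay x) (cay y)).geom_sum₂_mul m, norm_mul, norm_mul, hd, norm_div]
    simp only [norm_mul, norm_pow, Complex.norm_I, one_pow, one_mul, mul_pow, div_pow, norm_xaddI,
      wt]
    rw [Complex.norm_real, Real.norm_eq_abs]
    have hx : (1 + x ^ 2) ≠ 0 := by positivity
    have hy : (1 + y ^ 2) ≠ 0 := by positivity
    norm_num
    field_simp
    norm_num
  have h2 : kerR m x y = 1 / (2 * Real.pi) *
      (‖∑ j ∈ Finset.range m, cay x ^ j * cay y ^ (m - 1 - j)‖ ^ 2 * (wt x * wt y)) := by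
    have h0 : |x - y| ^ 2 ≠ 0 := by
      have := abs_pos.mpr (sub_ne_zero.mpr hxy)
      positivity
    rw [kerR, h1]
    field_simp
  rw [h2]
  push_cast
  rw [← Complex.mul_conj', map_sum, Finset.sum_mul_sum, Finset.sum_mul, Finset.mul_sum]
  refine Finset.sum_congr rfl fun j hj => ?_
  rw [Finset.sum_mul, Finset.mul_sum]
  refine Finset.sum_congr rfl fun l hl => ?_
  have hx := cay_ne_zero x
  have hy := cay_ne_zero y
  have hj' := Finset.mem_range.1 hj
  have hl' := Finset.mem_range.1 hl
  rw [map_mul, map_pow, map_pow, conj_cay, conj_cay]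
  have e1 : cay x ^ ((j : ℤ) - l) = cay x ^ j * (cay x)⁻¹ ^ l := by
    rw [zpow_sub₀ hx, zpow_natCast, zpow_natCast, inv_pow, div_eq_mul_inv]
  have e2 : cay y ^ (-((j : ℤ) - l)) = cay y ^ (m - 1 - j) * (cay y)⁻¹ ^ (m - 1 - l) := by
    rw [← zpow_natCast (cay y), ← zpow_natCast (cay y)⁻¹, inv_zpow, ← zpow_neg, ← zpow_add₀ hy]
    congr 1
    omega
  rw [e1, e2]
  ring

/-- The moments of `u` against the powers of the Cayley transform. -/
noncomputable def moment (u : ℝ → ℂ) (k : ℤ) : ℂ := ∫ y, u y * (wt y * cay y ^ (-k))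

lemma integrable_mul_wt_cay {u : ℝ → ℂ} (hu : Integrable (fun y => u y * wt y)) (k : ℤ) :
    Integrable (fun y => u y * (wt y * cay y ^ k)) := by
  have h := hu.mul_of_top_left (φ := fun y => u y * wt y) (f := fun y => cay y ^ k)
    (memLp_top_of_bound (continuous_cay_zpow k).aestronglyMeasurable 1
      (Eventually.of_forall fun x => (norm_cay_zpow x k).le))
  refine h.congr (Eventually.of_forall fun y => ?_)
  simp only [Pi.mul_apply]
  ring

lemma RFun_eq (m : ℕ) {u : ℝ → ℂ} (hu : Integrable (fun y => u y * wt y)) (x : ℝ) :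
    RFun m u x = ∑ j ∈ Finset.range m, ∑ l ∈ Finset.range m, 1 / (2 * (Real.pi : ℂ)) *
      moment u ((j : ℤ) - l) * (wt x * cay x ^ ((j : ℤ) - l)) := by
  -- On the diagonal the kernel is 0 by the convention for division and differs in general from the
  -- Fejér sum; the diagonal point is negligible.
  have hne : ∀ᵐ y : ℝ, y ≠ x := by simp [ae_iff]
  have h1 : RFun m u x = ∫ y, ∑ j ∈ Finset.range m, ∑ l ∈ Finset.range m,
      (1 / (2 * (Real.pi : ℂ)) * (wt x * cay x ^ ((j : ℤ) - l))) *
        (u y * (wt y * cay y ^ (-((j : ℤ) - l)))) := by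
    refine integral_congr_ae ?_
    filter_upwards [hne] with y hy
    rw [kerR_eq m hy.symm, Finset.sum_mul]
    refine Finset.sum_congr rfl fun j _ => ?_
    rw [Finset.sum_mul]
    refine Finset.sum_congr rfl fun l _ => ?_
    ring
  have hi : ∀ j l : ℕ, Integrable (fun y => (1 / (2 * (Real.pi : ℂ)) *
      (wt x * cay x ^ ((j : ℤ) - l))) * (u y * (wt y * cay y ^ (-((j : ℤ) - l))))) := fun j l =>
    (integrable_mul_wt_cay hu _).const_mul _
  rw [h1, integral_finsetSum _ fun j _ => integrable_finsetSum _ fun l _ => hi j l]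
  refine Finset.sum_congr rfl fun j _ => ?_
  rw [integral_finsetSum _ fun l _ => hi j l]
  refine Finset.sum_congr rfl fun l _ => ?_
  rw [integral_const_mul, moment]
  ring

/-- The number of representations of `k` as a difference of two numbers below `m`. -/
lemma sum_sum_ite_sub_eq (m : ℕ) (k : ℤ) :
    (∑ j ∈ Finset.range m, ∑ l ∈ Finset.range m, if (j : ℤ) - l = k then (1 : ℂ) else 0) =
      ((m - k.natAbs : ℕ) : ℂ) := by
  rw [← Finset.sum_product', Finset.sum_boole]
  congr 1
  rcases le_total 0 k with hk | hk
  · rw [show m - k.natAbs = (Finset.range (m - k.natAbs)).card by simp]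
    symm
    refine Finset.card_nbij (fun l => (l + k.natAbs, l)) ?_ ?_ ?_
    · intro l hl
      simp only [Finset.coe_range, Set.mem_Iio] at hl
      simp only [Finset.coe_filter, Finset.mem_product, Finset.mem_range, Set.mem_ofPred_eq]
      omega
    · intro a _ b _ hab
      simpa using congrArg Prod.snd hab
    · rintro ⟨a, b⟩ hab
      simp only [Finset.coe_filter, Finset.mem_product, Finset.mem_range, Set.mem_ofPred_eq] at hab
      simp only [Finset.coe_range, Set.mem_image, Set.mem_Iio, Prod.mk.injEq]
      exact ⟨b, by omega, by omega, by omega⟩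
  · rw [show m - k.natAbs = (Finset.range (m - k.natAbs)).card by simp]
    symm
    refine Finset.card_nbij (fun l => (l, l + k.natAbs)) ?_ ?_ ?_
    · intro l hl
      simp only [Finset.coe_range, Set.mem_Iio] at hl
      simp only [Finset.coe_filter, Finset.mem_product, Finset.mem_range, Set.mem_ofPred_eq]
      omega
    · intro a _ b _ hab
      simpa using congrArg Prod.fst hab
    · rintro ⟨a, b⟩ hab
      simp only [Finset.coe_filter, Finset.mem_product, Finset.mem_range, Set.mem_ofPred_eq] at hab
      simp only [Finset.coe_range, Set.mem_image, Set.mem_Iio, Prod.mk.injEq]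
      exact ⟨a, by omega, by omega, by omega⟩

/-! ### Sequences -/

/-- The discrete Coulomb equation has no solution with square summable differences. -/
lemma eq_zero_of_recurrence_real {E : ℝ} (hE : E ≠ 0) {x : ℕ → ℝ} (h0 : x 0 = 0)
    (hrec : ∀ n : ℕ, (n + 1 : ℝ) * (x (n + 2) - 2 * x (n + 1) + x n) = -2 * E * x (n + 1))
    (hs : Summable fun n => (x (n + 1) - x n) ^ 2) : ∀ n, x n = 0 := by
  have hx1 : x 1 = 0 := by
    by_contra hx1
    set d : ℕ → ℝ := fun n => x (n + 1) - x n with hd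
    have hd0 : d 0 = x 1 := by simp [hd, h0]
    rcases lt_or_gt_of_ne hE with hE | hE
    · -- the quantity `x (n + 1) * d n` does not decrease
      have hlim : Tendsto (fun n => d n ^ 2) atTop (𝓝 0) := hs.tendsto_atTop_zero
      have key : ∀ n, x 1 ^ 2 ≤ x 1 * d n ∧ 0 ≤ x 1 * x n := by
        intro n
        induction n with
        | zero => rw [hd0, h0]; constructor <;> nlinarith
        | succ n ih =>
          have h1 : 0 ≤ x 1 * x (n + 1) := by
            have : x (n + 1) = d n + x n := by simp [hd]
            rw [this]
            nlinarith [ih.1, ih.2, sq_nonneg (x 1)]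
          refine ⟨?_, h1⟩
          have h2 : (n + 1 : ℝ) * (d (n + 1) - d n) = -2 * E * x (n + 1) := by
            rw [← hrec n]; simp only [hd]; ring
          have h3 : 0 ≤ (n + 1 : ℝ) * (x 1 * d (n + 1) - x 1 * d n) := by
            have : (n + 1 : ℝ) * (x 1 * d (n + 1) - x 1 * d n) = -2 * E * (x 1 * x (n + 1)) := by
              linear_combination x 1 * h2
            rw [this]
            exact mul_nonneg (by linarith) h1
          have h4 := nonneg_of_mul_nonneg_right h3 (by positivity)
          linarith [ih.1]
      have h5 : ∀ n, x 1 ^ 2 ≤ d n ^ 2 := by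
        intro n
        have h6 := (key n).1
        have h7 : 0 < x 1 ^ 2 := by positivity
        have h8 : 0 ≤ (x 1 * d n - x 1 ^ 2) ^ 2 := sq_nonneg _
        by_contra h9
        push Not at h9
        nlinarith [sq_nonneg (d n - x 1)]
      have h6 := ge_of_tendsto' hlim h5
      have h7 : 0 < x 1 ^ 2 := by positivity
      linarith
    · have hrec' : ∀ n : ℕ, (n + 1 : ℝ) * (d (n + 1) - d n) = -2 * E * x (n + 1) := by
        intro n
        rw [← hrec n]; simp only [hd]; ring
      -- monotone energy
      have hJ : ∀ n : ℕ, x 1 ^ 2 ≤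
          (n + 1 : ℝ) * d (n + 1) ^ 2 + 2 * E * (x (n + 1) * x (n + 2)) := by
        intro n
        have step : ∀ n : ℕ, (n + 1 : ℝ) * d (n + 1) ^ 2 + 2 * E * (x (n + 1) * x (n + 2)) =
            (n : ℝ) * d n ^ 2 + 2 * E * (x n * x (n + 1)) + d n ^ 2 := by
          intro n
          have e1 : x (n + 2) = x (n + 1) + d (n + 1) := by simp [hd]
          have e2 : x n = x (n + 1) - d n := by simp [hd]
          rw [e1, e2]
          linear_combination (d (n + 1) + d n) * hrec' n
        induction n with
        | zero =>
          have := step 0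
          rw [h0, hd0] at this
          rw [this]
          simp
        | succ n ih =>
          have := step (n + 1)
          push_cast at this ih ⊢
          rw [this]
          nlinarith [sq_nonneg (d (n + 1))]
      -- Divide the energy by n + 1 and replace `2 E x (n + 1) / (n + 1)` by `d n - d (n + 1)`. What
      -- is not controlled by the summable squares telescopes.
      have hJ' : ∀ n : ℕ, x 1 ^ 2 * (1 / (n + 1 : ℝ)) ≤
          d (n + 1) ^ 2 + d n * d (n + 1) + (d n * x (n + 1) - d (n + 1) * x (n + 2)) := by
        intro n
        have hn : (0 : ℝ) < n + 1 := by positivity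
        have e0 : x (n + 2) = x (n + 1) + d (n + 1) := by simp [hd]
        have h1 : (n + 1 : ℝ) * (d (n + 1) ^ 2 + d n * d (n + 1) +
            (d n * x (n + 1) - d (n + 1) * x (n + 2))) =
            (n + 1 : ℝ) * d (n + 1) ^ 2 + 2 * E * (x (n + 1) * x (n + 2)) := by
          rw [e0]
          linear_combination (-(x (n + 1) + d (n + 1))) * hrec' n
        rw [mul_one_div, div_le_iff₀ hn, mul_comm, h1]
        exact hJ n
      obtain ⟨S, hS⟩ : ∃ S, ∀ N, ∑ n ∈ Finset.range N, d n ^ 2 ≤ S :=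
        ⟨∑' n, d n ^ 2, fun N => hs.sum_le_tsum _ fun n _ => sq_nonneg _⟩
      have hS1 : ∀ N, ∑ n ∈ Finset.range N, d (n + 1) ^ 2 ≤ S := by
        intro N
        have := hS (N + 1)
        rw [Finset.sum_range_succ'] at this
        nlinarith [sq_nonneg (d 0)]
      have hsum : ∀ N : ℕ, x 1 ^ 2 * ∑ n ∈ Finset.range N, (1 / (n + 1 : ℝ)) ≤
          2 * S + d 0 * x 1 - d N * x (N + 1) := by
        intro N
        have h1 : ∀ N : ℕ, ∑ n ∈ Finset.range N, (d n * x (n + 1) - d (n + 1) * x (n + 2)) =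
            d 0 * x 1 - d N * x (N + 1) := fun N =>
          Finset.sum_range_sub' (fun n => d n * x (n + 1)) N
        calc x 1 ^ 2 * ∑ n ∈ Finset.range N, (1 / (n + 1 : ℝ))
            ≤ ∑ n ∈ Finset.range N, ((d (n + 1) ^ 2 + (d n ^ 2 + d (n + 1) ^ 2) / 2) +
                (d n * x (n + 1) - d (n + 1) * x (n + 2))) := by
              rw [Finset.mul_sum]
              refine Finset.sum_le_sum fun n _ => (hJ' n).trans ?_
              nlinarith [sq_nonneg (d n - d (n + 1))]
          _ ≤ _ := by
              rw [Finset.sum_add_distrib, h1, Finset.sum_add_distrib, ← Finset.sum_div,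
                Finset.sum_add_distrib]
              linarith [hS N, hS1 N]
      have hdiv : Tendsto (fun N : ℕ => x 1 ^ 2 * ∑ n ∈ Finset.range N, (1 / (n + 1 : ℝ)))
          atTop atTop := by
        have := Real.tendsto_sum_range_one_div_nat_succ_atTop
        exact this.const_mul_atTop (by positivity)
      obtain ⟨N₀, hN₀⟩ := eventually_atTop.1
        (hdiv.eventually_ge_atTop (2 * S + d 0 * x 1 + 1))
      -- Divergence of the harmonic series forces the boundary term `d N * x (N + 1)` to be
      -- eventually below -1.
      have hneg : ∀ N ≥ N₀, d N * x (N + 1) ≤ -1 := fun N hN => by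
        linarith [hN₀ N hN, hsum N]
      -- Since x_{n+1}² - x_n² = 2 d_n x_{n+1} - d_n², the squares drop by at least 1 at each step,
      -- which cannot go on.
      have hdec : ∀ k : ℕ, x (N₀ + k) ^ 2 ≤ x N₀ ^ 2 - k := by
        intro k
        induction k with
        | zero => simp
        | succ k ih =>
          have h1 := hneg (N₀ + k) (by omega)
          have h2 : x (N₀ + k) = x (N₀ + k + 1) - d (N₀ + k) := by simp [hd]
          rw [h2] at ih
          push_cast
          rw [← add_assoc]
          nlinarith [sq_nonneg (d (N₀ + k))]
      obtain ⟨k, hk⟩ := exists_nat_gt (x N₀ ^ 2)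
      have := hdec k
      nlinarith [sq_nonneg (x (N₀ + k))]
  have : ∀ n, x n = 0 ∧ x (n + 1) = 0 := by
    intro n
    induction n with
    | zero => exact ⟨h0, hx1⟩
    | succ n ih =>
      refine ⟨ih.2, ?_⟩
      have h := hrec n
      rw [ih.1, ih.2] at h
      have hn : (n + 1 : ℝ) ≠ 0 := by positivity
      simpa [hn] using h
  exact fun n => (this n).1

lemma eq_zero_of_recurrence {E : ℝ} (hE : E ≠ 0) {x : ℕ → ℂ} (h0 : x 0 = 0)
    (hrec : ∀ n : ℕ, (n + 1 : ℂ) * (x (n + 2) - 2 * x (n + 1) + x n) = -2 * E * x (n + 1))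
    (hs : Summable fun n => ‖x (n + 1) - x n‖ ^ 2) (n : ℕ) : x n = 0 := by
  have hrec1 : ∀ n : ℕ, ((n + 1 : ℝ) : ℂ) * (x (n + 2) - ((2 : ℝ) : ℂ) * x (n + 1) + x n) =
      ((-2 * E : ℝ) : ℂ) * x (n + 1) := by
    intro n
    have := hrec n
    push_cast
    exact this
  apply Complex.ext
  · refine eq_zero_of_recurrence_real hE (x := fun n => (x n).re) (by simp [h0]) (fun n => ?_)
      (hs.of_nonneg_of_le (fun n => sq_nonneg _) fun n => ?_) n
    · have := congrArg Complex.re (hrec1 n)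
      rw [Complex.re_ofReal_mul, Complex.re_ofReal_mul, Complex.add_re, Complex.sub_re,
        Complex.re_ofReal_mul] at this
      exact this
    · rw [← Complex.sub_re, ← sq_abs]
      exact pow_le_pow_left₀ (abs_nonneg _) (Complex.abs_re_le_norm _) 2
  · refine eq_zero_of_recurrence_real hE (x := fun n => (x n).im) (by simp [h0]) (fun n => ?_)
      (hs.of_nonneg_of_le (fun n => sq_nonneg _) fun n => ?_) n
    · have := congrArg Complex.im (hrec1 n)
      rw [Complex.im_ofReal_mul, Complex.im_ofReal_mul, Complex.add_im, Complex.sub_im,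
        Complex.im_ofReal_mul] at this
      exact this
    · rw [← Complex.sub_im, ← sq_abs]
      exact pow_le_pow_left₀ (abs_nonneg _) (Complex.abs_im_le_norm _) 2

/-! ### The Fourier transform on `L²` and the operator `|∇|` -/

lemma continuous_absSymbol : Continuous absSymbol := by unfold absSymbol; fun_prop

/-- `v = |∇| u` on the Fourier side. -/
def IsGrad (u v : L2) : Prop := ((𝓕 v : L2) : ℝ → ℂ) =ᵐ[volume] fun ξ => absSymbol ξ * (𝓕 u : L2) ξ

lemma isGrad_absGrad (u : H1) : IsGrad u (absGrad u) := by
  have h : (𝓕 (absGrad u) : L2) = (memLp_absSymbol_mul u).toLp _ := by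
    change 𝓕 (𝓕⁻ ((memLp_absSymbol_mul u).toLp _ : L2)) = _
    exact FourierTransform.fourier_fourierInv_eq _
  rw [IsGrad, h]
  exact (memLp_absSymbol_mul u).coeFn_toLp

/-- The Sobolev weight is dominated by `1 + 2 π |ξ|`, so square integrability of u and |∇| u
suffices. Thus exhibiting |∇| u in L² is enough to place u in the domain. -/
lemma IsGrad.mem_H1 {u v : L2} (h : IsGrad u v) : u ∈ H1 := by
  set w : ℝ → ℂ := fun x => (((1 + ‖x‖ ^ 2) ^ ((1 : ℝ) / 2) : ℝ) : ℂ) with hw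
  have hwt : w.HasTemperateGrowth := by fun_prop
  have hm : MemLp (fun ξ => w ξ * (𝓕 u : L2) ξ) 2 volume := by
    refine MemLp.of_le (g := fun ξ => ‖(𝓕 u : L2) ξ‖ + ‖(𝓕 v : L2) ξ‖)
      ((Lp.memLp (𝓕 u : L2)).norm.add (Lp.memLp (𝓕 v : L2)).norm)
      (hwt.1.continuous.aestronglyMeasurable.mul (Lp.aestronglyMeasurable _)) ?_
    filter_upwards [h] with ξ hξ
    rw [hξ, norm_mul, norm_mul, hw]
    have h1 : (1 + ‖ξ‖ ^ 2) ^ ((1 : ℝ) / 2) ≤ 1 + 2 * Real.pi * |ξ| := by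
      rw [← Real.sqrt_eq_rpow, Real.norm_eq_abs]
      refine Real.sqrt_le_iff.2 ⟨by positivity, ?_⟩
      have h3 : 1 ≤ 2 * Real.pi := by linarith [Real.pi_gt_three]
      have h2 : |ξ| ≤ 2 * Real.pi * |ξ| := by nlinarith [abs_nonneg ξ]
      nlinarith [abs_nonneg ξ]
    rw [absSymbol, Complex.norm_real, Complex.norm_real,
      Real.norm_of_nonneg (by positivity : (0 : ℝ) ≤ (1 + ‖ξ‖ ^ 2) ^ ((1 : ℝ) / 2)),
      Real.norm_of_nonneg (by positivity : (0 : ℝ) ≤ 2 * Real.pi * |ξ|),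
      Real.norm_of_nonneg (by positivity :
        (0 : ℝ) ≤ ‖(𝓕 u : L2) ξ‖ + 2 * Real.pi * |ξ| * ‖(𝓕 u : L2) ξ‖)]
    nlinarith [mul_le_mul_of_nonneg_right h1 (norm_nonneg ((𝓕 u : L2) ξ))]
  refine TemperedDistribution.memSobolev_iff_exists_smulLeftCLM_fourier.mpr ⟨hm.toLp _, ?_⟩
  rw [Lp.fourier_toTemperedDistribution_eq]
  ext g
  rw [TemperedDistribution.smulLeftCLM_apply_apply, Lp.toTemperedDistribution_apply,
    Lp.toTemperedDistribution_apply]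
  refine integral_congr_ae ?_
  filter_upwards [hm.coeFn_toLp] with ξ hξ
  rw [hξ, SchwartzMap.smulLeftCLM_apply_apply hwt]
  simp only [hw, smul_eq_mul]
  ring

lemma IsGrad.absGrad_eq {u v : L2} (h : IsGrad u v) (hu : u ∈ H1) : absGrad ⟨u, hu⟩ = v := by
  have h1 := isGrad_absGrad ⟨u, hu⟩
  have h2 : (𝓕 (absGrad ⟨u, hu⟩) : L2) = 𝓕 v := Lp.ext (h1.trans h.symm)
  exact (Lp.fourierTransformₗᵢ ℝ ℂ).injective h2

lemma IsGrad.add {u v u' v' : L2} (h : IsGrad u v) (h' : IsGrad u' v') :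
    IsGrad (u + u') (v + v') := by
  unfold IsGrad
  rw [FourierTransform.fourier_add, FourierTransform.fourier_add]
  filter_upwards [h, h', Lp.coeFn_add (𝓕 v : L2) (𝓕 v'), Lp.coeFn_add (𝓕 u : L2) (𝓕 u')]
    with ξ h1 h2 h3 h4
  rw [h3, h4, Pi.add_apply, Pi.add_apply, h1, h2, mul_add]

lemma IsGrad.smul {u v : L2} (c : ℂ) (h : IsGrad u v) : IsGrad (c • u) (c • v) := by
  unfold IsGrad
  rw [FourierTransform.fourier_smul, FourierTransform.fourier_smul]
  filter_upwards [h, Lp.coeFn_smul c (𝓕 v : L2), Lp.coeFn_smul c (𝓕 u : L2)] with ξ h1 h2 h3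
  rw [h2, h3, Pi.smul_apply, Pi.smul_apply, h1, smul_eq_mul, smul_eq_mul]
  ring

lemma integral_fourierInv_mul_flip {f g : ℝ → ℂ} (hf : Integrable f) (hg : Integrable g) :
    ∫ x, 𝓕⁻ f x * g x = ∫ x, f x * 𝓕⁻ g x := by
  have h := VectorFourier.integral_fourierIntegral_smul_eq_flip (L := -innerₗ ℝ) (e := Real.fourierChar)
    (μ := volume) (ν := volume) Real.continuous_fourierChar (by
      simp only [LinearMap.neg_apply, innerₗ_apply_apply]; fun_prop) hf hg
  have hfl : (-innerₗ ℝ : ℝ →ₗ[ℝ] ℝ →ₗ[ℝ] ℝ).flip = -innerₗ ℝ := by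
    ext; simp
  rw [hfl] at h
  have hF : ∀ (k : ℝ → ℂ) (x : ℝ), 𝓕⁻ k x =
      VectorFourier.fourierIntegral Real.fourierChar volume (-innerₗ ℝ) k x := fun k x => rfl
  simp only [smul_eq_mul] at h
  simp only [hF]
  exact h

lemma continuous_fourierInv {G : ℝ → ℂ} (hG : Integrable G) : Continuous (𝓕⁻ G) :=
  VectorFourier.fourierIntegral_continuous (L := -innerₗ ℝ) Real.continuous_fourierChar (by
      simp only [LinearMap.neg_apply, innerₗ_apply_apply]; fun_prop) hG

/-- The Plancherel extension and the Fourier integral agree: against smooth compactly supported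
functions, both move the transform to the test function. -/
lemma coeFn_fourierInv_toLp {G : ℝ → ℂ} (hG1 : Integrable G) (hG : MemLp G 2 volume) :
    ((𝓕⁻ (hG.toLp G : L2) : L2) : ℝ → ℂ) =ᵐ[volume] 𝓕⁻ G := by
  have hloc1 : LocallyIntegrable ((𝓕⁻ (hG.toLp G : L2) : L2) : ℝ → ℂ) volume :=
    (Lp.memLp _).locallyIntegrable (by norm_num)
  refine ae_eq_of_integral_contDiff_smul_eq hloc1
    (continuous_fourierInv hG1).locallyIntegrable fun g hg hgs => ?_
  let φ : 𝓢(ℝ, ℂ) := HasCompactSupport.toSchwartzMap (f := fun x => (g x : ℂ))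
    (hgs.comp_left (g := fun r : ℝ => (r : ℂ)) (by simp))
    (Complex.ofRealCLM.contDiff.comp hg)
  have hφ : ∀ x, φ x = g x := fun x => rfl
  have h1 : (((𝓕⁻ (hG.toLp G : L2) : L2)) : 𝓢'(ℝ, ℂ)) φ = ∫ x, φ x * (𝓕⁻ (hG.toLp G : L2) : L2) x :=
    Lp.toTemperedDistribution_apply _ _
  have h2 : (((𝓕⁻ (hG.toLp G : L2) : L2)) : 𝓢'(ℝ, ℂ)) φ = ∫ x, (𝓕⁻ φ : 𝓢(ℝ, ℂ)) x * G x := by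
    rw [← Lp.fourierInv_toTemperedDistribution_eq, TemperedDistribution.fourierInv_apply,
      Lp.toTemperedDistribution_apply]
    refine integral_congr_ae ?_
    filter_upwards [hG.coeFn_toLp] with x hx
    rw [hx, smul_eq_mul]
  simp only [Complex.real_smul]
  simp only [hφ] at h1
  rw [← h1, h2]
  simp only [SchwartzMap.fourierInv_coe]
  rw [integral_fourierInv_mul_flip φ.integrable hG1]
  rfl

/-- `f` and `g` are square integrable functions, and `g = |∇| f`. -/
def HasAbsGrad (f g : ℝ → ℂ) : Prop :=
  ∃ (hf : MemLp f 2 volume) (hg : MemLp g 2 volume), IsGrad (hf.toLp f) (hg.toLp g)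

lemma HasAbsGrad.of_fourierInv {G G' : ℝ → ℂ} (h1 : Integrable G) (h2 : MemLp G 2 volume)
    (h1' : Integrable G') (h2' : MemLp G' 2 volume) (h : ∀ ξ, G' ξ = absSymbol ξ * G ξ) :
    HasAbsGrad (𝓕⁻ G) (𝓕⁻ G') := by
  have e := coeFn_fourierInv_toLp h1 h2
  have e' := coeFn_fourierInv_toLp h1' h2'
  refine ⟨(memLp_congr_ae e).1 (Lp.memLp _), (memLp_congr_ae e').1 (Lp.memLp _), ?_⟩
  have i : ((memLp_congr_ae e).1 (Lp.memLp _)).toLp (𝓕⁻ G) = 𝓕⁻ (h2.toLp G : L2) :=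
    Lp.ext ((MemLp.coeFn_toLp _).trans e.symm)
  have i' : ((memLp_congr_ae e').1 (Lp.memLp _)).toLp (𝓕⁻ G') = 𝓕⁻ (h2'.toLp G' : L2) :=
    Lp.ext ((MemLp.coeFn_toLp _).trans e'.symm)
  unfold IsGrad
  rw [i, i', FourierTransform.fourier_fourierInv_eq, FourierTransform.fourier_fourierInv_eq]
  filter_upwards [h2.coeFn_toLp, h2'.coeFn_toLp] with ξ e1 e2
  rw [e1, e2, h]

lemma HasAbsGrad.add {f g f' g' : ℝ → ℂ} (h : HasAbsGrad f g) (h' : HasAbsGrad f' g') :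
    HasAbsGrad (f + f') (g + g') := by
  obtain ⟨hf, hg, h⟩ := h
  obtain ⟨hf', hg', h'⟩ := h'
  refine ⟨hf.add hf', hg.add hg', ?_⟩
  rw [MemLp.toLp_add hf hf', MemLp.toLp_add hg hg']
  exact h.add h'

lemma HasAbsGrad.smul {f g : ℝ → ℂ} (c : ℂ) (h : HasAbsGrad f g) :
    HasAbsGrad (c • f) (c • g) := by
  obtain ⟨hf, hg, h⟩ := h
  refine ⟨hf.const_smul c, hg.const_smul c, ?_⟩
  rw [MemLp.toLp_const_smul, MemLp.toLp_const_smul]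
  exact h.smul c

/-- The hypothesis says that |∇| acts on positive powers of σ as σ² d/dσ, so linearity extends it to
polynomials. The factor X removes the constant term, which need not be square integrable. -/
lemma HasAbsGrad.polynomial {σ : ℝ → ℂ}
    (h : ∀ n : ℕ, HasAbsGrad (fun x => σ x ^ (n + 1)) (fun x => (n + 1) * σ x ^ (n + 2)))
    (P : Polynomial ℂ) :
    HasAbsGrad (fun x => (Polynomial.X * P).eval (σ x))
      (fun x => σ x ^ 2 * (Polynomial.X * P).derivative.eval (σ x)) := by
  induction P using Polynomial.induction_on' with
  | add p q hp hq =>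
    convert! hp.add hq using 1
    · funext x; simp [mul_add]
    · funext x; simp [mul_add]
  | monomial n a =>
    convert! (h n).smul a using 1
    · funext x; simp
    · funext x; simp; ring

/-! ### Powers of the pole and of the Cayley transform under |∇|. -/

/-- `ξ ^ j exp (- 2 π ξ)` on the half-line. -/
noncomputable def lag (j : ℕ) : ℝ → ℂ :=
  (Set.Ioi (0 : ℝ)).indicator fun ξ => (ξ : ℂ) ^ j * cexp (-(2 * Real.pi) * ξ)

/-- `i / (x + i)`. -/
noncomputable def pole (x : ℝ) : ℂ := I / ((x : ℂ) + I)

lemma integrableOn_pow_mul_cexp {r : ℂ} (hr : 0 < r.re) (j : ℕ) :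
    IntegrableOn (fun t : ℝ => (t : ℂ) ^ j * cexp (-r * t)) (Set.Ioi 0) := by
  have h := integrableOn_rpow_mul_exp_neg_mul_rpow (s := j) (p := 1) (b := r.re)
    (by have : (0 : ℝ) ≤ j := by positivity
        linarith) one_pos hr
  refine Integrable.mono' h ?_ ?_
  · exact (Continuous.aestronglyMeasurable (by fun_prop))
  · filter_upwards [ae_restrict_mem measurableSet_Ioi] with t ht
    rw [norm_mul, norm_pow, Complex.norm_real, Real.norm_of_nonneg (le_of_lt ht), Complex.norm_exp]
    simp

lemma integral_pow_mul_cexp {r : ℂ} (hr : 0 < r.re) (j : ℕ) :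
    ∫ t : ℝ in Set.Ioi 0, (t : ℂ) ^ j * cexp (-r * t) = j.factorial * (1 / r) ^ (j + 1) := by
  have hr0 : r ≠ 0 := fun h => by simp [h] at hr
  induction j with
  | zero =>
    have h := integral_exp_mul_complex_Ioi (a := -r) (by simpa using hr) 0
    simp only [pow_zero, one_mul]
    rw [h]
    simp
  | succ j ih =>
    have hd : ∀ t : ℝ, HasDerivAt (fun t : ℝ => (t : ℂ) ^ (j + 1) * cexp (-r * t))
        ((j + 1) * ((t : ℂ) ^ j * cexp (-r * t)) - r * ((t : ℂ) ^ (j + 1) * cexp (-r * t))) t := by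
      intro t
      have h1 : HasDerivAt (fun y : ℝ => (y : ℂ)) 1 t := Complex.ofRealCLM.hasDerivAt
      have h2 := (h1.pow (j + 1)).mul (h1.const_mul (-r)).cexp
      convert! h2 using 1
      push_cast
      simp
      ring
    have hl : Tendsto (fun t : ℝ => (t : ℂ) ^ (j + 1) * cexp (-r * t)) atTop (𝓝 0) := by
      rw [tendsto_zero_iff_norm_tendsto_zero]
      refine (tendsto_rpow_mul_exp_neg_mul_atTop_nhds_zero (j + 1 : ℕ) r.re hr).congr' ?_
      filter_upwards [eventually_gt_atTop 0] with t ht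
      rw [norm_mul, norm_pow, Complex.norm_real, Real.norm_of_nonneg ht.le, Complex.norm_exp,
        Real.rpow_natCast]
      simp
    have i1 := integrableOn_pow_mul_cexp hr j
    have i2 := integrableOn_pow_mul_cexp hr (j + 1)
    have h := integral_Ioi_of_hasDerivAt_of_tendsto' (a := 0) (fun t _ => hd t)
      ((i1.const_mul _).sub (i2.const_mul _)) hl
    rw [integral_sub (i1.const_mul _) (i2.const_mul _), integral_const_mul, integral_const_mul,
      ih] at h
    simp only [ofReal_zero, ne_eq, Nat.add_eq_zero_iff, one_ne_zero, and_false, not_false_eq_true,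
      zero_pow, zero_mul, sub_zero] at h
    have h3 : r * ∫ t : ℝ in Set.Ioi 0, (t : ℂ) ^ (j + 1) * cexp (-r * t) =
      (j + 1) * (j.factorial * (1 / r) ^ (j + 1)) := by linear_combination -h
    rw [Nat.factorial_succ]
    apply mul_left_cancel₀ hr0
    rw [h3]
    push_cast
    rw [pow_succ (1 / r) (j + 1)]
    field_simp

lemma integrable_lag (j : ℕ) : Integrable (lag j) := by
  unfold lag
  rw [integrable_indicator_iff measurableSet_Ioi]
  exact integrableOn_pow_mul_cexp (by simp; positivity) j

lemma norm_lag_le (j : ℕ) : ∃ C, ∀ ξ, ‖lag j ξ‖ ≤ C := by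
  refine ⟨j.factorial, fun ξ => ?_⟩
  unfold lag
  by_cases h : ξ ∈ Set.Ioi (0 : ℝ)
  · rw [Set.indicator_of_mem h]
    have h0 : 0 < ξ := h
    have h1 := Real.pow_div_factorial_le_exp ξ h0.le j
    rw [div_le_iff₀ (by positivity)] at h1
    rw [norm_mul, norm_pow, Complex.norm_real, Complex.norm_exp, Real.norm_of_nonneg h0.le]
    have h2 : (-(2 * (Real.pi : ℂ)) * ξ).re = -(2 * Real.pi * ξ) := by
      rw [show (-(2 * (Real.pi : ℂ)) * ξ) = ((-(2 * Real.pi * ξ) : ℝ) : ℂ) by push_cast; ring]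
      rfl
    have h4 : Real.exp ξ * Real.exp (-(2 * Real.pi * ξ)) ≤ 1 := by
      rw [← Real.exp_add, Real.exp_le_one_iff]
      nlinarith [Real.pi_gt_three]
    rw [h2]
    calc ξ ^ j * Real.exp (-(2 * Real.pi * ξ))
        ≤ (Real.exp ξ * j.factorial) * Real.exp (-(2 * Real.pi * ξ)) := by gcongr
      _ = (Real.exp ξ * Real.exp (-(2 * Real.pi * ξ))) * j.factorial := by ring
      _ ≤ 1 * j.factorial := by gcongr
      _ = _ := one_mul _
  · rw [Set.indicator_of_notMem h, norm_zero]
    positivity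

lemma memLp_lag (j : ℕ) : MemLp (lag j) 2 volume := by
  obtain ⟨C, hC⟩ := norm_lag_le j
  rw [memLp_two_iff_integrable_sq_norm (integrable_lag j).aestronglyMeasurable]
  refine ((integrable_lag j).norm.const_mul C).mono'
    ((integrable_lag j).aestronglyMeasurable.norm.pow 2) (Eventually.of_forall fun ξ => ?_)
  rw [Real.norm_of_nonneg (by positivity), sq]
  exact mul_le_mul_of_nonneg_right (hC ξ) (norm_nonneg _)

/-- The Gamma integral with complex rate 2π(1 - i x): powers of the pole have Fourier transforms on
the positive half-line, where |ξ| = ξ. -/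
lemma fourierInv_lag (j : ℕ) (x : ℝ) :
    𝓕⁻ (lag j) x = j.factorial / (2 * Real.pi) ^ (j + 1) * pole x ^ (j + 1) := by
  have hp := xaddI_ne x
  have h := integral_pow_mul_cexp (r := 2 * Real.pi * (1 - I * x)) (by simp; positivity) j
  rw [Real.fourierInv_eq']
  have h1 : ∀ v : ℝ, cexp ((2 * Real.pi * inner ℝ v x : ℝ) * I) • lag j v =
      (Set.Ioi (0 : ℝ)).indicator (fun t : ℝ => (t : ℂ) ^ j *
        cexp (-(2 * Real.pi * (1 - I * x)) * t)) v := by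
    intro v
    unfold lag
    by_cases hv : v ∈ Set.Ioi (0 : ℝ)
    · rw [Set.indicator_of_mem hv, Set.indicator_of_mem hv]
      rw [smul_eq_mul, mul_left_comm, ← Complex.exp_add]
      congr 2
      simp only [RCLike.inner_apply, conj_trivial]
      push_cast
      ring
    · rw [Set.indicator_of_notMem hv, Set.indicator_of_notMem hv, smul_zero]
  simp_rw [h1]
  rw [integral_indicator measurableSet_Ioi, h]
  have hpi : (2 * (Real.pi : ℂ)) ≠ 0 := by simp [Real.pi_ne_zero]
  have e3 : (1 : ℂ) / (2 * Real.pi * (1 - I * x)) = pole x / (2 * Real.pi) := by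
    have : (1 : ℂ) - I * x = -I * (x + I) := by linear_combination Complex.I_sq
    rw [this, pole]
    have hI := Complex.I_ne_zero
    field_simp
    linear_combination (-1 : ℂ) * Complex.I_sq
  rw [e3, div_pow]
  ring

lemma fourierInv_comp_neg (G : ℝ → ℂ) (x : ℝ) : 𝓕⁻ (fun ξ => G (-ξ)) x = 𝓕⁻ G (-x) := by
  rw [Real.fourierInv_eq', Real.fourierInv_eq', ← integral_neg_eq_self]
  simp

lemma lag_succ (j : ℕ) (ξ : ℝ) : 2 * Real.pi * lag (j + 1) ξ = absSymbol ξ * lag j ξ := by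
  unfold lag absSymbol
  by_cases h : ξ ∈ Set.Ioi (0 : ℝ)
  · rw [Set.indicator_of_mem h, Set.indicator_of_mem h, abs_of_pos h]
    push_cast
    ring
  · rw [Set.indicator_of_notMem h, Set.indicator_of_notMem h, mul_zero, mul_zero]

lemma absSymbol_neg (ξ : ℝ) : absSymbol (-ξ) = absSymbol ξ := by simp [absSymbol]

lemma fourierInv_const_mul (c : ℂ) (G : ℝ → ℂ) (x : ℝ) :
    𝓕⁻ (fun ξ => c * G ξ) x = c * 𝓕⁻ G x := by
  rw [Real.fourierInv_eq', Real.fourierInv_eq', ← integral_const_mul]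
  congr 1
  funext v
  simp only [smul_eq_mul]
  ring

lemma hasAbsGrad_pole (n : ℕ) :
    HasAbsGrad (fun x => pole x ^ (n + 1)) (fun x => (n + 1) * pole x ^ (n + 2)) := by
  have h := (HasAbsGrad.of_fourierInv (integrable_lag n) (memLp_lag n)
    ((integrable_lag (n + 1)).const_mul (2 * Real.pi)) ((memLp_lag (n + 1)).const_mul _)
    (lag_succ n)).smul ((2 * Real.pi) ^ (n + 1) / n.factorial)
  have hpi : (2 * (Real.pi : ℂ)) ≠ 0 := by simp [Real.pi_ne_zero]
  have hf : (n.factorial : ℂ) ≠ 0 := by exact_mod_cast n.factorial_ne_zero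
  convert! h using 1
  · funext x
    rw [Pi.smul_apply, fourierInv_lag, smul_eq_mul]
    field_simp
  · funext x
    rw [Pi.smul_apply, fourierInv_const_mul, fourierInv_lag, smul_eq_mul, Nat.factorial_succ]
    push_cast
    field_simp
    ring

/-- Reflection in x reflects ξ and preserves |ξ|. This version serves the negative powers of `cay`,
because `cay (-x)` is the inverse of `cay x`. -/
lemma hasAbsGrad_pole_neg (n : ℕ) :
    HasAbsGrad (fun x => pole (-x) ^ (n + 1)) (fun x => (n + 1) * pole (-x) ^ (n + 2)) := by
  have hneg : MeasurePreserving (fun x : ℝ => -x) volume volume := Measure.measurePreserving_neg _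
  have h := (HasAbsGrad.of_fourierInv (G := fun ξ => lag n (-ξ))
    (G' := fun ξ => 2 * Real.pi * lag (n + 1) (-ξ)) (integrable_lag n).comp_neg
    ((memLp_lag n).comp_measurePreserving hneg)
    ((integrable_lag (n + 1)).comp_neg.const_mul (2 * Real.pi))
    (((memLp_lag (n + 1)).comp_measurePreserving hneg).const_mul _)
    (fun ξ => by rw [lag_succ, absSymbol_neg])).smul ((2 * Real.pi) ^ (n + 1) / n.factorial)
  have hpi : (2 * (Real.pi : ℂ)) ≠ 0 := by simp [Real.pi_ne_zero]
  have hf : (n.factorial : ℂ) ≠ 0 := by exact_mod_cast n.factorial_ne_zero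
  convert! h using 1
  · funext x
    rw [Pi.smul_apply, fourierInv_comp_neg, fourierInv_lag, smul_eq_mul]
    field_simp
  · funext x
    rw [Pi.smul_apply, fourierInv_const_mul, fourierInv_comp_neg, fourierInv_lag, smul_eq_mul,
      Nat.factorial_succ]
    push_cast
    field_simp
    ring

lemma cay_eq_pole (x : ℝ) : cay x = 1 - 2 * pole x := by
  have hp := xaddI_ne x
  rw [cay, pole]
  field_simp
  ring

/-- With p the pole and `cay = 1 - 2 p`, this turns p² d/dp of (1 - 2p)^n into `n wt cay ^ n`. -/
lemma pole_sq (x : ℝ) : -2 * pole x ^ 2 = wt x * cay x := by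
  have hp := xaddI_ne x
  have h2 := xsubI_ne x
  rw [cay, pole, wt]
  push_cast
  rw [← xsubI_mul_xaddI]
  field_simp
  linear_combination (-1 : ℂ) * Complex.I_sq

lemma cay_neg (x : ℝ) : cay (-x) = (cay x)⁻¹ := by
  have hp := xaddI_ne x
  have h2 := xsubI_ne x
  have h3 := xaddI_ne (-x)
  rw [cay, cay, inv_div, div_eq_div_iff h3 h2]
  push_cast
  ring

lemma wt_neg (x : ℝ) : wt (-x) = wt x := by simp [wt]

lemma exists_polynomial_cay (k : ℕ) : ∃ P : Polynomial ℂ,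
    Polynomial.X * P = (1 - 2 * Polynomial.X) ^ k - 1 := by
  have : Polynomial.X ∣ (((1 - 2 * Polynomial.X) ^ k - 1 : Polynomial ℂ)) := by
    rw [Polynomial.X_dvd_iff, Polynomial.coeff_zero_eq_eval_zero]
    simp
  obtain ⟨P, hP⟩ := this
  exact ⟨P, hP.symm⟩

/-- `|∇| (cay ^ k - 1) = |k| wt cay ^ k`. -/
lemma hasAbsGrad_cay_zpow (k : ℤ) :
    HasAbsGrad (fun x => cay x ^ k - 1) (fun x => (k.natAbs : ℂ) * (wt x * cay x ^ k)) := by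
  obtain ⟨P, hP⟩ := exists_polynomial_cay k.natAbs
  have hev : ∀ x : ℝ, (Polynomial.X * P).eval (pole x) = cay x ^ (k.natAbs : ℤ) - 1 := by
    intro x
    rw [hP, cay_eq_pole, zpow_natCast]
    simp
  have hder : ∀ x : ℝ, pole x ^ 2 * (Polynomial.X * P).derivative.eval (pole x) =
      (k.natAbs : ℂ) * (wt x * cay x ^ (k.natAbs : ℤ)) := by
    intro x
    rw [hP]
    rcases Nat.eq_zero_or_pos k.natAbs with h0 | h0
    · simp [h0]
    · obtain ⟨n, hn⟩ := Nat.exists_eq_succ_of_ne_zero h0.ne'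
      rw [hn]
      have : (wt x : ℂ) * cay x ^ ((n.succ : ℕ) : ℤ) = (wt x * cay x) * cay x ^ n := by
        rw [zpow_natCast, pow_succ]; ring
      rw [this, ← pole_sq, cay_eq_pole]
      simp [Polynomial.derivative_pow]
      ring
  rcases Int.natAbs_eq k with hk | hk
  · have h := HasAbsGrad.polynomial hasAbsGrad_pole P
    simp only [hev, hder] at h
    rwa [← hk] at h
  · have h := HasAbsGrad.polynomial (σ := fun x => pole (-x)) hasAbsGrad_pole_neg P
    simp only [hev, hder, cay_neg, wt_neg, inv_zpow, ← zpow_neg] at h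
    rwa [← hk] at h

/-! ### The trigonometric system in `L²` -/

lemma inner_eq_integral (f g : L2) : inner ℂ f g = ∫ x, (starRingEnd ℂ) (f x) * g x := by
  rw [L2.inner_def]
  congr 1
  funext x
  rw [RCLike.inner_apply, mul_comm]

lemma inner_toLp {f g : ℝ → ℂ} (hf : MemLp f 2 volume) (hg : MemLp g 2 volume) :
    inner ℂ (hf.toLp f) (hg.toLp g) = ∫ x, (starRingEnd ℂ) (f x) * g x := by
  rw [inner_eq_integral]
  refine integral_congr_ae ?_
  filter_upwards [hf.coeFn_toLp, hg.coeFn_toLp] with x h1 h2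
  rw [h1, h2]

lemma memLp_wt : MemLp wt 2 volume := by
  have : wt = fun x => 2 * (1 + x ^ 2)⁻¹ := funext wt_eq_inv
  rw [this]
  exact memLp_inv_one_add_sq.const_mul 2

lemma memLp_wt_mul_cay (k : ℤ) : MemLp (fun x => (wt x : ℂ) * cay x ^ k) 2 volume := by
  refine memLp_wt.of_le ?_ (Eventually.of_forall fun x => ?_)
  · exact ((Complex.continuous_ofReal.comp continuous_wt).mul
      (continuous_cay_zpow k)).aestronglyMeasurable
  · rw [norm_mul, norm_cay_zpow, mul_one, Complex.norm_real]

lemma memLp_cay_sub_one (k : ℤ) : MemLp (fun x => cay x ^ k - 1) 2 volume :=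
  (hasAbsGrad_cay_zpow k).choose

/-- The function `wt cay ^ k`. -/
noncomputable def qv (k : ℤ) : L2 := (memLp_wt_mul_cay k).toLp _

/-- The function `cay ^ k - 1`. -/
noncomputable def ev (k : ℤ) : L2 := (memLp_cay_sub_one k).toLp _

lemma integrable_mul_wt (u : L2) : Integrable (fun y => u y * wt y) := by
  have h := (Lp.memLp u).integrable_mul memLp_wt.ofReal
  exact h

lemma inner_qv (k : ℤ) (u : L2) : inner ℂ (qv k) u = moment u k := by
  rw [inner_eq_integral, moment]
  refine integral_congr_ae ?_
  filter_upwards [(memLp_wt_mul_cay k).coeFn_toLp] with x hx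
  rw [qv, hx, map_mul, conj_cay_zpow, Complex.conj_ofReal, mul_comm]

/-- On nonzero frequencies `qv` and `ev` are biorthogonal up to 2π. The second term comes from the
constant -1 in `ev k` and is seen only by `qv 0`. -/
lemma inner_qv_ev (j k : ℤ) : inner ℂ (qv j) (ev k) =
    (if j = k then 2 * (Real.pi : ℂ) else 0) - if j = 0 then 2 * (Real.pi : ℂ) else 0 := by
  rw [qv, ev, inner_toLp]
  have h : ∀ x, (starRingEnd ℂ) ((wt x : ℂ) * cay x ^ j) * (cay x ^ k - 1) =
      (wt x : ℂ) * cay x ^ (k - j) - (wt x : ℂ) * cay x ^ (-j) := by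
    intro x
    rw [map_mul, conj_cay_zpow, Complex.conj_ofReal, sub_eq_add_neg k, zpow_add₀ (cay_ne_zero x)]
    ring
  simp_rw [h]
  rw [integral_sub (integrable_cay_zpow_mul_wt _) (integrable_cay_zpow_mul_wt _),
    integral_wt_mul_cay_zpow, integral_wt_mul_cay_zpow]
  simp only [sub_eq_zero, neg_eq_zero, eq_comm]

lemma ev_zero : ev 0 = 0 := by
  rw [ev, Lp.eq_zero_iff_ae_eq_zero]
  filter_upwards [(memLp_cay_sub_one 0).coeFn_toLp] with x hx
  rw [hx]
  simp

lemma qv_eq (k : ℤ) : qv k = (-(1 / 2) : ℂ) • (ev (k + 1) - (2 : ℂ) • ev k + ev (k - 1)) := by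
  have h := (((memLp_cay_sub_one (k + 1)).sub ((memLp_cay_sub_one k).const_smul (2 : ℂ))).add
    (memLp_cay_sub_one (k - 1))).const_smul (-(1 / 2) : ℂ)
  have h2 : (-(1 / 2) : ℂ) • (ev (k + 1) - (2 : ℂ) • ev k + ev (k - 1)) = h.toLp _ := rfl
  rw [h2, qv]
  refine MemLp.toLp_congr _ _ (Eventually.of_forall fun x => ?_)
  simp only [wt_mul_cay_zpow, Pi.add_apply, Pi.smul_apply, Pi.sub_apply, smul_eq_mul]

lemma isGrad_ev (k : ℤ) : IsGrad (ev k) ((k.natAbs : ℂ) • qv k) := by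
  obtain ⟨_, _, h⟩ := hasAbsGrad_cay_zpow k
  exact h

lemma ev_mem_H1 (k : ℤ) : ev k ∈ H1 := (isGrad_ev k).mem_H1

lemma absGrad_ev (k : ℤ) : absGrad ⟨ev k, ev_mem_H1 k⟩ = (k.natAbs : ℂ) • qv k :=
  (isGrad_ev k).absGrad_eq _

lemma VOp_ev (m : ℕ) (k : ℤ) : VOp m (ev k) = (m : ℂ) • (qv k - qv 0) := by
  have h := ((memLp_wt_mul_cay k).sub (memLp_wt_mul_cay 0)).const_smul (m : ℂ)
  have h2 : (m : ℂ) • (qv k - qv 0) = h.toLp _ := rfl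
  rw [h2]
  change (memLp_V_mul m (ev k)).toLp _ = _
  refine MemLp.toLp_congr _ _ ?_
  filter_upwards [(memLp_cay_sub_one k).coeFn_toLp] with x hx
  rw [ev, hx, V_eq_cast]
  simp only [Pi.smul_apply, Pi.sub_apply, smul_eq_mul, zpow_zero]
  ring

lemma ROp_eq (m : ℕ) (u : L2) : ROp m u = ∑ j ∈ Finset.range m, ∑ l ∈ Finset.range m,
    (1 / (2 * (Real.pi : ℂ)) * inner ℂ (qv ((j : ℤ) - l)) u) • qv ((j : ℤ) - l) := by
  have h : ∀ j l : ℕ, MemLp ((1 / (2 * (Real.pi : ℂ)) * inner ℂ (qv ((j : ℤ) - l)) u) •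
      fun x => (wt x : ℂ) * cay x ^ ((j : ℤ) - l)) 2 volume := fun j l =>
    (memLp_wt_mul_cay _).const_smul _
  change (memLp_RFun m u).toLp _ = _
  refine Lp.ext ((memLp_RFun m u).coeFn_toLp.trans ?_)
  refine EventuallyEq.trans ?_ (Lp.coeFn_finsetSum _ _).symm
  have h1 : ∀ᵐ x, ∀ j l : ℕ, ((1 / (2 * (Real.pi : ℂ)) * inner ℂ (qv ((j : ℤ) - l)) u) •
      qv ((j : ℤ) - l) : L2) x = 1 / (2 * (Real.pi : ℂ)) * inner ℂ (qv ((j : ℤ) - l)) u *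
        ((wt x : ℂ) * cay x ^ ((j : ℤ) - l)) := by
    rw [ae_all_iff]; intro j
    rw [ae_all_iff]; intro l
    filter_upwards [Lp.coeFn_smul (1 / (2 * (Real.pi : ℂ)) * inner ℂ (qv ((j : ℤ) - l)) u)
      (qv ((j : ℤ) - l)), (memLp_wt_mul_cay ((j : ℤ) - l)).coeFn_toLp] with x e1 e2
    rw [e1, Pi.smul_apply, smul_eq_mul]
    congr 1
  have h2 : ∀ᵐ x, ∀ j : ℕ, (∑ l ∈ Finset.range m,
      (1 / (2 * (Real.pi : ℂ)) * inner ℂ (qv ((j : ℤ) - l)) u) • qv ((j : ℤ) - l) : L2) x =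
      ∑ l ∈ Finset.range m, ((1 / (2 * (Real.pi : ℂ)) * inner ℂ (qv ((j : ℤ) - l)) u) •
        qv ((j : ℤ) - l) : L2) x := by
    rw [ae_all_iff]; intro j
    filter_upwards [Lp.coeFn_finsetSum (Finset.range m) (fun l : ℕ =>
      (1 / (2 * (Real.pi : ℂ)) * inner ℂ (qv ((j : ℤ) - l)) u) • qv ((j : ℤ) - l))] with x e1
    rw [e1, Finset.sum_apply]
  filter_upwards [h1, h2] with x e1 e2
  rw [RFun_eq m (integrable_mul_wt u), Finset.sum_apply]
  refine Finset.sum_congr rfl fun j _ => ?_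
  rw [e2]
  refine Finset.sum_congr rfl fun l _ => ?_
  rw [e1, inner_qv]

lemma ROp_isSymmetric (m : ℕ) : (ROp m).IsSymmetric := by
  intro u v
  rw [ROp_eq, ROp_eq, sum_inner, inner_sum]
  refine Finset.sum_congr rfl fun j _ => ?_
  rw [sum_inner, inner_sum]
  refine Finset.sum_congr rfl fun l _ => ?_
  have hc : (starRingEnd ℂ) (1 / (2 * (Real.pi : ℂ))) = 1 / (2 * (Real.pi : ℂ)) := by
    have : (1 / (2 * (Real.pi : ℂ))) = ((1 / (2 * Real.pi) : ℝ) : ℂ) := by push_cast; rfl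
    rw [this, Complex.conj_ofReal]
  rw [inner_smul_left, inner_smul_right, map_mul, inner_conj_symm, hc]
  ring

lemma VOp_isSymmetric (m : ℕ) : (VOp m).IsSymmetric := by
  intro u v
  rw [inner_eq_integral, inner_eq_integral]
  refine integral_congr_ae ?_
  filter_upwards [(memLp_V_mul m u).coeFn_toLp, (memLp_V_mul m v).coeFn_toLp] with x h1 h2
  change (starRingEnd ℂ) ((memLp_V_mul m u).toLp _ x) * v x =
    (starRingEnd ℂ) (u x) * (memLp_V_mul m v).toLp _ x
  rw [h1, h2, map_mul, Complex.conj_ofReal]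
  ring

lemma absGrad_symm (u v : H1) : inner ℂ (absGrad u) (v : L2) = inner ℂ (u : L2) (absGrad v) := by
  rw [← Lp.inner_fourier_eq, ← Lp.inner_fourier_eq (u : L2), inner_eq_integral, inner_eq_integral]
  refine integral_congr_ae ?_
  filter_upwards [isGrad_absGrad u, isGrad_absGrad v] with ξ h1 h2
  rw [h1, h2, map_mul, absSymbol, Complex.conj_ofReal]
  ring

/-! ### The action of L₊, L₋ and R on the trigonometric system. -/

/-- `L₊` as a linear map on `H¹(ℝ)`. -/
noncomputable def LPlusH (m : ℕ) : H1 →ₗ[ℂ] L2 := absGrad - (VOp m).comp H1.subtype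

/-- `L₋` as a linear map on `H¹(ℝ)`. -/
noncomputable def LMinusH (m : ℕ) : H1 →ₗ[ℂ] L2 :=
  absGrad - (VOp m).comp H1.subtype + (ROp m).comp H1.subtype

lemma LMinusH_apply (m : ℕ) (u : H1) : LMinusH m u = absGrad u - VOp m u + ROp m u := rfl

lemma LPlusH_apply (m : ℕ) (u : H1) : LPlusH m u = absGrad u - VOp m u := rfl

lemma LMinusH_symm (m : ℕ) (u v : H1) :
    inner ℂ (LMinusH m u) (v : L2) = inner ℂ (u : L2) (LMinusH m v) := by
  rw [LMinusH_apply, LMinusH_apply, inner_add_left, inner_sub_left, inner_add_right,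
    inner_sub_right, absGrad_symm]
  congr 1
  · congr 1
    exact VOp_isSymmetric m u v
  · exact ROp_isSymmetric m u v

lemma LPlusH_symm (m : ℕ) (u v : H1) :
    inner ℂ (LPlusH m u) (v : L2) = inner ℂ (u : L2) (LPlusH m v) := by
  rw [LPlusH_apply, LPlusH_apply, inner_sub_left, inner_sub_right, absGrad_symm]
  congr 1
  exact VOp_isSymmetric m u v

/-- The term in `qv 0` is the potential acting on the constant -1 in `ev k`. The operator R cancels
it, which is why L₋ is diagonal and L₊ is not. -/
lemma LPlusH_ev (m : ℕ) (k : ℤ) : LPlusH m ⟨ev k, ev_mem_H1 k⟩ =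
    ((k.natAbs : ℂ) - m) • qv k + (m : ℂ) • qv 0 := by
  rw [LPlusH_apply, absGrad_ev, VOp_ev]
  module

lemma sum_sum_ite_smul_qv (m : ℕ) (c : ℂ) (k : ℤ) : (∑ j ∈ Finset.range m, ∑ l ∈ Finset.range m,
      (if (j : ℤ) - l = k then c else 0) • qv ((j : ℤ) - l)) =
      (((m - k.natAbs : ℕ) : ℂ) * c) • qv k := by
  rw [← sum_sum_ite_sub_eq, Finset.sum_mul, Finset.sum_smul]
  refine Finset.sum_congr rfl fun j _ => ?_
  rw [Finset.sum_mul, Finset.sum_smul]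
  refine Finset.sum_congr rfl fun l _ => ?_
  split_ifs with h
  · rw [h, one_mul]
  · rw [zero_mul, zero_smul, zero_smul]

lemma two_pi_ne : (2 * (Real.pi : ℂ)) ≠ 0 := by simp [Real.pi_ne_zero]

lemma ROp_ev (m : ℕ) (k : ℤ) :
    ROp m (ev k) = ((m - k.natAbs : ℕ) : ℂ) • qv k - (m : ℂ) • qv 0 := by
  have h : ∀ j l : ℕ, (1 / (2 * (Real.pi : ℂ)) * inner ℂ (qv ((j : ℤ) - l)) (ev k)) •
      qv ((j : ℤ) - l) = (if (j : ℤ) - l = k then (1 : ℂ) else 0) • qv ((j : ℤ) - l) -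
        (if (j : ℤ) - l = 0 then (1 : ℂ) else 0) • qv ((j : ℤ) - l) := by
    intro j l
    have := two_pi_ne
    rw [inner_qv_ev, ← sub_smul]
    congr 1
    split_ifs <;> field_simp <;> ring
  rw [ROp_eq]
  simp_rw [h, Finset.sum_sub_distrib]
  rw [sum_sum_ite_smul_qv, sum_sum_ite_smul_qv]
  simp

/-- `L₋` multiplies the trigonometric polynomials by `(|k| - m)₊`. -/
lemma LMinusH_ev (m : ℕ) (k : ℤ) : LMinusH m ⟨ev k, ev_mem_H1 k⟩ =
    ((k.natAbs - m : ℕ) : ℂ) • qv k := by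
  have h : LMinusH m ⟨ev k, ev_mem_H1 k⟩ = LPlusH m ⟨ev k, ev_mem_H1 k⟩ + ROp m (ev k) := rfl
  rw [h, LPlusH_ev, ROp_ev]
  rcases le_total k.natAbs m with hk | hk
  · rw [Nat.sub_eq_zero_of_le hk, Nat.cast_sub hk]
    push_cast
    module
  · rw [Nat.sub_eq_zero_of_le hk, Nat.cast_sub hk]
    push_cast
    module

lemma eq_zero_of_inner_qv {u : L2} (h : ∀ k, inner ℂ (qv k) u = 0) : u = 0 := by
  have h1 : ∀ᵐ x, u x * wt x = 0 := by
    refine ae_eq_zero_of_integral_cay_zpow (integrable_mul_wt u) fun k => ?_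
    have := h (-k)
    rw [inner_qv, moment, neg_neg] at this
    rw [← this]
    congr 1
    funext x
    ring
  rw [Lp.eq_zero_iff_ae_eq_zero]
  filter_upwards [h1] with x hx
  exact (mul_eq_zero.1 hx).resolve_right (by exact_mod_cast (wt_pos x).ne')

/-- The difference is `cay ^ k (cay - 1)`, and |cay - 1|² = 2 wt turns the L² pairing into the
orthogonality of characters on the circle. -/
lemma inner_ev_succ_sub (j k : ℤ) : inner ℂ (ev (j + 1) - ev j) (ev (k + 1) - ev k) =
    if j = k then 4 * (Real.pi : ℂ) else 0 := by
  have h1 := (memLp_cay_sub_one (j + 1)).sub (memLp_cay_sub_one j)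
  have h2 := (memLp_cay_sub_one (k + 1)).sub (memLp_cay_sub_one k)
  have e1 : ev (j + 1) - ev j = h1.toLp _ := rfl
  have e2 : ev (k + 1) - ev k = h2.toLp _ := rfl
  rw [e1, e2, inner_toLp]
  have h : ∀ x, (starRingEnd ℂ) (((fun x => cay x ^ (j + 1) - 1) - fun x => cay x ^ j - 1) x) *
      (((fun x => cay x ^ (k + 1) - 1) - fun x => cay x ^ k - 1) x) =
      2 * ((wt x : ℂ) * cay x ^ (k - j)) := by
    intro x
    have hx := cay_ne_zero x
    simp only [Pi.sub_apply]
    rw [sub_sub_sub_cancel_right, sub_sub_sub_cancel_right, map_sub, conj_cay_zpow, conj_cay_zpow,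
      wt_eq, zpow_add_one₀ hx, neg_add, zpow_add₀ hx, sub_eq_add_neg k, zpow_add₀ hx, zpow_neg_one]
    field_simp
    ring
  simp_rw [h]
  rw [integral_const_mul, integral_wt_mul_cay_zpow]
  simp only [sub_eq_zero, eq_comm]
  split_ifs <;> ring

/-- Bessel's inequality for the normalized differences. It is the only decay at infinity that
membership in L² supplies to the recurrences. -/
lemma summable_inner_ev_succ_sub (u : L2) :
    Summable fun k : ℤ => ‖inner ℂ (ev (k + 1) - ev k) u‖ ^ 2 := by
  set c : ℝ := (√(4 * Real.pi))⁻¹ with hc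
  have hpi : 0 < 4 * Real.pi := by positivity
  have hc2 : c * c * (4 * Real.pi) = 1 := by
    rw [hc, ← mul_inv, Real.mul_self_sqrt hpi.le, inv_mul_cancel₀ hpi.ne']
  have hc0 : c ≠ 0 := by
    intro h; rw [h] at hc2; simp at hc2
  have ho : Orthonormal ℂ fun k : ℤ => (c : ℂ) • (ev (k + 1) - ev k) := by
    rw [orthonormal_iff_ite]
    intro i j
    rw [inner_smul_left, inner_smul_right, inner_ev_succ_sub, Complex.conj_ofReal]
    split_ifs
    · rw [← mul_assoc]; exact_mod_cast hc2
    · simp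
  have h := ho.inner_products_summable u
  refine (h.mul_left (c⁻¹ ^ 2)).congr fun k => ?_
  rw [inner_smul_left, norm_mul, Complex.conj_ofReal, Complex.norm_real, mul_pow,
    Real.norm_eq_abs, sq_abs]
  field_simp

/-! ### Trigonometric polynomials and eigenfunctions -/

lemma inner_qv_eq (u : L2) (k : ℤ) : inner ℂ (qv k) u = (-(1 / 2) : ℂ) *
    (inner ℂ (ev (k + 1)) u - 2 * inner ℂ (ev k) u + inner ℂ (ev (k - 1)) u) := by
  have h2 : (starRingEnd ℂ) 2 = 2 := map_ofNat _ 2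
  rw [qv_eq, inner_smul_left, inner_add_left, inner_sub_left, inner_smul_left]
  simp [h2]

lemma tendsto_norm_inner_ev_succ_sub (u : L2) (σ : ℕ → ℤ) (hσ : Function.Injective σ) :
    Tendsto (fun n => ‖inner ℂ (ev (σ n + 1) - ev (σ n)) u‖ ^ 2) atTop (𝓝 0) :=
  ((summable_inner_ev_succ_sub u).comp_injective hσ).tendsto_atTop_zero

/-- If the moments of `u` vanish from `a` on, then `u` is orthogonal to the corresponding
differences. -/
lemma inner_ev_succ_eq {u : L2} {a : ℤ} (h : ∀ k, a ≤ k → inner ℂ (qv k) u = 0) :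
    inner ℂ (ev a) u = inner ℂ (ev (a - 1)) u := by
  -- A vanishing moment is a vanishing second difference, so the first differences are constant;
  -- being square summable, they are zero.
  have hd : ∀ n : ℕ, inner ℂ (ev (a - 1 + n + 1) - ev (a - 1 + n)) u =
      inner ℂ (ev a - ev (a - 1)) u := by
    intro n
    induction n with
    | zero => simp
    | succ n ih =>
      rw [← ih]
      have h1 := h (a - 1 + n + 1) (by omega)
      rw [inner_qv_eq] at h1
      have h2 := (mul_eq_zero.1 h1).resolve_left (by norm_num)
      rw [inner_sub_left, inner_sub_left]
      push_cast
      rw [show a - 1 + ((n : ℤ) + 1) = a - 1 + n + 1 by ring]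
      rw [show a - 1 + (n : ℤ) + 1 - 1 = a - 1 + n by ring] at h2
      linear_combination h2
  have h3 := tendsto_norm_inner_ev_succ_sub u (fun n : ℕ => a - 1 + n) (fun x y hxy => by
    simpa using hxy)
  simp_rw [hd] at h3
  have h4 := tendsto_nhds_unique tendsto_const_nhds h3
  rw [sq_eq_zero_iff, norm_eq_zero, inner_sub_left] at h4
  exact sub_eq_zero.1 h4

/-- The mirror image of `inner_ev_succ_eq`, towards frequency -∞. -/
lemma inner_ev_pred_eq {u : L2} {a : ℤ} (h : ∀ k, k ≤ a → inner ℂ (qv k) u = 0) :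
    inner ℂ (ev (a + 1)) u = inner ℂ (ev a) u := by
  have hd : ∀ n : ℕ, inner ℂ (ev (a - n + 1) - ev (a - n)) u =
      inner ℂ (ev (a + 1) - ev a) u := by
    intro n
    induction n with
    | zero => simp
    | succ n ih =>
      rw [← ih]
      have h1 := h (a - n) (by omega)
      rw [inner_qv_eq] at h1
      have h2 := (mul_eq_zero.1 h1).resolve_left (by norm_num)
      rw [inner_sub_left, inner_sub_left]
      push_cast
      rw [show a - ((n : ℤ) + 1) + 1 = a - n by ring, show a - ((n : ℤ) + 1) = a - n - 1 by ring]
      linear_combination -h2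
  have h3 := tendsto_norm_inner_ev_succ_sub u (fun n : ℕ => a - n) (fun x y hxy => by
    simpa using hxy)
  simp_rw [hd] at h3
  have h4 := tendsto_nhds_unique tendsto_const_nhds h3
  rw [sq_eq_zero_iff, norm_eq_zero, inner_sub_left] at h4
  exact sub_eq_zero.1 h4

/-- The eigenvalue equation paired with `ev k`, with L₊ moved to `ev k` by symmetry. -/
lemma LPlusH_eigen_inner {m : ℕ} {E : ℝ} {u : H1} (h : LPlusH m u = (E : ℂ) • (u : L2)) (k : ℤ) :
    ((k.natAbs : ℂ) - m) * inner ℂ (qv k) (u : L2) + m * inner ℂ (qv 0) (u : L2) =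
      E * inner ℂ (ev k) (u : L2) := by
  have h1 := LPlusH_symm m ⟨ev k, ev_mem_H1 k⟩ u
  rw [h, LPlusH_ev, inner_add_left, inner_smul_left, inner_smul_left, inner_smul_right] at h1
  simpa using h1

/-- An eigenfunction of `L₊` has only the frequencies `|k| ≤ m`. -/
lemma LPlusH_eigen_support {m : ℕ} {E : ℝ} {u : H1}
    (h : LPlusH m u = (E : ℂ) • (u : L2)) {k : ℤ} (hk : m < k.natAbs) :
    inner ℂ (qv k) (u : L2) = 0 := by
  -- The sign ε treats the two directions of frequency at once.
  obtain ⟨ε, hε, n, hn⟩ : ∃ ε : ℤ, (ε = 1 ∨ ε = -1) ∧ ∃ n : ℕ, k = ε * (m + n + 1) := by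
    rcases le_total 0 k with h0 | h0
    · exact ⟨1, Or.inl rfl, k.natAbs - m - 1, by omega⟩
    · exact ⟨-1, Or.inr rfl, k.natAbs - m - 1, by omega⟩
  have habs : ∀ j : ℕ, (ε * ((m : ℤ) + j)).natAbs = m + j := by
    intro j
    rcases hε with rfl | rfl <;> omega
  -- Subtracting the equation at frequency ε m, where the factor |k| - m vanishes, eliminates the
  -- moment of order zero.
  have hrel : ∀ j : ℕ, (j : ℂ) * inner ℂ (qv (ε * (m + j))) (u : L2) =
      E * (inner ℂ (ev (ε * (m + j))) (u : L2) - inner ℂ (ev (ε * m)) (u : L2)) := by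
    intro j
    have h1 := LPlusH_eigen_inner h (ε * (m + j))
    have h2 := LPlusH_eigen_inner h (ε * m)
    have h0 := habs 0
    simp only [Nat.cast_zero, add_zero] at h0
    rw [habs] at h1
    rw [h0] at h2
    push_cast at h1
    linear_combination h1 - h2
  by_cases hE : E = 0
  · have h1 := hrel (n + 1)
    rw [hE] at h1
    push_cast at h1
    rw [zero_mul, ← add_assoc, ← hn] at h1
    exact (mul_eq_zero.1 h1).resolve_left (by exact_mod_cast Nat.succ_ne_zero n)
  -- Normalized so that `x 0 = 0`; the moments are -1/2 times its second differences, so `hrel`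
  -- becomes the discrete Coulomb equation.
  set x : ℕ → ℂ := fun j => inner ℂ (ev (ε * (m + j))) (u : L2) -
    inner ℂ (ev (ε * m)) (u : L2) with hx
  have hdiff : ∀ j : ℕ, inner ℂ (qv (ε * (m + ((j + 1 : ℕ) : ℤ)))) (u : L2) =
      (-(1 / 2) : ℂ) * (x (j + 2) - 2 * x (j + 1) + x j) := by
    intro j
    rw [inner_qv_eq]
    simp only [hx]
    push_cast
    rcases hε with rfl | rfl
    · rw [show (1 : ℤ) * (m + (j + 1)) + 1 = 1 * (m + (j + 2)) by ring,
        show (1 : ℤ) * (m + (j + 1)) - 1 = 1 * (m + j) by ring]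
      ring
    · rw [show (-1 : ℤ) * (m + (j + 1)) + 1 = -1 * (m + j) by ring,
        show (-1 : ℤ) * (m + (j + 1)) - 1 = -1 * (m + (j + 2)) by ring]
      ring
  have hzero := eq_zero_of_recurrence hE (x := x) (by simp [hx]) (fun j => by
      have h1 := hrel (j + 1)
      rw [hdiff] at h1
      change _ = _ * x (j + 1) at h1
      push_cast at h1
      linear_combination (-2 : ℂ) * h1) (by
      rcases hε with rfl | rfl
      · refine ((summable_inner_ev_succ_sub (u : L2)).comp_injective
          (i := fun j : ℕ => (m : ℤ) + j) (fun a b hab => by simpa using hab)).congr fun j => ?_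
        simp only [hx, Function.comp_apply, inner_sub_left, one_mul]
        push_cast
        rw [← add_assoc]
        congr 2
        ring
      · refine ((summable_inner_ev_succ_sub (u : L2)).comp_injective
          (i := fun j : ℕ => -((m : ℤ) + j + 1)) (fun a b hab => by simpa using hab)).congr
            fun j => ?_
        simp only [hx, Function.comp_apply, inner_sub_left]
        push_cast
        rw [← norm_neg, show -((m : ℤ) + j + 1) + 1 = -1 * (m + j) by ring,
          show -((m : ℤ) + j + 1) = -1 * (m + (j + 1)) by ring]
        congr 2
        ring)
  have h1 := hdiff n
  rw [hzero, hzero, hzero] at h1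
  push_cast at h1
  rw [← add_assoc, ← hn] at h1
  simpa using h1

/-- An eigenfunction of `L₊` without the frequency `m` vanishes. -/
lemma LPlusH_eigen_eq_zero {m : ℕ} (hm : 1 ≤ m) {E : ℝ} {u : H1}
    (h : LPlusH m u = (E : ℂ) • (u : L2)) (hu : inner ℂ (qv m) (u : L2) = 0) : (u : L2) = 0 := by
  have hsup := fun k => LPlusH_eigen_support h (k := k)
  -- Descend from frequency m. While the pairing with `ev k` equals that with `ev m`, comparing the
  -- equations at k and m leaves `(|k| - m)` times the moment. The bound on n keeps k above -m, so
  -- this factor is nonzero.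
  have key : ∀ n : ℕ, n ≤ 2 * m - 1 → (∀ k : ℤ, (m : ℤ) - n ≤ k → inner ℂ (qv k) (u : L2) = 0) ∧
      inner ℂ (ev (m - n - 1)) (u : L2) = inner ℂ (ev m) (u : L2) := by
    intro n
    induction n with
    | zero =>
      intro _
      have h0 : ∀ k : ℤ, (m : ℤ) - (0 : ℕ) ≤ k → inner ℂ (qv k) (u : L2) = 0 := by
        intro k hk
        rcases eq_or_lt_of_le hk with hk | hk
        · rw [← hk]; simpa using hu
        · exact hsup k (by omega)
      refine ⟨h0, ?_⟩
      have := inner_ev_succ_eq h0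
      simp only [Nat.cast_zero, sub_zero] at this ⊢
      exact this.symm
    | succ n ih =>
      intro hn
      obtain ⟨h1, h2⟩ := ih (by omega)
      have hk : ∀ k : ℤ, (m : ℤ) - ((n + 1 : ℕ) : ℤ) ≤ k → inner ℂ (qv k) (u : L2) = 0 := by
        intro k hk
        rcases eq_or_lt_of_le hk with hk | hk
        · have e1 := LPlusH_eigen_inner h (m : ℤ)
          have e2 := LPlusH_eigen_inner h k
          have hk' : k = m - n - 1 := by rw [← hk]; push_cast; ring
          have e3 : inner ℂ (ev k) (u : L2) = inner ℂ (ev m) (u : L2) := by rw [hk', h2]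
          rw [e3, ← e1] at e2
          simp only [Int.natAbs_natCast, sub_self, zero_mul, zero_add] at e2
          have e4 : ((k.natAbs : ℂ) - m) * inner ℂ (qv k) (u : L2) = 0 := by
            linear_combination e2
          refine (mul_eq_zero.1 e4).resolve_left fun h0 => ?_
          have : k.natAbs = m := by exact_mod_cast sub_eq_zero.1 h0
          omega
        · exact h1 k (by push_cast at hk; omega)
      refine ⟨hk, ?_⟩
      have := inner_ev_succ_eq hk
      rw [← this, ← h2]
      congr 2
      push_cast
      ring
  obtain ⟨h1, h2⟩ := key (2 * m - 1) le_rfl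
  have e1 : ((2 * m - 1 : ℕ) : ℤ) = 2 * m - 1 := by omega
  rw [e1] at h1 h2
  have h3 := inner_ev_succ_eq h1
  -- The last frequency is -m: the first differences on both of its sides vanish, and so does its
  -- moment.
  have h4 := inner_ev_pred_eq (u := (u : L2)) (a := -(m : ℤ) - 1) (fun k hk => hsup k (by omega))
  refine eq_zero_of_inner_qv fun k => ?_
  rcases lt_or_ge k (-(m : ℤ)) with hk | hk
  · exact hsup k (by omega)
  · rcases eq_or_lt_of_le hk with hk | hk
    · rw [← hk, inner_qv_eq]
      rw [show -(m : ℤ) - 1 + 1 = -m by ring] at h4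
      rw [show (m : ℤ) - (2 * m - 1) - 1 = -m by ring, show (m : ℤ) - (2 * m - 1) = -m + 1 by ring] at h3
      rw [← h4, h3]
      ring
    · exact h1 k (by omega)

/-! ### Trigonometric polynomials of degree at most m vanishing at infinity. -/

/-- The nonzero frequencies of modulus at most `m`. -/
noncomputable def freq (m : ℕ) : Finset ℤ := (Finset.Icc (-(m : ℤ)) m).erase 0

lemma mem_freq {m : ℕ} {k : ℤ} : k ∈ freq m ↔ k ≠ 0 ∧ k.natAbs ≤ m := by
  rw [freq, Finset.mem_erase, Finset.mem_Icc]
  constructor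
  · rintro ⟨h1, h2, h3⟩; exact ⟨h1, by omega⟩
  · rintro ⟨h1, h2⟩; exact ⟨h1, by omega, by omega⟩

lemma card_freq (m : ℕ) : (freq m).card = 2 * m := by
  rw [freq, Finset.card_erase_of_mem (Finset.mem_Icc.2 ⟨by omega, by omega⟩), Int.card_Icc]
  omega

/-- The trigonometric polynomials of degree at most `m` which vanish at infinity. -/
noncomputable def trigPoly (m : ℕ) : Submodule ℂ L2 :=
  Submodule.span ℂ (Set.range fun k : freq m => ev k)

lemma ev_mem_trigPoly {m : ℕ} {k : ℤ} (hk : k.natAbs ≤ m) : ev k ∈ trigPoly m := by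
  by_cases h0 : k = 0
  · rw [h0, ev_zero]; exact Submodule.zero_mem _
  · exact Submodule.subset_span ⟨⟨k, mem_freq.2 ⟨h0, hk⟩⟩, rfl⟩

lemma qv_mem_trigPoly {m : ℕ} {k : ℤ} (hk : k.natAbs < m) : qv k ∈ trigPoly m := by
  rw [qv_eq]
  exact Submodule.smul_mem _ _ (Submodule.add_mem _ (Submodule.sub_mem _
    (ev_mem_trigPoly (by omega)) (Submodule.smul_mem _ _ (ev_mem_trigPoly (by omega))))
    (ev_mem_trigPoly (by omega)))

lemma linearIndependent_ev (m : ℕ) : LinearIndependent ℂ fun k : freq m => ev k := by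
  rw [Fintype.linearIndependent_iff]
  intro g hg i
  have h := congrArg (fun v => inner ℂ (qv i) v) hg
  simp only [inner_sum, inner_smul_right, inner_qv_ev, inner_zero_right,
    (mem_freq.1 i.2).1, if_false, sub_zero] at h
  rw [Finset.sum_eq_single i] at h
  · simpa [Real.pi_ne_zero] using h
  · intro b _ hb
    rw [if_neg (fun hib => hb (Subtype.ext hib.symm)), mul_zero]
  · simp

lemma finrank_trigPoly (m : ℕ) : Module.finrank ℂ (trigPoly m) = 2 * m := by
  rw [trigPoly, finrank_span_eq_card (linearIndependent_ev m), Fintype.card_coe, card_freq]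

instance (m : ℕ) : FiniteDimensional ℂ (trigPoly m) :=
  FiniteDimensional.span_of_finite ℂ (Set.finite_range _)

/-- The first differences vanish on both sides of a, hence so does the second difference at a. One
missing moment is therefore harmless. -/
lemma eq_zero_of_inner_qv_of_ne {u : L2} {a : ℤ} (h : ∀ k, k ≠ a → inner ℂ (qv k) u = 0) :
    u = 0 := by
  refine eq_zero_of_inner_qv fun k => ?_
  by_cases hk : k = a
  · have h1 := inner_ev_succ_eq (u := u) (a := a + 1) (fun k hk => h k (by omega))
    have h2 := inner_ev_pred_eq (u := u) (a := a - 1) (fun k hk => h k (by omega))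
    rw [hk, inner_qv_eq, h1, ← h2, sub_add_cancel, add_sub_cancel_right]
    ring
  · exact h k hk

lemma mem_trigPoly_iff {m : ℕ} {u : L2} :
    u ∈ trigPoly m ↔ ∀ k : ℤ, m < k.natAbs → inner ℂ (qv k) u = 0 := by
  constructor
  · intro hu k hk
    induction hu using Submodule.span_induction with
    | mem x hx =>
      obtain ⟨j, rfl⟩ := hx
      have := (mem_freq.1 j.2)
      rw [inner_qv_ev, if_neg, if_neg, sub_zero]
      · rintro rfl; simp at hk
      · rintro rfl; omega
    | zero => simp
    | add x y _ _ hx hy => rw [inner_add_right, hx, hy, add_zero]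
    | smul c x _ hx => rw [inner_smul_right, hx, mul_zero]
  · intro h
    -- By biorthogonality w has the same nonzero moments as u; the moment of order zero need not be
    -- compared.
    set w : L2 := ∑ k ∈ freq m, ((1 / (2 * (Real.pi : ℂ))) * inner ℂ (qv k) u) • ev k with hw
    have hwm : w ∈ trigPoly m := Submodule.sum_mem _ fun k hk =>
      Submodule.smul_mem _ _ (ev_mem_trigPoly (mem_freq.1 hk).2)
    have hz : u - w = 0 := by
      refine eq_zero_of_inner_qv_of_ne (a := 0) fun k hk => ?_
      rw [inner_sub_right, hw, inner_sum]
      simp only [inner_smul_right, inner_qv_ev, hk, if_false, sub_zero]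
      have := two_pi_ne
      by_cases hkm : k ∈ freq m
      · rw [Finset.sum_eq_single k]
        · rw [if_pos rfl]
          field_simp
          ring
        · intro b _ hb
          rw [if_neg hb.symm, mul_zero]
        · intro h; exact absurd hkm h
      · rw [Finset.sum_eq_zero, h k, sub_zero]
        · by_contra hc
          exact hkm (mem_freq.2 ⟨hk, by omega⟩)
        · intro b hb
          rw [if_neg, mul_zero]
          rintro rfl
          exact hkm hb
    rw [sub_eq_zero.1 hz]
    exact hwm

/-! ### The kernel of L₋, its relation to R, and the eigenvalues of L₊ and L₋. -/

lemma trigPoly_le_H1 (m : ℕ) : trigPoly m ≤ H1 := by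
  rw [trigPoly, Submodule.span_le]
  rintro _ ⟨k, rfl⟩
  exact ev_mem_H1 k

/-- Pairing with `ev k` gives `(|k| - m)₊` times the k-th moment, so exactly the frequencies beyond
m are excluded. -/
lemma LMinusH_eq_zero_iff {m : ℕ} (u : H1) : LMinusH m u = 0 ↔ (u : L2) ∈ trigPoly m := by
  constructor
  · intro h
    rw [mem_trigPoly_iff]
    intro k hk
    have h1 := LMinusH_symm m ⟨ev k, ev_mem_H1 k⟩ u
    rw [h, LMinusH_ev, inner_smul_left, inner_zero_right] at h1
    refine (mul_eq_zero.1 h1).resolve_left ?_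
    rw [map_natCast]
    exact_mod_cast (by omega : k.natAbs - m ≠ 0)
  · intro h
    have hle : trigPoly m ≤ (LinearMap.ker (LMinusH m)).map H1.subtype := by
      rw [trigPoly, Submodule.span_le]
      rintro _ ⟨k, rfl⟩
      refine ⟨⟨ev k, ev_mem_H1 k⟩, ?_, rfl⟩
      change LMinusH m _ = 0
      rw [LMinusH_ev, Nat.sub_eq_zero_of_le (mem_freq.1 k.2).2, Nat.cast_zero, zero_smul]
    obtain ⟨v, hv, hvu⟩ := hle h
    have : v = u := Subtype.ext hvu
    rw [← this]
    exact hv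

/-- R produces `qv k` only for |k| < m, and the weight raises the degree by one, just up to m. -/
lemma ROp_mem_trigPoly (m : ℕ) (u : L2) : ROp m u ∈ trigPoly m := by
  rw [ROp_eq]
  refine Submodule.sum_mem _ fun j hj => Submodule.sum_mem _ fun l hl =>
    Submodule.smul_mem _ _ (qv_mem_trigPoly ?_)
  have := Finset.mem_range.1 hj
  have := Finset.mem_range.1 hl
  omega

lemma LMinusH_ROp (m : ℕ) (u : L2) :
    LMinusH m ⟨ROp m u, trigPoly_le_H1 m (ROp_mem_trigPoly m u)⟩ = 0 :=
  (LMinusH_eq_zero_iff _).2 (ROp_mem_trigPoly m u)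

/-- The adjoint of L₋ R = 0. This identity decouples the system at every nonzero energy. -/
lemma ROp_LMinusH (m : ℕ) (u : H1) : ROp m (LMinusH m u) = 0 := by
  refine ext_inner_left ℂ fun v => ?_
  have h1 := ROp_isSymmetric m v (LMinusH m u)
  have h2 := LMinusH_symm m ⟨ROp m v, trigPoly_le_H1 m (ROp_mem_trigPoly m v)⟩ u
  rw [LMinusH_ROp, inner_zero_left] at h2
  rw [inner_zero_right, ← h1]
  exact h2.symm

lemma LPlusH_eq (m : ℕ) (u : H1) : LPlusH m u = LMinusH m u - ROp m u := by
  rw [LPlusH_apply, LMinusH_apply, add_sub_cancel_right]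

lemma LPlusH_of_mem {m : ℕ} {u : H1} (hu : (u : L2) ∈ trigPoly m) : LPlusH m u = -ROp m u := by
  rw [LPlusH_eq, (LMinusH_eq_zero_iff u).2 hu, zero_sub]

lemma eigenvalue_real {T : H1 →ₗ[ℂ] L2}
    (hT : ∀ u v : H1, inner ℂ (T u) (v : L2) = inner ℂ (u : L2) (T v)) {z : ℂ} {u : H1}
    (hu : (u : L2) ≠ 0) (h : T u = z • (u : L2)) : z = (z.re : ℂ) := by
  have h1 := hT u u
  rw [h, inner_smul_left, inner_smul_right] at h1
  have h2 : inner ℂ (u : L2) (u : L2) ≠ 0 := inner_self_ne_zero.2 hu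
  exact (Complex.conj_eq_iff_re.1 (mul_right_cancel₀ h2 h1)).symm

lemma LPlusH_eigen_mem {m : ℕ} {z : ℂ} {u : H1} (h : LPlusH m u = z • (u : L2)) :
    (u : L2) ∈ trigPoly m := by
  by_cases hu : (u : L2) = 0
  · rw [hu]; exact Submodule.zero_mem _
  have hz := eigenvalue_real (LPlusH_symm m) hu h
  rw [hz] at h
  exact mem_trigPoly_iff.2 fun k hk => LPlusH_eigen_support h hk

/-- `L₋` has no eigenvalue except zero. -/
lemma LMinusH_eigen_eq_zero {m : ℕ} {z : ℂ} (hz : z ≠ 0) {u : H1}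
    (h : LMinusH m u = z • (u : L2)) : (u : L2) = 0 := by
  -- R kills the range of L₋. The eigenvector is then one of L₊ too, hence a trigonometric
  -- polynomial, hence in ker L₋.
  have hR : ROp m u = 0 := by
    have h1 := ROp_LMinusH m u
    rw [h, map_smul] at h1
    exact (smul_eq_zero.1 h1).resolve_left hz
  have h2 : LPlusH m u = z • (u : L2) := by rw [LPlusH_eq, hR, sub_zero, h]
  have h3 := (LMinusH_eq_zero_iff u).2 (LPlusH_eigen_mem h2)
  rw [h] at h3
  exact (smul_eq_zero.1 h3).resolve_left hz

lemma re_inner_ROp_nonneg (m : ℕ) (u : L2) : 0 ≤ (inner ℂ u (ROp m u)).re := by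
  rw [ROp_eq, inner_sum, Complex.re_sum]
  refine Finset.sum_nonneg fun j _ => ?_
  rw [inner_sum, Complex.re_sum]
  refine Finset.sum_nonneg fun l _ => ?_
  rw [inner_smul_right, mul_assoc, ← inner_conj_symm u, Complex.mul_conj]
  have : (1 / (2 * (Real.pi : ℂ))) = ((1 / (2 * Real.pi) : ℝ) : ℂ) := by push_cast; rfl
  rw [this, ← Complex.ofReal_mul, Complex.ofReal_re]
  have := Real.pi_pos
  have := Complex.normSq_nonneg (inner ℂ (qv ((j : ℤ) - l)) u)
  positivity

/-- The eigenfunction is a trigonometric polynomial, where L₊ = -R and R is nonnegative. -/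
lemma LPlusH_eigenvalue_nonpos {m : ℕ} {E : ℝ} {u : H1} (hu : (u : L2) ≠ 0)
    (h : LPlusH m u = (E : ℂ) • (u : L2)) : E ≤ 0 := by
  have h1 := LPlusH_of_mem (LPlusH_eigen_mem h)
  have h2 := re_inner_ROp_nonneg m u
  have h3 : ROp m u = -((E : ℂ) • (u : L2)) := by rw [← h, h1, neg_neg]
  rw [h3, inner_neg_right, inner_smul_right, inner_self_eq_norm_sq_to_K] at h2
  have h4 : 0 < ‖(u : L2)‖ ^ 2 := by have := norm_pos_iff.2 hu; positivity
  have h5 : (-((E : ℂ) * ((‖(u : L2)‖ : ℂ)) ^ 2)).re = -(E * ‖(u : L2)‖ ^ 2) := by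
    rw [← Complex.ofReal_pow, ← Complex.ofReal_mul, ← Complex.ofReal_neg, Complex.ofReal_re]
  have h6 : 0 ≤ -(E * ‖(u : L2)‖ ^ 2) := by rw [← h5]; exact h2
  nlinarith

/-- The zero mode `cay ^ m - cay ^ (-m)` of `L₊`. -/
lemma LPlusH_eq_zero_iff {m : ℕ} (hm : 1 ≤ m) (u : H1) :
    LPlusH m u = 0 ↔ (u : L2) ∈ Submodule.span ℂ {ev m - ev (-m)} := by
  have h0 : (ev m - ev (-m) : L2) ∈ H1 := H1.sub_mem (ev_mem_H1 _) (ev_mem_H1 _)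
  have hz : LPlusH m ⟨ev m - ev (-m), h0⟩ = 0 := by
    have : (⟨ev m - ev (-m), h0⟩ : H1) = ⟨ev m, ev_mem_H1 _⟩ - ⟨ev (-m), ev_mem_H1 _⟩ := rfl
    rw [this, map_sub, LPlusH_ev, LPlusH_ev]
    simp
  constructor
  · intro h
    have hE : ∀ v : H1, LPlusH m v = 0 → LPlusH m v = ((0 : ℝ) : ℂ) • (v : L2) := by
      intro v hv; rw [hv]; simp
    -- This coefficient makes the difference w a zero mode without the frequency m, which must
    -- vanish.
    set a : ℂ := inner ℂ (qv m) (u : L2) / (2 * Real.pi) with ha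
    set w : H1 := u - a • ⟨ev m - ev (-m), h0⟩ with hw
    have h1 : LPlusH m w = 0 := by rw [hw, map_sub, map_smul, h, hz, smul_zero, sub_zero]
    have h2 : inner ℂ (qv m) (w : L2) = 0 := by
      have e : (w : L2) = u - a • (ev m - ev (-m)) := rfl
      have hm0 : (m : ℤ) ≠ 0 := by omega
      have hm1 : (m : ℤ) ≠ -m := by omega
      rw [e, inner_sub_right, inner_smul_right, inner_sub_right, inner_qv_ev, inner_qv_ev, ha,
        if_pos rfl, if_neg hm0, if_neg hm1]
      have := two_pi_ne
      field_simp
      ring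
    have h3 := LPlusH_eigen_eq_zero hm (hE w h1) h2
    rw [Submodule.mem_span_singleton]
    refine ⟨a, ?_⟩
    have e : (w : L2) = u - a • (ev m - ev (-m)) := rfl
    rw [e, sub_eq_zero] at h3
    exact h3.symm
  · intro h
    obtain ⟨c, hc⟩ := Submodule.mem_span_singleton.1 h
    have : u = c • ⟨ev m - ev (-m), h0⟩ := Subtype.ext hc.symm
    rw [this, map_smul, hz, smul_zero]

lemma ev_sub_ev_ne_zero {m : ℕ} (hm : 1 ≤ m) : (ev m - ev (-m) : L2) ≠ 0 := by
  intro h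
  have h1 : inner ℂ (qv m) (ev m - ev (-m)) = 0 := by rw [h, inner_zero_right]
  have hm0 : (m : ℤ) ≠ 0 := by omega
  have hm1 : (m : ℤ) ≠ -m := by omega
  rw [inner_sub_right, inner_qv_ev, inner_qv_ev, if_pos rfl, if_neg hm0, if_neg hm1] at h1
  have := two_pi_ne
  simp at h1

/-! ### Resolvents -/

section Resolvent

variable {E : Type*} [NormedAddCommGroup E] [NormedSpace ℂ E]

/-- `B` is the resolvent of `T` at `z`. -/
def IsResolvent (T : E →ₗ.[ℂ] E) (z : ℂ) (B : E →L[ℂ] E) : Prop :=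
  (∀ y : E, ∃ h : B y ∈ T.domain, z • B y - T ⟨B y, h⟩ = y) ∧
    (∀ x : T.domain, B (z • (x : E) - T x) = x)

/-- The Neumann series for a bounded perturbation. -/
lemma IsResolvent.exists_of_perturbation [CompleteSpace E] {D : Submodule ℂ E} {T T' : D →ₗ[ℂ] E}
    {z z' : ℂ} {B : E →L[ℂ] E} (hB : IsResolvent ⟨D, T⟩ z B) (C : E →L[ℂ] E)
    (hT : ∀ x : D, z' • (x : E) - T' x = z • (x : E) - T x - C x) (hC : ‖C‖ * ‖B‖ < 1) :
    ∃ B' : E →L[ℂ] E, IsResolvent ⟨D, T'⟩ z' B' := by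
  have hn : ‖C * B‖ < 1 := (norm_mul_le C B).trans_lt hC
  -- On the domain z' - T' = (1 - C B)(z - T), so the new resolvent is B (1 - C B)⁻¹.
  set U : (E →L[ℂ] E)ˣ := Units.oneSub (C * B) hn with hU
  have hUv : (U : E →L[ℂ] E) = 1 - C * B := rfl
  have h1 : ∀ y, (U : E →L[ℂ] E) ((↑U⁻¹ : E →L[ℂ] E) y) = y := fun y => by
    rw [← mul_apply_eq_comp, Units.mul_inv, one_apply_eq_self]
  have h2 : ∀ y, (↑U⁻¹ : E →L[ℂ] E) ((U : E →L[ℂ] E) y) = y := fun y => by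
    rw [← mul_apply_eq_comp, Units.inv_mul, one_apply_eq_self]
  refine ⟨B * (↑U⁻¹ : E →L[ℂ] E), fun y => ?_, fun x => ?_⟩
  · obtain ⟨h, hy⟩ := hB.1 ((↑U⁻¹ : E →L[ℂ] E) y)
    refine ⟨h, ?_⟩
    refine (hT ⟨_, h⟩).trans ?_
    have : z • B ((↑U⁻¹ : E →L[ℂ] E) y) - T ⟨B ((↑U⁻¹ : E →L[ℂ] E) y), h⟩ =
      (↑U⁻¹ : E →L[ℂ] E) y := hy
    simp only
    rw [this]
    conv_rhs => rw [← h1 y, hUv]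
    simp
  · have hx := hB.2 x
    have h3 : z' • (x : E) - T' x = (U : E →L[ℂ] E) (z • (x : E) - T x) := by
      rw [hT, hUv, sub_apply, one_apply_eq_self,
        mul_apply_eq_comp]
      congr 1
      exact congrArg C hx.symm
    change (B * (↑U⁻¹ : E →L[ℂ] E)) (z' • (x : E) - T' x) = x
    rw [h3, mul_apply_eq_comp, h2]
    exact hx

end Resolvent

section SymmetricResolvent

variable {E : Type*} [NormedAddCommGroup E] [InnerProductSpace ℂ E]

/-- The number ⟨x, T x⟩ is real, so the imaginary part of ⟨x, (z - T) x⟩ is that of z times ‖x‖². -/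
lemma abs_im_mul_norm_le {D : Submodule ℂ E} {T : D →ₗ[ℂ] E}
    (hT : ∀ u v : D, inner ℂ (T u) (v : E) = inner ℂ (u : E) (T v)) (z : ℂ) (x : D) :
    |z.im| * ‖(x : E)‖ ≤ ‖z • (x : E) - T x‖ := by
  by_cases hx : (x : E) = 0
  · rw [hx, norm_zero, mul_zero]; positivity
  have hx' := norm_pos_iff.2 hx
  have h1 : (inner ℂ (x : E) (T x)).im = 0 := by
    have := hT x x
    rw [← inner_conj_symm] at this
    exact Complex.conj_eq_iff_im.1 this
  have h2 : (inner ℂ (x : E) (z • (x : E) - T x)).im = z.im * ‖(x : E)‖ ^ 2 := by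
    rw [inner_sub_right, inner_smul_right, Complex.sub_im, h1, sub_zero,
      inner_self_eq_norm_sq_to_K]
    have : (((‖(x : E)‖ : ℝ) : ℂ) ^ 2) = ((‖(x : E)‖ ^ 2 : ℝ) : ℂ) := by push_cast; rfl
    change (z * ((‖(x : E)‖ : ℝ) : ℂ) ^ 2).im = _
    rw [this, Complex.im_mul_ofReal]
  have h3 : |z.im| * ‖(x : E)‖ ^ 2 ≤ ‖(x : E)‖ * ‖z • (x : E) - T x‖ := by
    rw [← abs_of_nonneg (sq_nonneg ‖(x : E)‖), ← abs_mul, ← h2]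
    exact (Complex.abs_im_le_norm _).trans (norm_inner_le_norm _ _)
  have h4 : ‖(x : E)‖ * (|z.im| * ‖(x : E)‖) ≤ ‖(x : E)‖ * ‖z • (x : E) - T x‖ := by
    calc _ = |z.im| * ‖(x : E)‖ ^ 2 := by ring
      _ ≤ _ := h3
  exact le_of_mul_le_mul_left h4 hx'

lemma IsResolvent.norm_le {D : Submodule ℂ E} {T : D →ₗ[ℂ] E}
    (hT : ∀ u v : D, inner ℂ (T u) (v : E) = inner ℂ (u : E) (T v)) {z : ℂ} (hz : z.im ≠ 0)
    {B : E →L[ℂ] E} (hB : IsResolvent ⟨D, T⟩ z B) : ‖B‖ ≤ |z.im|⁻¹ := by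
  have h0 := abs_pos.2 hz
  refine ContinuousLinearMap.opNorm_le_bound _ (by positivity) fun y => ?_
  obtain ⟨h, hy⟩ := hB.1 y
  have h1 := abs_im_mul_norm_le hT z ⟨B y, h⟩
  have h2 : z • B y - T ⟨B y, h⟩ = y := hy
  simp only [h2] at h1
  rw [inv_mul_eq_div, le_div_iff₀ h0, mul_comm]
  exact h1

/-- A bounded symmetric perturbation of a self-adjoint operator is self-adjoint. -/
lemma exists_resolvent_of_symmetric_perturbation [CompleteSpace E] {D : Submodule ℂ E}
    {T T' : D →ₗ[ℂ] E}
    (hT : ∀ u v : D, inner ℂ (T u) (v : E) = inner ℂ (u : E) (T v))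
    (hT' : ∀ u v : D, inner ℂ (T' u) (v : E) = inner ℂ (u : E) (T' v))
    (hres : ∀ z : ℂ, z.im ≠ 0 → ∃ B, IsResolvent ⟨D, T⟩ z B) (C : E →L[ℂ] E)
    (hC : ∀ x : D, T' x = T x + C x) {z : ℂ} (hz : z.im ≠ 0) :
    ∃ B, IsResolvent ⟨D, T'⟩ z B := by
  obtain ⟨t, ht, htC⟩ : ∃ t : ℝ, 1 ≤ t ∧ ‖C‖ < t * |z.im| := by
    have h0 := abs_pos.2 hz
    refine ⟨(‖C‖ + 1) / |z.im| + 1, by have := norm_nonneg C; have : 0 ≤ (‖C‖ + 1) / |z.im| := by positivity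
                                       linarith, ?_⟩
    rw [add_mul, div_mul_cancel₀ _ h0.ne']
    linarith
  -- Far from the real axis the resolvent of T has norm below 1/‖C‖ if C ≠ 0, and the Neumann series
  -- for T' converges.
  set z₀ : ℂ := ⟨z.re, t * z.im⟩ with hz₀
  have hz₀i : |z₀.im| = t * |z.im| := by
    change |t * z.im| = _
    rw [abs_mul, abs_of_pos (by linarith)]
  have hpos : 0 < t * |z.im| := (norm_nonneg C).trans_lt htC
  have hz₀0 : z₀.im ≠ 0 := abs_pos.1 (hz₀i ▸ hpos)
  obtain ⟨B, hB⟩ := hres z₀ hz₀0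
  have hBn := hB.norm_le hT hz₀0
  rw [hz₀i] at hBn
  obtain ⟨B₀, hB₀⟩ := hB.exists_of_perturbation (T' := T') (z' := z₀) C
    (fun x => by rw [hC]; abel) (by
      calc ‖C‖ * ‖B‖ ≤ ‖C‖ * (t * |z.im|)⁻¹ := by gcongr
        _ < 1 := by rw [← div_eq_mul_inv, div_lt_one hpos]; exact htC)
  have hB₀n := hB₀.norm_le hT' hz₀0
  rw [hz₀i] at hB₀n
  -- One step back to z: its length (t - 1)|Im z| is less than t|Im z|, and symmetry of T' bounds
  -- ‖B₀‖ by the inverse of the latter.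
  refine hB₀.exists_of_perturbation (z' := z) ((z₀ - z) • (1 : E →L[ℂ] E)) (fun x => ?_) ?_
  · rw [smul_apply, one_apply_eq_self]
    module
  · have h1 : ‖(z₀ - z) • (1 : E →L[ℂ] E)‖ ≤ (t - 1) * |z.im| := by
      refine ContinuousLinearMap.opNorm_le_bound _ (mul_nonneg (by linarith) (abs_nonneg _))
        fun y => ?_
      rw [smul_apply, one_apply_eq_self, norm_smul]
      refine mul_le_mul_of_nonneg_right (le_of_eq ?_) (norm_nonneg _)
      have : z₀ - z = (((t - 1) * z.im : ℝ) : ℂ) * I := by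
        apply Complex.ext <;> simp [hz₀, sub_mul]
      rw [this, norm_mul, Complex.norm_real, Complex.norm_I, mul_one, Real.norm_eq_abs, abs_mul,
        abs_of_nonneg (by linarith)]
    calc ‖(z₀ - z) • (1 : E →L[ℂ] E)‖ * ‖B₀‖ ≤ ((t - 1) * |z.im|) * (t * |z.im|)⁻¹ := by
          gcongr
      _ < 1 := by
          rw [← div_eq_mul_inv, div_lt_one hpos]
          have := abs_pos.2 hz
          nlinarith

end SymmetricResolvent

/-! ### The resolvents of |∇| and L₋. -/

lemma exists_mulCLM {b : ℝ → ℂ} (hb : AEStronglyMeasurable b volume) {C : ℝ}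
    (hC : ∀ x, ‖b x‖ ≤ C) :
    ∃ M : L2 →L[ℂ] L2, ∀ u : L2, (M u : ℝ → ℂ) =ᵐ[volume] fun x => b x * u x := by
  have hm : ∀ u : L2, MemLp (fun x => b x * u x) 2 volume := fun u =>
    (Lp.memLp u).of_le_mul (c := C) (hb.mul (Lp.aestronglyMeasurable u))
      (Eventually.of_forall fun x => by
        rw [norm_mul]; exact mul_le_mul_of_nonneg_right (hC x) (norm_nonneg _))
  refine ⟨LinearMap.mkContinuous
    { toFun := fun u => (hm u).toLp _
      map_add' := fun u v => ?_
      map_smul' := fun c u => ?_ } C fun u => ?_, fun u => (hm u).coeFn_toLp⟩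
  · rw [← MemLp.toLp_add]
    refine MemLp.toLp_congr _ _ ?_
    filter_upwards [Lp.coeFn_add u v] with x hx
    simp only [hx, Pi.add_apply, mul_add]
  · rw [RingHom.id_apply, ← MemLp.toLp_const_smul]
    refine MemLp.toLp_congr _ _ ?_
    filter_upwards [Lp.coeFn_smul c u] with x hx
    simp only [hx, Pi.smul_apply, smul_eq_mul]
    ring
  · refine Lp.norm_le_mul_norm_of_ae_le_mul ?_
    filter_upwards [(hm u).coeFn_toLp] with x hx
    change ‖(hm u).toLp _ x‖ ≤ _
    rw [hx, norm_mul]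
    exact mul_le_mul_of_nonneg_right (hC x) (norm_nonneg _)

lemma exists_resolvent_absGrad {z : ℂ} (hz : z.im ≠ 0) :
    ∃ B : L2 →L[ℂ] L2, IsResolvent ⟨H1, absGrad⟩ z B := by
  have him : ∀ ξ, (z - absSymbol ξ).im = z.im := fun ξ => by simp [absSymbol]
  have hne : ∀ ξ, z - absSymbol ξ ≠ 0 := fun ξ h => hz (by rw [← him ξ, h, Complex.zero_im])
  have hb : Continuous fun ξ => (z - absSymbol ξ)⁻¹ :=
    (continuous_const.sub continuous_absSymbol).inv₀ hne
  obtain ⟨M, hM⟩ := exists_mulCLM hb.aestronglyMeasurable (C := |z.im|⁻¹)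
    fun ξ => by
      rw [norm_inv]
      refine inv_anti₀ (abs_pos.2 hz) ?_
      rw [← him ξ]
      exact Complex.abs_im_le_norm _
  let F : L2 ≃ₗᵢ[ℂ] L2 := Lp.fourierTransformₗᵢ ℝ ℂ
  let B : L2 →L[ℂ] L2 := (F.symm : L2 →L[ℂ] L2).comp (M.comp (F : L2 →L[ℂ] L2))
  have hFB : ∀ y : L2, (𝓕 (B y) : L2) = M (𝓕 y) := fun y => F.apply_symm_apply _
  refine ⟨B, fun y => ?_, fun x => ?_⟩
  · have hg : IsGrad (B y) (z • B y - y) := by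
      unfold IsGrad
      rw [sub_eq_add_neg, FourierTransform.fourier_add, FourierTransform.fourier_smul,
        ← neg_one_smul ℂ y, FourierTransform.fourier_smul, hFB]
      filter_upwards [hM (𝓕 y), Lp.coeFn_add (z • M (𝓕 y)) ((-1 : ℂ) • (𝓕 y : L2)),
        Lp.coeFn_smul z (M (𝓕 y)), Lp.coeFn_smul (-1 : ℂ) (𝓕 y : L2)] with ξ h1 h2 h3 h4
      rw [h2, Pi.add_apply, h3, h4, Pi.smul_apply, Pi.smul_apply, h1, smul_eq_mul, smul_eq_mul]
      have := hne ξ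
      field_simp
      ring
    refine ⟨hg.mem_H1, ?_⟩
    change z • B y - absGrad ⟨B y, hg.mem_H1⟩ = y
    rw [hg.absGrad_eq, sub_sub_cancel]
  · change B (z • (x : L2) - absGrad x) = x
    apply F.injective
    change (𝓕 (B (z • (x : L2) - absGrad x)) : L2) = 𝓕 (x : L2)
    rw [hFB]
    refine Lp.ext ?_
    have hx := isGrad_absGrad x
    rw [sub_eq_add_neg, FourierTransform.fourier_add, FourierTransform.fourier_smul,
        ← neg_one_smul ℂ (absGrad x), FourierTransform.fourier_smul]
    filter_upwards [hM (z • 𝓕 (x : L2) + (-1 : ℂ) • 𝓕 (absGrad x)), hx,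
      Lp.coeFn_add (z • (𝓕 (x : L2) : L2)) ((-1 : ℂ) • (𝓕 (absGrad x) : L2)),
      Lp.coeFn_smul z (𝓕 (x : L2) : L2), Lp.coeFn_smul (-1 : ℂ) (𝓕 (absGrad x) : L2)]
      with ξ h1 h2 h3 h4 h5
    rw [h1, h3, Pi.add_apply, h4, h5, Pi.smul_apply, Pi.smul_apply, h2, smul_eq_mul, smul_eq_mul]
    have := hne ξ
    field_simp
    ring

lemma exists_resolvent_LMinusH (m : ℕ) {z : ℂ} (hz : z.im ≠ 0) :
    ∃ B : L2 →L[ℂ] L2, IsResolvent ⟨H1, LMinusH m⟩ z B := by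
  -- Everywhere defined symmetric operators are bounded (Hellinger–Toeplitz), so no norm estimates
  -- are needed.
  let V' : L2 →L[ℂ] L2 := ⟨VOp m, (VOp_isSymmetric m).continuous⟩
  let R' : L2 →L[ℂ] L2 := ⟨ROp m, (ROp_isSymmetric m).continuous⟩
  refine exists_resolvent_of_symmetric_perturbation absGrad_symm (LMinusH_symm m)
    (fun z hz => exists_resolvent_absGrad hz) (R' - V') (fun x => ?_) hz
  change LMinusH m x = absGrad x + (ROp m x - VOp m x)
  rw [LMinusH_apply]
  abel

/-! ### The spectrum of the linearized operator -/

lemma JL_apply (m : ℕ) (u v : H1) (h : ((u : L2), (v : L2)) ∈ (JL m).domain) :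
    JL m ⟨((u : L2), (v : L2)), h⟩ = (-LMinusH m v, LPlusH m u) := rfl

/-- Applying R to the first equation gives R u = 0, so L₊ u may be replaced by L₋ u. The
combinations u ± i v then diagonalize the system into eigenvalue equations for L₋ at ∓ i z. -/
lemma JL_eigen_eq_zero {m : ℕ} {z : ℂ} (hz : z ≠ 0) {u v : H1}
    (h1 : -LMinusH m v = z • (u : L2)) (h2 : LPlusH m u = z • (v : L2)) :
    (u : L2) = 0 ∧ (v : L2) = 0 := by
  have hR : ROp m u = 0 := by
    have h := ROp_LMinusH m v
    rw [← neg_neg (LMinusH m v), h1, map_neg, map_smul, neg_eq_zero] at h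
    exact (smul_eq_zero.1 h).resolve_left hz
  rw [LPlusH_eq, hR, sub_zero] at h2
  have h1' : LMinusH m v = -(z • (u : L2)) := by rw [← h1, neg_neg]
  have hI : I * I = -1 := Complex.I_mul_I
  have e1 : ((u + I • v : H1) : L2) = 0 := by
    refine LMinusH_eigen_eq_zero (m := m) (z := -I * z) (by simp [hz]) ?_
    rw [map_add, map_smul, h2, h1', Submodule.coe_add, Submodule.coe_smul]
    have : (-I * z) • ((u : L2) + I • (v : L2)) =
      -((I * z) • (u : L2)) - ((I * I) * z) • (v : L2) := by module
    rw [this, hI]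
    module
  have e2 : ((u - I • v : H1) : L2) = 0 := by
    refine LMinusH_eigen_eq_zero (m := m) (z := I * z) (by simp [hz]) ?_
    rw [map_sub, map_smul, h2, h1', Submodule.coe_sub, Submodule.coe_smul]
    have : (I * z) • ((u : L2) - I • (v : L2)) =
      (I * z) • (u : L2) - ((I * I) * z) • (v : L2) := by module
    rw [this, hI]
    module
  rw [Submodule.coe_add, Submodule.coe_smul] at e1
  rw [Submodule.coe_sub, Submodule.coe_smul] at e2
  constructor
  · have : (u : L2) = (1 / 2 : ℂ) • (((u : L2) + I • (v : L2)) + ((u : L2) - I • (v : L2))) := by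
      module
    rw [this, e1, e2, add_zero, smul_zero]
  · have : (v : L2) = (-(I / 2) : ℂ) • (((u : L2) + I • (v : L2)) - ((u : L2) - I • (v : L2))) := by
      have : (-(I / 2) : ℂ) • (((u : L2) + I • (v : L2)) - ((u : L2) - I • (v : L2))) =
        (-(I * I)) • (v : L2) := by module
      rw [this, hI, neg_neg, one_smul]
    rw [this, e1, e2, sub_zero, smul_zero]

lemma pointSpectrum_JL_subset (m : ℕ) : pointSpectrum (JL m) ⊆ {0} := by
  rintro z ⟨⟨u, v⟩, hne, hd, he⟩
  by_contra hz
  have h := JL_eigen_eq_zero (m := m) (z := z) hz (u := ⟨u, hd.1⟩) (v := ⟨v, hd.2⟩)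
    (congrArg Prod.fst he) (congrArg Prod.snd he)
  exact hne (Prod.ext h.1 h.2)

lemma mem_presolventSet_JL (m : ℕ) {z : ℂ} (hz : z.re ≠ 0) : z ∈ presolventSet (JL m) := by
  have hz0 : z ≠ 0 := fun h => hz (by rw [h, Complex.zero_re])
  obtain ⟨B₁, hB₁, -⟩ := exists_resolvent_LMinusH m (z := -I * z) (by simpa using hz)
  obtain ⟨B₂, hB₂, -⟩ := exists_resolvent_LMinusH m (z := I * z) (by simpa using hz)
  let R' : L2 →L[ℂ] L2 := ⟨ROp m, (ROp_isSymmetric m).continuous⟩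
  let f : L2 × L2 →L[ℂ] L2 := ContinuousLinearMap.fst ℂ L2 L2
  let g : L2 × L2 →L[ℂ] L2 := ContinuousLinearMap.snd ℂ L2 L2
  let P : L2 × L2 →L[ℂ] L2 := B₁.comp (g - I • f)
  let Q' : L2 × L2 →L[ℂ] L2 := B₂.comp (g + I • f)
  let A : L2 × L2 →L[ℂ] L2 := (1 / 2 : ℂ) • (P + Q')
  -- Without the last term this solves the system with L₋ in place of L₊. Since R applied to the
  -- first equation gives R a = z⁻¹ R y₁, the term makes up for L₊ = L₋ - R; it does not disturb the
  -- first equation because L₋ R = 0.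
  let C : L2 × L2 →L[ℂ] L2 := (-(I / 2) : ℂ) • (P - Q') - (z ^ 2)⁻¹ • R'.comp f
  have hI : I * I = -1 := Complex.I_mul_I
  have hright : ∀ y : L2 × L2, ∃ h : (A.prod C) y ∈ (JL m).domain,
      z • (A.prod C) y - JL m ⟨(A.prod C) y, h⟩ = y := by
    intro y
    obtain ⟨hP, hP'⟩ := hB₁ (y.2 - I • y.1)
    obtain ⟨hQ, hQ'⟩ := hB₂ (y.2 + I • y.1)
    set p : H1 := ⟨B₁ (y.2 - I • y.1), hP⟩ with hp
    set q : H1 := ⟨B₂ (y.2 + I • y.1), hQ⟩ with hq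
    replace hP' : (-I * z) • (p : L2) - LMinusH m p = y.2 - I • y.1 := hP'
    replace hQ' : (I * z) • (q : L2) - LMinusH m q = y.2 + I • y.1 := hQ'
    set r : H1 := ⟨ROp m y.1, trigPoly_le_H1 m (ROp_mem_trigPoly m y.1)⟩ with hr
    have hTr : LMinusH m r = 0 := LMinusH_ROp m y.1
    set a : H1 := (1 / 2 : ℂ) • (p + q) with ha
    set b : H1 := (-(I / 2) : ℂ) • (p - q) - (z ^ 2)⁻¹ • r with hb
    have hAy : A y = a := rfl
    have hCy : C y = b := rfl
    have hTp : LMinusH m p = (-I * z) • (p : L2) - (y.2 - I • y.1) := by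
      rw [← hP', sub_sub_cancel]
    have hTq : LMinusH m q = (I * z) • (q : L2) - (y.2 + I • y.1) := by
      rw [← hQ', sub_sub_cancel]
    have hTb : z • (a : L2) + LMinusH m b = y.1 := by
      rw [hb, map_sub, map_smul, map_smul, hTr, smul_zero, sub_zero, map_sub, hTp, hTq, ha,
        Submodule.coe_smul, Submodule.coe_add]
      have : z • (1 / 2 : ℂ) • ((p : L2) + (q : L2)) + (-(I / 2)) •
          ((-I * z) • (p : L2) - (y.2 - I • y.1) - ((I * z) • (q : L2) - (y.2 + I • y.1))) =
          (z / 2 * (1 + I * I)) • ((p : L2) + (q : L2)) + (-(I * I)) • y.1 := by module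
      rw [this, hI]
      module
    have hRa : z • ROp m a = ROp m y.1 := by
      have := congrArg (ROp m) hTb
      rwa [map_add, map_smul, ROp_LMinusH, add_zero] at this
    have hTa : z • (b : L2) - LPlusH m a = y.2 := by
      have e : ROp m a = z⁻¹ • ROp m y.1 := by rw [← hRa, smul_smul, inv_mul_cancel₀ hz0, one_smul]
      rw [LPlusH_eq, e]
      have hrL : (r : L2) = ROp m y.1 := rfl
      rw [hb, ha, map_smul, map_add, hTp, hTq, Submodule.coe_sub, Submodule.coe_smul,
        Submodule.coe_smul, Submodule.coe_sub, hrL]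
      have hzz : z * (z ^ 2)⁻¹ = z⁻¹ := by field_simp
      have : z • ((-(I / 2)) • ((p : L2) - (q : L2)) - (z ^ 2)⁻¹ • ROp m y.1) -
          ((1 / 2 : ℂ) • ((-I * z) • (p : L2) - (y.2 - I • y.1) +
            ((I * z) • (q : L2) - (y.2 + I • y.1))) - z⁻¹ • ROp m y.1) =
          y.2 + (z⁻¹ - z * (z ^ 2)⁻¹) • ROp m y.1 := by module
      rw [this, hzz, sub_self, zero_smul, add_zero]
    refine ⟨⟨a.2, b.2⟩, Prod.ext ?_ ?_⟩
    · change z • (a : L2) - -LMinusH m b = y.1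
      rw [sub_neg_eq_add, hTb]
    · exact hTa
  refine ⟨A.prod C, hright, fun x => ?_⟩
  -- The right inverse is also a left inverse: a discrepancy would be an eigenvector for the nonzero
  -- value z.
  obtain ⟨h, hy⟩ := hright (z • (x : L2 × L2) - JL m x)
  set w := (A.prod C) (z • (x : L2 × L2) - JL m x) with hw
  set d : (JL m).domain := ⟨w, h⟩ - x with hd
  have hd1 : JL m d = z • (d : L2 × L2) := by
    rw [hd, LinearPMap.map_sub, Submodule.coe_sub, smul_sub]
    have : JL m ⟨w, h⟩ = z • w - (z • (x : L2 × L2) - JL m x) := by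
      exact (sub_eq_of_eq_add' (sub_eq_iff_eq_add.1 hy)).symm
    rw [this]
    abel
  by_contra hne
  refine hz0 (pointSpectrum_JL_subset m ⟨(d : L2 × L2), ?_, d.2, hd1⟩)
  rw [hd, Submodule.coe_sub]
  exact sub_ne_zero.2 hne

/-! ### Quasimodes -/

lemma norm_fourierInv_le (G : ℝ → ℂ) (x : ℝ) : ‖𝓕⁻ G x‖ ≤ ∫ ξ, ‖G ξ‖ := by
  rw [Real.fourierInv_eq']
  refine (norm_integral_le_integral_norm _).trans (le_of_eq ?_)
  congr 1
  funext v
  rw [norm_smul, Complex.norm_exp_ofReal_mul_I, one_mul]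

/-- The Fourier transform of u is the indicator of an interval of length ℓ starting at E / 2π. For
small ℓ the sup norm ℓ is negligible against the L² norm √ℓ, so decaying perturbations do not see u.
-/
lemma exists_quasimode {E ℓ : ℝ} (hE : 0 ≤ E) (hℓ : 0 < ℓ) : ∃ u : H1, ‖(u : L2)‖ = √ℓ ∧
    ‖absGrad u - (E : ℂ) • (u : L2)‖ ≤ 2 * Real.pi * ℓ * √ℓ ∧ ∀ᵐ x, ‖(u : L2) x‖ ≤ ℓ := by
  set a : ℝ := E / (2 * Real.pi) with ha
  have ha0 : 0 ≤ a := by positivity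
  have hEa : E = 2 * Real.pi * a := by rw [ha]; field_simp
  set s : Set ℝ := Set.Ioc a (a + ℓ) with hs
  have hsm : MeasurableSet s := measurableSet_Ioc
  have hvol : volume.real s = ℓ := by
    rw [hs, Real.volume_real_Ioc_of_le (by linarith)]; ring
  have hsf : volume s ≠ ∞ := by rw [hs, Real.volume_Ioc]; exact ENNReal.ofReal_ne_top
  set G : ℝ → ℂ := s.indicator fun _ => 1 with hG
  have hG1 : Integrable G := by
    rw [hG, integrable_indicator_iff hsm]
    exact integrableOn_const hsf
  have hG2 : MemLp G 2 volume := memLp_indicator_const 2 hsm 1 (Or.inr hsf)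
  have hGn : ‖hG2.toLp G‖ = √ℓ := by
    have : hG2.toLp G = indicatorConstLp 2 hsm hsf (1 : ℂ) := rfl
    rw [this, norm_indicatorConstLp (by norm_num) (by norm_num), hvol, norm_one, one_mul,
      Real.sqrt_eq_rpow]
    simp
  have hint : ∫ ξ, ‖G ξ‖ = ℓ := by
    have : (fun ξ => ‖G ξ‖) = s.indicator fun _ => (1 : ℝ) := by
      funext ξ
      rw [hG, norm_indicator_eq_indicator_norm]
      simp
    rw [this, integral_indicator hsm, setIntegral_const, hvol, smul_eq_mul, mul_one]
  have hmem : ∀ ξ ∈ s, ‖absSymbol ξ - E‖ ≤ 2 * Real.pi * ℓ := by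
    intro ξ hξ
    have h0 : 0 ≤ ξ := ha0.trans hξ.1.le
    rw [absSymbol, ← Complex.ofReal_sub, Complex.norm_real, abs_of_nonneg h0, hEa, ← mul_sub,
      Real.norm_of_nonneg (mul_nonneg (by positivity) (by linarith [hξ.1]))]
    have := hξ.2
    gcongr
    linarith
  have hm3 : MemLp (fun ξ => (absSymbol ξ - E) * G ξ) 2 volume := by
    refine hG2.of_le_mul (c := 2 * Real.pi * ℓ)
      ((continuous_absSymbol.sub continuous_const).aestronglyMeasurable.mul
        hG1.aestronglyMeasurable) (Eventually.of_forall fun ξ => ?_)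
    by_cases hξ : ξ ∈ s
    · rw [norm_mul]
      exact mul_le_mul_of_nonneg_right (hmem ξ hξ) (norm_nonneg _)
    · rw [hG, Set.indicator_of_notMem hξ]; simp
  set u : L2 := 𝓕⁻ (hG2.toLp G : L2) with hu
  set w : L2 := 𝓕⁻ (hm3.toLp _ : L2) with hw
  have hFu : (𝓕 u : L2) = hG2.toLp G := FourierTransform.fourier_fourierInv_eq _
  have hFw : (𝓕 w : L2) = hm3.toLp _ := FourierTransform.fourier_fourierInv_eq _
  have hgrad : IsGrad u (w + (E : ℂ) • u) := by
    unfold IsGrad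
    rw [FourierTransform.fourier_add, FourierTransform.fourier_smul, hFu, hFw]
    filter_upwards [hm3.coeFn_toLp, hG2.coeFn_toLp, Lp.coeFn_add (hm3.toLp _ : L2)
      ((E : ℂ) • (hG2.toLp G : L2)), Lp.coeFn_smul (E : ℂ) (hG2.toLp G : L2)] with ξ h1 h2 h3 h4
    rw [h3, Pi.add_apply, h4, Pi.smul_apply, h1, h2, smul_eq_mul]
    ring
  refine ⟨⟨u, hgrad.mem_H1⟩, ?_, ?_, ?_⟩
  · change ‖u‖ = √ℓ
    rw [← Lp.norm_fourier_eq, hFu, hGn]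
  · rw [hgrad.absGrad_eq]
    change ‖w + (E : ℂ) • u - (E : ℂ) • u‖ ≤ _
    rw [add_sub_cancel_right, ← Lp.norm_fourier_eq, hFw, ← hGn]
    refine Lp.norm_le_mul_norm_of_ae_le_mul ?_
    filter_upwards [hm3.coeFn_toLp, hG2.coeFn_toLp] with ξ h1 h2
    rw [h1, h2]
    by_cases hξ : ξ ∈ s
    · rw [norm_mul]
      exact mul_le_mul_of_nonneg_right (hmem ξ hξ) (norm_nonneg _)
    · rw [hG, Set.indicator_of_notMem hξ]; simp
  · filter_upwards [coeFn_fourierInv_toLp hG1 hG2] with x hx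
    rw [hu, hx, ← hint]
    exact norm_fourierInv_le G x

lemma norm_VOp_le (m : ℕ) {u : L2} {ℓ : ℝ} (hu : ∀ᵐ x, ‖u x‖ ≤ ℓ) :
    ‖VOp m u‖ ≤ ℓ * ‖(m : ℂ) • qv 0‖ := by
  refine Lp.norm_le_mul_norm_of_ae_le_mul ?_
  filter_upwards [hu, (memLp_V_mul m u).coeFn_toLp, Lp.coeFn_smul (m : ℂ) (qv 0),
    (memLp_wt_mul_cay 0).coeFn_toLp] with x h1 h2 h3 h4
  change ‖(memLp_V_mul m u).toLp _ x‖ ≤ _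
  rw [h2, h3, Pi.smul_apply, qv, h4, V_eq_cast, norm_mul, zpow_zero, mul_one, smul_eq_mul,
    mul_comm]
  exact mul_le_mul_of_nonneg_right h1 (norm_nonneg _)

lemma norm_inner_qv_le (k : ℤ) {u : L2} {ℓ : ℝ} (hu : ∀ᵐ x, ‖u x‖ ≤ ℓ) :
    ‖inner ℂ (qv k) u‖ ≤ ℓ * ∫ x, wt x := by
  rw [inner_eq_integral, ← integral_const_mul]
  refine norm_integral_le_of_norm_le (integrable_wt.const_mul ℓ) ?_
  filter_upwards [hu, (memLp_wt_mul_cay k).coeFn_toLp] with x h1 h2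
  rw [norm_mul, RCLike.norm_conj, qv, h2, norm_mul, norm_cay_zpow, mul_one, Complex.norm_real,
    Real.norm_of_nonneg (wt_pos x).le, mul_comm]
  exact mul_le_mul_of_nonneg_right h1 (wt_pos x).le

/-- R sees u only through finitely many moments, each at most the sup norm of u times ∫ wt. -/
lemma exists_norm_ROp_le (m : ℕ) : ∃ K : ℝ, 0 ≤ K ∧ ∀ (u : L2) (ℓ : ℝ),
    (∀ᵐ x, ‖u x‖ ≤ ℓ) → ‖ROp m u‖ ≤ K * ℓ := by
  have hw : 0 ≤ ∫ x, wt x := integral_nonneg fun x => (wt_pos x).le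
  refine ⟨∑ j ∈ Finset.range m, ∑ l ∈ Finset.range m,
    ‖(1 / (2 * (Real.pi : ℂ)))‖ * (∫ x, wt x) * ‖qv ((j : ℤ) - l)‖, by positivity,
    fun u ℓ hu => ?_⟩
  rw [ROp_eq, Finset.sum_mul]
  refine (norm_sum_le _ _).trans (Finset.sum_le_sum fun j _ => ?_)
  rw [Finset.sum_mul]
  refine (norm_sum_le _ _).trans (Finset.sum_le_sum fun l _ => ?_)
  rw [norm_smul, norm_mul]
  calc _ ≤ ‖(1 / (2 * (Real.pi : ℂ)))‖ * (ℓ * ∫ x, wt x) * ‖qv ((j : ℤ) - l)‖ := by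
        gcongr
        exact norm_inner_qv_le _ hu
    _ = _ := by ring

lemma imaginary_axis_subset_pspectrum (m : ℕ) {z : ℂ} (hz : z.re = 0) :
    z ∈ pspectrum (JL m) := by
  rintro ⟨B, -, hB⟩
  set μ : ℝ := z.im with hμ
  have hzμ : z = I * μ := by apply Complex.ext <;> simp [hz, hμ]
  obtain ⟨ε, hε, hεμ⟩ : ∃ ε : ℝ, ε * ε = 1 ∧ μ = ε * |μ| := by
    rcases le_total 0 μ with h | h
    · exact ⟨1, by norm_num, by rw [abs_of_nonneg h, one_mul]⟩
    · exact ⟨-1, by norm_num, by rw [abs_of_nonpos h]; ring⟩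
  obtain ⟨K, hK0, hK⟩ := exists_norm_ROp_le m
  set M : ℝ := 2 * Real.pi + ‖(m : ℂ) • qv 0‖ + K with hM
  have hM0 : 0 ≤ M := by positivity
  set c : ℝ := ‖B‖ * M with hc
  have hc0 : 0 ≤ c := by positivity
  -- With ℓ = t² the packet has norm t and residual at most M t², so a resolvent would give t ≤ c
  -- t², contradicting c t < 1.
  set t : ℝ := 1 / (c + 1) with ht
  have ht0 : 0 < t := by positivity
  have ht1 : t ≤ 1 := by rw [ht, div_le_one (by positivity)]; linarith
  obtain ⟨u, hu1, hu2, hu3⟩ := exists_quasimode (abs_nonneg μ) (show 0 < t ^ 2 by positivity)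
  rw [Real.sqrt_sq ht0.le] at hu1 hu2
  have hV := norm_VOp_le m hu3
  have hR := hK u (t ^ 2) hu3
  have h3 : 2 * Real.pi * t ^ 2 * t ≤ 2 * Real.pi * t ^ 2 :=
    mul_le_of_le_one_right (by positivity) ht1
  have hLp : ‖((|μ| : ℝ) : ℂ) • (u : L2) - LPlusH m u‖ ≤ M * t ^ 2 := by
    have : ((|μ| : ℝ) : ℂ) • (u : L2) - LPlusH m u =
        VOp m u - (absGrad u - ((|μ| : ℝ) : ℂ) • (u : L2)) := by
      rw [LPlusH_apply]; abel
    rw [this]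
    refine (norm_sub_le _ _).trans ?_
    have : 0 ≤ K * t ^ 2 := by positivity
    rw [hM]
    linarith
  have hLm : ‖((|μ| : ℝ) : ℂ) • (u : L2) - LMinusH m u‖ ≤ M * t ^ 2 := by
    have : ((|μ| : ℝ) : ℂ) • (u : L2) - LMinusH m u =
        VOp m u - (absGrad u - ((|μ| : ℝ) : ℂ) • (u : L2)) - ROp m u := by
      rw [LMinusH_apply]; abel
    rw [this]
    refine (norm_sub_le _ _).trans ((add_le_add_left (norm_sub_le _ _) _).trans ?_)
    rw [hM]
    linarith
  -- The symbol of |∇| is nonnegative, so the packet sits at energy |μ|; the factor -i ε restores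
  -- the sign of μ and turns both components of the residual into that of a single operator.
  set v : H1 := (-I * ε) • u with hv
  have hdom : ((u : L2), (v : L2)) ∈ (JL m).domain := ⟨u.2, v.2⟩
  have hx := hB ⟨((u : L2), (v : L2)), hdom⟩
  have hy : ‖z • ((u : L2), (v : L2)) - JL m ⟨((u : L2), (v : L2)), hdom⟩‖ ≤ M * t ^ 2 := by
    rw [JL_apply, Prod.norm_def]
    refine max_le ?_ ?_
    · change ‖z • (u : L2) - -LMinusH m v‖ ≤ _
      have : z • (u : L2) - -LMinusH m v =
          (I * ε) • (((|μ| : ℝ) : ℂ) • (u : L2) - LMinusH m u) := by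
        rw [hv, map_smul, hzμ]
        nth_rw 1 [hεμ]
        push_cast
        module
      rw [this, norm_smul, norm_mul, Complex.norm_I, one_mul, Complex.norm_real]
      have : ‖ε‖ = 1 := by
        rw [Real.norm_eq_abs, ← sq_eq_sq₀ (abs_nonneg _) zero_le_one, sq_abs]; linarith
      rw [this, one_mul]
      exact hLm
    · change ‖z • (v : L2) - LPlusH m u‖ ≤ _
      have : z • (v : L2) - LPlusH m u = ((|μ| : ℝ) : ℂ) • (u : L2) - LPlusH m u := by
        congr 1
        rw [hv, Submodule.coe_smul, smul_smul, hzμ]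
        congr 1
        have e : (ε : ℂ) * ε = 1 := by exact_mod_cast hε
        have e2 : (μ : ℂ) = ε * (|μ| : ℝ) := by exact_mod_cast hεμ
        rw [e2]
        linear_combination (-((ε : ℂ) * ε) * (|μ| : ℝ)) * Complex.I_mul_I + ((|μ| : ℝ) : ℂ) * e
      rw [this]
      exact hLp
  have h1 : t ≤ ‖B‖ * (M * t ^ 2) := by
    calc t = ‖(u : L2)‖ := hu1.symm
      _ ≤ ‖((u : L2), (v : L2))‖ := by rw [Prod.norm_def]; exact le_max_left _ _
      _ = ‖B (z • ((u : L2), (v : L2)) - JL m ⟨((u : L2), (v : L2)), hdom⟩)‖ := by rw [hx]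
      _ ≤ ‖B‖ * (M * t ^ 2) := (B.le_opNorm _).trans (by gcongr)
  have h2 : t * (c + 1) = 1 := by rw [ht]; field_simp
  have h4 : ‖B‖ * (M * t ^ 2) = c * t * t := by rw [hc]; ring
  rw [h4] at h1
  nlinarith

lemma pspectrum_JL (m : ℕ) : pspectrum (JL m) = {z : ℂ | z.re = 0} := by
  ext z
  refine ⟨fun h => ?_, fun h => imaginary_axis_subset_pspectrum m h⟩
  by_contra hz
  exact h (mem_presolventSet_JL m hz)

/-! ### Kernels -/

section Kernels

variable {E : Type*} [NormedAddCommGroup E] [NormedSpace ℂ E]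

lemma mem_pker {T : E →ₗ.[ℂ] E} {x : E} : x ∈ pker T ↔ ∃ h : x ∈ T.domain, T ⟨x, h⟩ = 0 := by
  constructor
  · rintro ⟨y, hy, rfl⟩
    exact ⟨y.2, hy⟩
  · rintro ⟨h, hx⟩
    exact ⟨⟨x, h⟩, hx, rfl⟩

lemma mem_pker_ppow_zero {T : E →ₗ.[ℂ] E} {x : E} : x ∈ pker (ppow T 0) ↔ x = 0 := by
  rw [mem_pker]
  exact ⟨fun ⟨_, h⟩ => h, fun h => ⟨trivial, h⟩⟩

lemma mem_pker_ppow_succ {T : E →ₗ.[ℂ] E} {n : ℕ} {x : E} :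
    x ∈ pker (ppow T (n + 1)) ↔ ∃ h : x ∈ T.domain, T ⟨x, h⟩ ∈ pker (ppow T n) := by
  rw [mem_pker]
  constructor
  · rintro ⟨⟨h1, h2⟩, hx⟩
    exact ⟨h1, mem_pker.2 ⟨h2, hx⟩⟩
  · rintro ⟨h1, h⟩
    obtain ⟨h2, hx⟩ := mem_pker.1 h
    exact ⟨⟨h1, h2⟩, hx⟩

end Kernels

/-- For a symmetric operator the kernel of the square is the kernel. This keeps the generalized
kernel of 𝓛 inside `trigPoly m × trigPoly m`. -/
lemma mem_trigPoly_of_LMinusH {m : ℕ} {u : H1} (h : LMinusH m u ∈ trigPoly m) :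
    (u : L2) ∈ trigPoly m := by
  have h1 := (LMinusH_eq_zero_iff ⟨LMinusH m u, trigPoly_le_H1 m h⟩).2 h
  have h2 := LMinusH_symm m u ⟨LMinusH m u, trigPoly_le_H1 m h⟩
  rw [h1, inner_zero_right] at h2
  exact (LMinusH_eq_zero_iff u).1 (inner_self_eq_zero.1 h2)

lemma mem_prod_of_JL {m : ℕ} {x : L2 × L2} (hx : x ∈ (JL m).domain)
    (h : JL m ⟨x, hx⟩ ∈ (trigPoly m).prod (trigPoly m)) :
    x ∈ (trigPoly m).prod (trigPoly m) := by
  obtain ⟨h1, h2⟩ := h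
  change -LMinusH m ⟨x.2, hx.2⟩ ∈ trigPoly m at h1
  change LPlusH m ⟨x.1, hx.1⟩ ∈ trigPoly m at h2
  refine ⟨?_, ?_⟩
  · refine mem_trigPoly_of_LMinusH (m := m) (u := ⟨x.1, hx.1⟩) ?_
    have := (trigPoly m).add_mem h2 (ROp_mem_trigPoly m x.1)
    rw [LPlusH_eq] at this
    simpa using this
  · exact mem_trigPoly_of_LMinusH (m := m) (u := ⟨x.2, hx.2⟩) ((Submodule.neg_mem_iff _).1 h1)

lemma pker_ppow_JL_le (m n : ℕ) :
    pker (ppow (JL m) n) ≤ (trigPoly m).prod (trigPoly m) := by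
  induction n with
  | zero =>
    intro x hx
    rw [mem_pker_ppow_zero.1 hx]
    exact Submodule.zero_mem _
  | succ n ih =>
    intro x hx
    obtain ⟨h1, h2⟩ := mem_pker_ppow_succ.1 hx
    exact mem_prod_of_JL h1 (ih h2)

/-- On pairs of trigonometric polynomials 𝓛 acts as (u, v) ↦ (0, -R u), which is nilpotent of order
two. -/
lemma pker_ppow_two_JL (m : ℕ) :
    pker (ppow (JL m) 2) = (trigPoly m).prod (trigPoly m) := by
  refine le_antisymm (pker_ppow_JL_le m 2) ?_
  rintro ⟨u, v⟩ ⟨hu, hv⟩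
  have hd : (u, v) ∈ (JL m).domain := ⟨trigPoly_le_H1 m hu, trigPoly_le_H1 m hv⟩
  have e1 : JL m ⟨(u, v), hd⟩ = (0, -ROp m u) := by
    have h1 := (LMinusH_eq_zero_iff ⟨v, hd.2⟩).2 hv
    have h2 := LPlusH_of_mem (u := ⟨u, hd.1⟩) hu
    refine Prod.ext ?_ h2
    change -LMinusH m ⟨v, hd.2⟩ = 0
    rw [h1, neg_zero]
  refine mem_pker_ppow_succ.2 ⟨hd, mem_pker_ppow_succ.2 ?_⟩
  rw [e1]
  have hr : -ROp m u ∈ trigPoly m := (trigPoly m).neg_mem (ROp_mem_trigPoly m u)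
  refine ⟨⟨H1.zero_mem, trigPoly_le_H1 m hr⟩, mem_pker_ppow_zero.2 ?_⟩
  refine Prod.ext ?_ ?_
  · have h1 := (LMinusH_eq_zero_iff ⟨-ROp m u, trigPoly_le_H1 m hr⟩).2 hr
    change -LMinusH m ⟨-ROp m u, trigPoly_le_H1 m hr⟩ = 0
    rw [h1, neg_zero]
  · exact map_zero (LPlusH m)

lemma iUnion_pker_ppow_JL (m : ℕ) :
    (⋃ n ≥ 1, (pker (ppow (JL m) n) : Set (L2 × L2))) = pker (ppow (JL m) 2) := by
  refine Set.Subset.antisymm (Set.iUnion₂_subset fun n _ => ?_) ?_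
  · rw [pker_ppow_two_JL]
    exact pker_ppow_JL_le m n
  · exact Set.subset_biUnion_of_mem (u := fun n => (pker (ppow (JL m) n) : Set (L2 × L2)))
      (show (2 : ℕ) ∈ {n | n ≥ 1} by simp)

lemma pker_JL {m : ℕ} (hm : 1 ≤ m) :
    pker (JL m) = (Submodule.span ℂ {ev m - ev (-m)}).prod (trigPoly m) := by
  have h0 : (ev m - ev (-m) : L2) ∈ H1 := H1.sub_mem (ev_mem_H1 _) (ev_mem_H1 _)
  ext ⟨u, v⟩
  rw [mem_pker]
  constructor
  · rintro ⟨h, hx⟩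
    have h1 : -LMinusH m ⟨v, h.2⟩ = 0 := congrArg Prod.fst hx
    have h2 : LPlusH m ⟨u, h.1⟩ = 0 := congrArg Prod.snd hx
    exact ⟨(LPlusH_eq_zero_iff hm ⟨u, h.1⟩).1 h2,
      (LMinusH_eq_zero_iff ⟨v, h.2⟩).1 (neg_eq_zero.1 h1)⟩
  · rintro ⟨hu, hv⟩
    have hu1 : u ∈ H1 := (Submodule.span_singleton_le_iff_mem _ _).2 h0 hu
    refine ⟨⟨hu1, trigPoly_le_H1 m hv⟩, Prod.ext ?_ ?_⟩
    · change -LMinusH m ⟨v, trigPoly_le_H1 m hv⟩ = 0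
      rw [(LMinusH_eq_zero_iff ⟨v, trigPoly_le_H1 m hv⟩).2 hv, neg_zero]
    · exact (LPlusH_eq_zero_iff hm ⟨u, hu1⟩).2 hu

/-- The product of two submodules is linearly equivalent to the product of the submodules as
modules. -/
def submoduleProdEquiv {K V W : Type*} [Ring K] [AddCommGroup V] [AddCommGroup W] [Module K V]
    [Module K W] (p : Submodule K V) (q : Submodule K W) : p.prod q ≃ₗ[K] p × q where
  toFun x := (⟨x.1.1, x.2.1⟩, ⟨x.1.2, x.2.2⟩)
  invFun x := ⟨(x.1, x.2), x.1.2, x.2.2⟩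
  map_add' _ _ := rfl
  map_smul' _ _ := rfl
  left_inv _ := rfl
  right_inv _ := rfl

lemma finrank_pker_JL {m : ℕ} (hm : 1 ≤ m) : Module.finrank ℂ (pker (JL m)) = 2 * m + 1 := by
  rw [pker_JL hm, (submoduleProdEquiv _ _).finrank_eq,
    Module.finrank_prod, finrank_span_singleton (ev_sub_ev_ne_zero hm), finrank_trigPoly, add_comm]

lemma pointSpectrum_JL {m : ℕ} (hm : 1 ≤ m) : pointSpectrum (JL m) = {0} := by
  refine Set.Subset.antisymm (pointSpectrum_JL_subset m) ?_
  rintro z rfl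
  have h : ((ev m - ev (-m), 0) : L2 × L2) ∈ pker (JL m) := by
    rw [pker_JL hm]
    exact ⟨Submodule.mem_span_singleton_self _, Submodule.zero_mem _⟩
  obtain ⟨h1, h2⟩ := mem_pker.1 h
  refine ⟨_, fun h0 => ev_sub_ev_ne_zero hm (congrArg Prod.fst h0), h1, ?_⟩
  rw [h2, zero_smul]

/-! ### The eigenfunctions of `L₊` -/

lemma EigenEq_LPlus_simple {m : ℕ} (hm : 1 ≤ m) {E : ℝ} {φ ψ : L2}
    (hφ : EigenEq (LPlus m) (E : ℂ) φ) (hφ0 : φ ≠ 0) (hψ : EigenEq (LPlus m) (E : ℂ) ψ) :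
    ∃ c : ℂ, ψ = c • φ := by
  obtain ⟨h1, e1⟩ := hφ
  obtain ⟨h2, e2⟩ := hψ
  replace e1 : LPlusH m ⟨φ, h1⟩ = (E : ℂ) • φ := e1
  replace e2 : LPlusH m ⟨ψ, h2⟩ = (E : ℂ) • ψ := e2
  have hc : inner ℂ (qv m) φ ≠ 0 := fun h => hφ0 (LPlusH_eigen_eq_zero hm e1 h)
  refine ⟨inner ℂ (qv m) ψ / inner ℂ (qv m) φ, ?_⟩
  set c := inner ℂ (qv m) ψ / inner ℂ (qv m) φ with hcd
  have h3 : LPlusH m (⟨ψ, h2⟩ - c • ⟨φ, h1⟩) =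
      (E : ℂ) • ((⟨ψ, h2⟩ - c • ⟨φ, h1⟩ : H1) : L2) := by
    rw [map_sub, map_smul, e1, e2, Submodule.coe_sub, Submodule.coe_smul, smul_sub,
      smul_comm c]
  have h4 := LPlusH_eigen_eq_zero hm h3 (by
    rw [Submodule.coe_sub, Submodule.coe_smul, inner_sub_right, inner_smul_right, hcd,
      div_mul_cancel₀ _ hc, sub_self])
  exact sub_eq_zero.1 h4

/-- All eigenfunctions lie in `trigPoly m`, which L₊ = -R leaves invariant. The spectral theorem
gives 2m orthonormal eigenvectors, simplicity makes their eigenvalues distinct, and nonpositivity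
together with the zero mode makes 0 the largest. -/
lemma exists_isEigenSystem {m : ℕ} (hm : 1 ≤ m) :
    ∃ (E : Fin (2 * m) → ℝ) (φ : Fin (2 * m) → L2), IsEigenSystem m E φ := by
  let A : trigPoly m →ₗ[ℂ] trigPoly m :=
    { toFun := fun u => ⟨-ROp m u, (trigPoly m).neg_mem (ROp_mem_trigPoly m u)⟩
      map_add' := fun u v => Subtype.ext (by
        simp only [Submodule.coe_add, map_add]
        abel)
      map_smul' := fun c u => Subtype.ext (by
        simp only [Submodule.coe_smul, map_smul, RingHom.id_apply, smul_neg]) }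
  have hA : A.IsSymmetric := by
    intro u v
    change inner ℂ (-ROp m u) (v : L2) = inner ℂ (u : L2) (-ROp m v)
    rw [inner_neg_left, inner_neg_right, ROp_isSymmetric m]
  have hAL : ∀ (u : trigPoly m), LPlusH m ⟨u, trigPoly_le_H1 m u.2⟩ = A u := fun u =>
    LPlusH_of_mem (u := ⟨(u : L2), trigPoly_le_H1 m u.2⟩) u.2
  let b := hA.eigenvectorBasis (finrank_trigPoly m)
  let e := hA.eigenvalues (finrank_trigPoly m)
  have hb : ∀ i, EigenEq (LPlus m) (e i : ℂ) (b i) := fun i =>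
    ⟨trigPoly_le_H1 m (b i).2, by
      refine (hAL (b i)).trans ?_
      exact congrArg Subtype.val (hA.apply_eigenvectorBasis (finrank_trigPoly m) i)⟩
  have hbo : Orthonormal ℂ fun i => ((b i : trigPoly m) : L2) :=
    b.orthonormal.comp_linearIsometry (trigPoly m).subtypeₗᵢ
  have hsimple : ∀ i, ∀ ψ : L2, EigenEq (LPlus m) (e i : ℂ) ψ → ∃ c : ℂ, ψ = c • (b i : L2) :=
    fun i ψ hψ => EigenEq_LPlus_simple hm (hb i) (hbo.ne_zero i) hψ
  have hinj : Function.Injective e := by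
    intro i j hij
    by_contra hne
    obtain ⟨c, hc⟩ := hsimple j (b i) (hij ▸ hb i)
    have h1 : inner ℂ (b j : L2) (b i : L2) = 0 := hbo.2 (Ne.symm hne)
    rw [hc, inner_smul_right, inner_self_eq_norm_sq_to_K, hbo.1 j] at h1
    have hc0 : c = 0 := by simpa using h1
    rw [hc0, zero_smul] at hc
    exact hbo.ne_zero i hc
  have hanti : StrictAnti e :=
    (hA.eigenvalues_antitone (finrank_trigPoly m)).strictAnti_of_injective hinj
  have hev : ∀ {z : ℂ} {u : L2}, u ≠ 0 → EigenEq (LPlus m) z u → ∃ i, (e i : ℂ) = z := by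
    intro z u hu hz
    obtain ⟨h1, h2⟩ := hz
    have h3 : u ∈ trigPoly m := LPlusH_eigen_mem (u := ⟨u, h1⟩) h2
    have h4 : Module.End.HasEigenvalue A z := by
      refine Module.End.hasEigenvalue_of_hasEigenvector (x := ⟨u, h3⟩)
        (Module.End.hasEigenvector_iff.2 ⟨Module.End.mem_eigenspace_iff.2 (Subtype.ext ?_), ?_⟩)
      · exact (hAL ⟨u, h3⟩).symm.trans h2
      · exact fun h => hu (congrArg Subtype.val h)
    exact hA.exists_eigenvalues_eq (finrank_trigPoly m) h4
  have hnonpos : ∀ i, e i ≤ 0 := fun i => by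
    obtain ⟨h1, h2⟩ := hb i
    exact LPlusH_eigenvalue_nonpos (u := ⟨b i, h1⟩) (hbo.ne_zero i) h2
  have hzero : ∃ i, e i = 0 := by
    have h0 : (ev m - ev (-m) : L2) ∈ H1 := H1.sub_mem (ev_mem_H1 _) (ev_mem_H1 _)
    obtain ⟨i, hi⟩ := hev (z := 0) (ev_sub_ev_ne_zero hm) ⟨h0, by
      rw [zero_smul]
      exact (LPlusH_eq_zero_iff hm ⟨_, h0⟩).2 (Submodule.mem_span_singleton_self _)⟩
    exact ⟨i, by exact_mod_cast hi⟩
  -- The eigenvalues `e` are listed in decreasing order, hence the reversal.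
  refine ⟨fun k => e k.rev, fun k => (b k.rev : L2), ⟨?_, ?_, ?_, ?_, ?_, ?_⟩⟩
  · exact fun i j hij => hanti (Fin.rev_lt_rev.2 hij)
  · intro k hk
    obtain ⟨i, hi⟩ := hzero
    refine le_antisymm (hnonpos _) ?_
    rw [← hi]
    refine hanti.antitone ?_
    rw [Fin.le_def, Fin.val_rev]
    omega
  · ext z
    constructor
    · rintro ⟨u, hu, hz⟩
      obtain ⟨i, hi⟩ := hev hu hz
      exact ⟨i.rev, by simp [hi]⟩
    · rintro ⟨k, rfl⟩
      exact ⟨_, hbo.ne_zero _, hb _⟩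
  · exact fun k => hb _
  · exact fun k => hsimple _
  · exact hbo.comp _ Fin.rev_injective

lemma IsEigenSystem.span_eq {m : ℕ} {E : Fin (2 * m) → ℝ} {φ : Fin (2 * m) → L2}
    (h : IsEigenSystem m E φ) : Submodule.span ℂ (Set.range φ) = trigPoly m := by
  refine Submodule.eq_of_le_of_finrank_eq ?_ ?_
  · rw [Submodule.span_le]
    rintro _ ⟨k, rfl⟩
    obtain ⟨h1, h2⟩ := h.eigen k
    exact LPlusH_eigen_mem (u := ⟨φ k, h1⟩) h2
  · rw [finrank_span_eq_card h.orthonormal.linearIndependent, finrank_trigPoly, Fintype.card_fin]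

lemma IsEigenSystem.pker_ppow_two {m : ℕ} {E : Fin (2 * m) → ℝ} {φ : Fin (2 * m) → L2}
    (h : IsEigenSystem m E φ) : pker (ppow (JL m) 2) = Submodule.span ℂ
      (Set.range (fun k => (φ k, (0 : L2))) ∪ Set.range (fun k => ((0 : L2), φ k))) := by
  have e1 : Set.range (fun k => (φ k, (0 : L2))) = LinearMap.inl ℂ L2 L2 '' Set.range φ := by
    rw [← Set.range_comp]; rfl
  have e2 : Set.range (fun k => ((0 : L2), φ k)) = LinearMap.inr ℂ L2 L2 '' Set.range φ := by
    rw [← Set.range_comp]; rfl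
  rw [pker_ppow_two_JL, Submodule.span_union, e1, e2, Submodule.span_image, Submodule.span_image,
    h.span_eq]
  ext ⟨u, v⟩
  rw [Submodule.mem_sup]
  constructor
  · rintro ⟨hu, hv⟩
    exact ⟨(u, 0), ⟨u, hu, rfl⟩, (0, v), ⟨v, hv, rfl⟩, by simp⟩
  · rintro ⟨_, ⟨a, ha, rfl⟩, _, ⟨b, hb, rfl⟩, hab⟩
    have h1 := congrArg Prod.fst hab
    have h2 := congrArg Prod.snd hab
    simp at h1 h2
    rw [← h1, ← h2]
    exact ⟨ha, hb⟩

/-! ### `|∇|` on Schwartz functions -/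

/-- Multiplication of a Schwartz function by the coordinate. -/
noncomputable def mulX (ψ : 𝓢(ℝ, ℂ)) : 𝓢(ℝ, ℂ) :=
  SchwartzMap.smulLeftCLM ℂ (fun x : ℝ => (x : ℂ)) ψ

lemma mulX_apply (ψ : 𝓢(ℝ, ℂ)) (x : ℝ) : mulX ψ x = x * ψ x := by
  rw [mulX, SchwartzMap.smulLeftCLM_apply_apply (by fun_prop), smul_eq_mul]

lemma norm_cexp_mul_I (x ξ : ℝ) : ‖cexp (2 * Real.pi * I * x * ξ)‖ = 1 := by
  rw [show (2 * Real.pi * I * x * ξ : ℂ) = ((2 * Real.pi * x * ξ : ℝ) : ℂ) * I by push_cast; ring,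
    Complex.norm_exp_ofReal_mul_I]

lemma integrable_cexp_mul {G : ℝ → ℂ} (hG : Integrable G) (x : ℝ) :
    Integrable fun ξ : ℝ => cexp (2 * Real.pi * I * x * ξ) * G ξ := by
  refine hG.norm.mono' ((Continuous.aestronglyMeasurable (by fun_prop)).mul
    hG.aestronglyMeasurable) (Eventually.of_forall fun ξ => ?_)
  rw [norm_mul, norm_cexp_mul_I, one_mul]

lemma norm_setIntegral_cexp_mul_le {G : ℝ → ℂ} (hG : Integrable G) (x : ℝ) (s : Set ℝ) :
    ‖∫ ξ in s, cexp (2 * Real.pi * I * x * ξ) * G ξ‖ ≤ ∫ ξ, ‖G ξ‖ := by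
  refine (norm_integral_le_integral_norm _).trans ?_
  simp only [norm_mul, norm_cexp_mul_I, one_mul]
  exact setIntegral_le_integral hG.norm (Eventually.of_forall fun ξ => norm_nonneg _)

lemma setIntegral_cexp_mul_parts (F : 𝓢(ℝ, ℂ)) (x : ℝ) :
    2 * Real.pi * I * x * (∫ ξ in Set.Ioi (0 : ℝ), cexp (2 * Real.pi * I * x * ξ) * F ξ) +
      ∫ ξ in Set.Ioi (0 : ℝ), cexp (2 * Real.pi * I * x * ξ) * SchwartzMap.derivCLM ℂ ℂ F ξ =
    -F 0 := by
  have i1 := (integrable_cexp_mul F.integrable x).integrableOn (s := Set.Ioi 0)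
  have i2 := (integrable_cexp_mul (SchwartzMap.derivCLM ℂ ℂ F).integrable x).integrableOn
    (s := Set.Ioi 0)
  have hd : ∀ ξ : ℝ, HasDerivAt (fun ξ : ℝ => cexp (2 * Real.pi * I * x * ξ) * F ξ)
      (2 * Real.pi * I * x * (cexp (2 * Real.pi * I * x * ξ) * F ξ) +
        cexp (2 * Real.pi * I * x * ξ) * SchwartzMap.derivCLM ℂ ℂ F ξ) ξ := by
    intro ξ
    have h1 : HasDerivAt (fun y : ℝ => (y : ℂ)) 1 ξ := Complex.ofRealCLM.hasDerivAt
    have h2 := (h1.const_mul (2 * Real.pi * I * x)).cexp.mul (F.hasDerivAt ξ)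
    rw [SchwartzMap.derivCLM_apply]
    convert! h2 using 1
    ring
  have hl : Tendsto (fun ξ : ℝ => cexp (2 * Real.pi * I * x * ξ) * F ξ) atTop (𝓝 0) := by
    rw [tendsto_zero_iff_norm_tendsto_zero]
    simp only [norm_mul, norm_cexp_mul_I, one_mul]
    have := F.tendsto_cocompact.norm
    rw [norm_zero] at this
    exact this.mono_left atTop_le_cocompact
  have h := integral_Ioi_of_hasDerivAt_of_tendsto' (a := 0) (fun t _ => hd t)
      ((i1.const_mul _).add i2) hl
  rw [integral_add (i1.const_mul _) i2, integral_const_mul] at h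
  rw [h]
  simp

/-- Two integrations by parts; F 0 = 0 removes the boundary term of order 1/x. Applied to ξ times a
Fourier transform on each half-line, it shows that the kink of |ξ| costs no more than decay 1/x². -/
lemma exists_bound_setIntegral_cexp_mul (F : 𝓢(ℝ, ℂ)) (hF : F 0 = 0) : ∃ C : ℝ, ∀ x : ℝ,
    (1 + x ^ 2) * ‖∫ ξ in Set.Ioi (0 : ℝ), cexp (2 * Real.pi * I * x * ξ) * F ξ‖ ≤ C := by
  set F' := SchwartzMap.derivCLM ℂ ℂ F with hF'
  set F'' := SchwartzMap.derivCLM ℂ ℂ F' with hF''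
  refine ⟨(∫ ξ, ‖F ξ‖) + (‖F' 0‖ + ∫ ξ, ‖F'' ξ‖), fun x => ?_⟩
  have h1 := setIntegral_cexp_mul_parts F x
  have h2 := setIntegral_cexp_mul_parts F' x
  rw [← hF', hF, neg_zero] at h1
  rw [← hF''] at h2
  have b0 := norm_setIntegral_cexp_mul_le F.integrable x (Set.Ioi 0)
  have b2 := norm_setIntegral_cexp_mul_le F''.integrable x (Set.Ioi 0)
  set J := ∫ ξ in Set.Ioi (0 : ℝ), cexp (2 * Real.pi * I * x * ξ) * F ξ
  set J' := ∫ ξ in Set.Ioi (0 : ℝ), cexp (2 * Real.pi * I * x * ξ) * F' ξ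
  set J'' := ∫ ξ in Set.Ioi (0 : ℝ), cexp (2 * Real.pi * I * x * ξ) * F'' ξ
  have h3 : (((2 * Real.pi * x) ^ 2 : ℝ) : ℂ) * J = -(F' 0 + J'') := by
    push_cast
    linear_combination (-(2 * Real.pi * I * x)) * h1 + h2 + (2 * Real.pi * x) ^ 2 * J * Complex.I_sq
  have h4 : (2 * Real.pi * x) ^ 2 * ‖J‖ ≤ ‖F' 0‖ + ∫ ξ, ‖F'' ξ‖ := by
    calc (2 * Real.pi * x) ^ 2 * ‖J‖ = ‖(((2 * Real.pi * x) ^ 2 : ℝ) : ℂ) * J‖ := by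
          rw [norm_mul, Complex.norm_real, Real.norm_of_nonneg (by positivity)]
      _ = ‖F' 0 + J''‖ := by rw [h3, norm_neg]
      _ ≤ _ := (norm_add_le _ _).trans (by gcongr)
  have h5 : x ^ 2 * ‖J‖ ≤ (2 * Real.pi * x) ^ 2 * ‖J‖ := by
    refine mul_le_mul_of_nonneg_right ?_ (norm_nonneg _)
    rw [mul_pow]
    refine le_mul_of_one_le_left (sq_nonneg x) ?_
    nlinarith [Real.pi_gt_three]
  linarith

lemma integrable_absSymbol_mul (ψ : 𝓢(ℝ, ℂ)) :
    Integrable fun ξ => absSymbol ξ * 𝓕 (ψ : ℝ → ℂ) ξ := by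
  refine ((mulX (𝓕 ψ)).integrable.norm.const_mul (2 * Real.pi)).mono'
    (continuous_absSymbol.aestronglyMeasurable.mul
      (𝓕 ψ : 𝓢(ℝ, ℂ)).continuous.aestronglyMeasurable) (Eventually.of_forall fun ξ => ?_)
  rw [mulX_apply, norm_mul, norm_mul, absSymbol, Complex.norm_real, Complex.norm_real,
    Real.norm_of_nonneg (by positivity), Real.norm_eq_abs, SchwartzMap.fourier_coe, mul_assoc]

lemma absGradS_eq (ψ : 𝓢(ℝ, ℂ)) (x : ℝ) : absGradS ψ x = 2 * Real.pi *
    ((∫ ξ in Set.Ioi (0 : ℝ), cexp (2 * Real.pi * I * x * ξ) * mulX (𝓕 ψ) ξ) +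
      ∫ ξ in Set.Ioi (0 : ℝ), cexp (2 * Real.pi * I * (-x : ℝ) * ξ) * mulX (𝓕⁻ ψ) ξ) := by
  have hi : Integrable fun ξ : ℝ => cexp (2 * Real.pi * I * x * ξ) *
      (absSymbol ξ * 𝓕 (ψ : ℝ → ℂ) ξ) := integrable_cexp_mul (integrable_absSymbol_mul ψ) x
  have h0 : absGradS ψ x = ∫ ξ : ℝ, cexp (2 * Real.pi * I * x * ξ) *
      (absSymbol ξ * 𝓕 (ψ : ℝ → ℂ) ξ) := by
    rw [absGradS, Real.fourierInv_eq']
    congr 1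
    funext ξ
    rw [smul_eq_mul]
    congr 2
    simp only [RCLike.inner_apply, conj_trivial]
    push_cast
    ring
  rw [h0, ← intervalIntegral.integral_Iic_add_Ioi (b := 0) hi.integrableOn hi.integrableOn, add_comm,
    mul_add, ← integral_const_mul, ← integral_const_mul]
  congr 1
  · refine setIntegral_congr_fun measurableSet_Ioi fun ξ hξ => ?_
    simp only [mulX_apply, absSymbol, abs_of_pos (Set.mem_Ioi.1 hξ), SchwartzMap.fourier_coe]
    push_cast
    ring
  · have hn := integral_comp_neg_Ioi 0 fun ξ : ℝ => cexp (2 * Real.pi * I * x * ξ) *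
      (absSymbol ξ * 𝓕 (ψ : ℝ → ℂ) ξ)
    rw [neg_zero] at hn
    rw [← hn]
    refine setIntegral_congr_fun measurableSet_Ioi fun ξ hξ => ?_
    simp only [mulX_apply, absSymbol, abs_neg, abs_of_pos (Set.mem_Ioi.1 hξ),
      SchwartzMap.fourierInv_coe, Real.fourierInv_eq_fourier_neg]
    push_cast
    rw [show (2 * Real.pi * I * x * -ξ : ℂ) = 2 * Real.pi * I * -x * ξ by ring]
    ring

lemma memLp_absSymbol_mul_fourier (ψ : 𝓢(ℝ, ℂ)) :
    MemLp (fun ξ => absSymbol ξ * 𝓕 (ψ : ℝ → ℂ) ξ) 2 volume := by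
  refine ((mulX (𝓕 ψ)).memLp 2).of_le_mul (c := 2 * Real.pi)
    (continuous_absSymbol.aestronglyMeasurable.mul
      (𝓕 ψ : 𝓢(ℝ, ℂ)).continuous.aestronglyMeasurable) (Eventually.of_forall fun ξ => ?_)
  rw [mulX_apply, norm_mul, norm_mul, absSymbol, Complex.norm_real, Complex.norm_real,
    Real.norm_of_nonneg (by positivity), Real.norm_eq_abs, SchwartzMap.fourier_coe, mul_assoc]

lemma hasAbsGrad_absGradS (ψ : 𝓢(ℝ, ℂ)) : HasAbsGrad ψ (absGradS ψ) := by
  have h := HasAbsGrad.of_fourierInv (𝓕 ψ : 𝓢(ℝ, ℂ)).integrable ((𝓕 ψ : 𝓢(ℝ, ℂ)).memLp 2)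
    (integrable_absSymbol_mul ψ) (memLp_absSymbol_mul_fourier ψ) (fun ξ => rfl)
  rwa [← SchwartzMap.fourierInv_coe, FourierTransform.fourierInv_fourier_eq] at h

lemma continuous_absGradS (ψ : 𝓢(ℝ, ℂ)) : Continuous (absGradS ψ) :=
  continuous_fourierInv (integrable_absSymbol_mul ψ)

lemma exists_norm_absGradS_le (ψ : 𝓢(ℝ, ℂ)) : ∃ C, ∀ x, ‖absGradS ψ x‖ ≤ C * wt x := by
  obtain ⟨C₁, h₁⟩ := exists_bound_setIntegral_cexp_mul (mulX (𝓕 ψ)) (by simp [mulX_apply])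
  obtain ⟨C₂, h₂⟩ := exists_bound_setIntegral_cexp_mul (mulX (𝓕⁻ ψ)) (by simp [mulX_apply])
  refine ⟨Real.pi * (C₁ + C₂), fun x => ?_⟩
  have e₁ := h₁ x
  have e₂ := h₂ (-x)
  rw [neg_sq] at e₂
  have hx : 0 < 1 + x ^ 2 := by positivity
  rw [wt_eq_inv, ← div_eq_mul_inv, ← mul_div_assoc, le_div_iff₀ hx, absGradS_eq, norm_mul,
    norm_mul, Complex.norm_real, Real.norm_of_nonneg Real.pi_pos.le, Complex.norm_ofNat]
  refine (mul_le_mul_of_nonneg_right (mul_le_mul_of_nonneg_left (norm_add_le _ _)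
    (by positivity)) hx.le).trans ?_
  nlinarith [Real.pi_pos]

lemma aestronglyMeasurable_of_integrable_mul_wt {u : ℝ → ℂ}
    (hu : Integrable (fun y => u y * wt y)) : AEStronglyMeasurable u volume := by
  have h := hu.aestronglyMeasurable.mul (Complex.continuous_ofReal.comp
    (continuous_wt.inv₀ fun x => (wt_pos x).ne')).aestronglyMeasurable
  refine h.congr (Eventually.of_forall fun x => ?_)
  have : (wt x : ℂ) ≠ 0 := by exact_mod_cast (wt_pos x).ne'
  simp [this]

lemma integrable_mul_absGradS {u : ℝ → ℂ} (hu : Integrable (fun y => u y * wt y)) (ψ : 𝓢(ℝ, ℂ)) :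
    Integrable fun x => u x * absGradS ψ x := by
  obtain ⟨C, hC⟩ := exists_norm_absGradS_le ψ
  refine (hu.norm.const_mul C).mono' ((aestronglyMeasurable_of_integrable_mul_wt hu).mul (continuous_absGradS ψ).aestronglyMeasurable)
    (Eventually.of_forall fun x => ?_)
  rw [norm_mul, norm_mul, Complex.norm_real, Real.norm_of_nonneg (wt_pos x).le]
  calc ‖u x‖ * ‖absGradS ψ x‖ ≤ ‖u x‖ * (C * wt x) := by gcongr; exact hC x
    _ = _ := by ring

lemma integrable_absGradS (ψ : 𝓢(ℝ, ℂ)) : Integrable (absGradS ψ) := by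
  have := integrable_mul_absGradS (u := fun _ => 1) (by simpa using integrable_cay_zpow_mul_wt 0) ψ
  simpa using this

/-- Fourier inversion at frequency zero, where the symbol vanishes: constants are annihilated by |∇|
in the distributional sense. -/
lemma integral_absGradS (ψ : 𝓢(ℝ, ℂ)) : ∫ x, absGradS ψ x = 0 := by
  set G : ℝ → ℂ := fun ξ => absSymbol ξ * 𝓕 (ψ : ℝ → ℂ) ξ with hG
  have hc : Continuous G := continuous_absSymbol.mul (𝓕 ψ : 𝓢(ℝ, ℂ)).continuous
  have h2 : Integrable (𝓕 G) := by
    refine (integrable_absGradS ψ).comp_neg.congr (Eventually.of_forall fun x => ?_)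
    simp only [absGradS, Real.fourierInv_eq_fourier_neg, neg_neg]
    rfl
  have h3 := congrFun (hc.fourier_fourierInv_eq (integrable_absSymbol_mul ψ) h2) 0
  rw [Real.fourier_eq'] at h3
  have h4 : G 0 = 0 := by simp [hG, absSymbol]
  rw [h4] at h3
  refine Eq.trans (integral_congr_ae (Eventually.of_forall fun x => ?_)) h3
  simp [absGradS, hG]

lemma HasAbsGrad.integral_symm {f g f' g' : ℝ → ℂ} (h : HasAbsGrad f g) (h' : HasAbsGrad f' g') :
    ∫ x, (starRingEnd ℂ) (g x) * f' x = ∫ x, (starRingEnd ℂ) (f x) * g' x := by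
  obtain ⟨hf, hg, h⟩ := h
  obtain ⟨hf', hg', h'⟩ := h'
  have := absGrad_symm ⟨_, h.mem_H1⟩ ⟨_, h'.mem_H1⟩
  rw [h.absGrad_eq, h'.absGrad_eq] at this
  rwa [inner_toLp, inner_toLp] at this

lemma integral_cay_zpow_mul_absGradS (k : ℤ) (ψ : 𝓢(ℝ, ℂ)) :
    ∫ x, cay x ^ k * absGradS ψ x = (k.natAbs : ℂ) * ∫ x, wt x * cay x ^ k * ψ x := by
  -- The inner product is conjugate linear on the left, so the frequency -k is used and the identity
  -- conjugated. The constant in `cay ^ k - 1` then drops out by `integral_absGradS`.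
  have h := congrArg (starRingEnd ℂ)
    ((hasAbsGrad_absGradS ψ).integral_symm (hasAbsGrad_cay_zpow (-k)))
  rw [← integral_conj, ← integral_conj] at h
  have hk : Integrable fun x => cay x ^ k * absGradS ψ x := by
    refine integrable_mul_absGradS ?_ ψ
    simpa only [mul_comm] using integrable_cay_zpow_mul_wt k
  have e1 : ∀ x, (starRingEnd ℂ) ((starRingEnd ℂ) (absGradS ψ x) * (cay x ^ (-k) - 1)) =
      cay x ^ k * absGradS ψ x - absGradS ψ x := by
    intro x
    simp only [map_mul, Complex.conj_conj, map_sub, map_one, conj_cay_zpow, neg_neg]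
    ring
  have e2 : ∀ x, (starRingEnd ℂ) ((starRingEnd ℂ) (ψ x) *
      (((-k).natAbs : ℂ) * (wt x * cay x ^ (-k)))) = (k.natAbs : ℂ) * (wt x * cay x ^ k * ψ x) := by
    intro x
    simp only [map_mul, Complex.conj_conj, conj_cay_zpow, neg_neg, Complex.conj_ofReal, map_natCast,
      Int.natAbs_neg]
    ring
  simp only [e1, e2] at h
  rwa [integral_sub hk (integrable_absGradS ψ), integral_absGradS, sub_zero, integral_const_mul] at h

/-! ### The resonance functions -/

lemma integrable_mul_wt_iff {u : ℝ → ℂ} : Integrable (fun y => u y * wt y) ↔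
    Integrable (fun x : ℝ => u x / (1 + (x : ℂ) ^ 2)) := by
  have h : (fun y => u y * wt y) = fun x : ℝ => (2 : ℂ) * (u x / (1 + (x : ℂ) ^ 2)) := by
    funext x
    rw [wt]
    push_cast
    ring
  rw [h, integrable_const_mul_iff (IsUnit.mk0 _ two_ne_zero)]

/-- The sum a + b is the value at infinity, the real or imaginary part of i^m; the choice by parity
of m picks the one that is nonzero. -/
lemma exists_resonance_eq (m : ℕ) : ∃ a b : ℂ, a + b ≠ 0 ∧
    ∀ x, resonance m x = a * cay x ^ (m : ℤ) + b * cay x ^ (-(m : ℤ)) := by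
  have hI : (I : ℂ) ^ m ≠ 0 := pow_ne_zero _ Complex.I_ne_zero
  have hc : ∀ x, (starRingEnd ℂ) (Qc m x) = (-I) ^ m * cay x ^ (-(m : ℤ)) := by
    intro x
    rw [Qc_eq, map_mul, conj_cay_zpow, map_pow, Complex.conj_I]
  by_cases hm : Odd m
  · refine ⟨I ^ m / (2 * I), -(-I) ^ m / (2 * I), ?_, fun x => ?_⟩
    · rw [hm.neg_pow, neg_neg, ← add_div, ← two_mul, mul_div_mul_left _ _ two_ne_zero]
      exact div_ne_zero hI Complex.I_ne_zero
    · rw [resonance, if_pos hm, gk, Complex.im_eq_sub_conj, hc, Qc_eq]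
      ring
  · refine ⟨I ^ m / 2, (-I) ^ m / 2, ?_, fun x => ?_⟩
    · rw [(Nat.not_odd_iff_even.1 hm).neg_pow, add_halves]
      exact hI
    · rw [resonance, if_neg hm, fk, Complex.re_eq_add_conj, hc, Qc_eq]
      ring

lemma continuous_resonance (m : ℕ) : Continuous (resonance m) := by
  obtain ⟨a, b, -, h⟩ := exists_resonance_eq m
  rw [funext h]
  exact (continuous_const.mul (continuous_cay_zpow _)).add
    (continuous_const.mul (continuous_cay_zpow _))

lemma integrable_resonance_mul_wt (m : ℕ) : Integrable (fun y => resonance m y * wt y) := by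
  obtain ⟨a, b, -, h⟩ := exists_resonance_eq m
  refine (((integrable_cay_zpow_mul_wt m).const_mul a).add
    ((integrable_cay_zpow_mul_wt (-m)).const_mul b)).congr (Eventually.of_forall fun x => ?_)
  simp only [Pi.add_apply, h]
  ring

lemma norm_resonance_sub_le (m : ℕ) (x y : ℝ) :
    ‖resonance m x - resonance m y‖ ≤ ‖Q m x - Q m y‖ := by
  refine le_of_sq_le_sq ?_ (norm_nonneg _)
  rw [norm_Q_sub_sq]
  refine pow_le_pow_left₀ (norm_nonneg _) ?_ 2
  unfold resonance
  split_ifs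
  · rw [← Complex.ofReal_sub, Complex.norm_real, gk, gk, ← Complex.sub_im]
    exact Complex.abs_im_le_norm _
  · rw [← Complex.ofReal_sub, Complex.norm_real, fk, fk, ← Complex.sub_re]
    exact Complex.abs_re_le_norm _

/-- The Gagliardo integrand is dominated by that of Q, which is 2π times the kernel of R and hence
bounded by a product of integrable weights. -/
lemma memHHalf_resonance (m : ℕ) : MemHHalf (resonance m) := by
  refine ⟨integrable_mul_wt_iff.1 (integrable_resonance_mul_wt m), ?_⟩
  have hi : Integrable (fun x : ℝ => (1 + x ^ 2)⁻¹) := integrable_inv_one_add_sq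
  refine ((hi.mul_prod hi).const_mul (2 * Real.pi * (4 * m ^ 2))).mono' ?_
    (Eventually.of_forall fun p => ?_)
  · have hc := (continuous_resonance m).measurable
    have h1 : Measurable fun p : ℝ × ℝ => ‖resonance m p.1 - resonance m p.2‖ ^ 2 :=
      (((hc.comp measurable_fst).sub (hc.comp measurable_snd)).norm).pow_const 2
    have h2 : Measurable fun p : ℝ × ℝ => |p.1 - p.2| ^ 2 :=
      ((measurable_fst.sub measurable_snd).norm).pow_const 2
    exact (h1.div h2).aestronglyMeasurable
  · rw [Real.norm_of_nonneg (by positivity)]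
    have h1 : ‖resonance m p.1 - resonance m p.2‖ ^ 2 / |p.1 - p.2| ^ 2 ≤
        ‖Q m p.1 - Q m p.2‖ ^ 2 / |p.1 - p.2| ^ 2 := by
      gcongr
      exact norm_resonance_sub_le m _ _
    have h2 : ‖Q m p.1 - Q m p.2‖ ^ 2 / |p.1 - p.2| ^ 2 = 2 * Real.pi * kerR m p.1 p.2 := by
      have := Real.pi_ne_zero
      rw [kerR]
      field_simp
    rw [h2] at h1
    refine h1.trans ?_
    rw [mul_assoc (2 * Real.pi)]
    exact mul_le_mul_of_nonneg_left (kerR_le m _ _) (by positivity)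

lemma memLp_resonance_sub {m : ℕ} {a b : ℂ}
    (h : ∀ x, resonance m x = a * cay x ^ (m : ℤ) + b * cay x ^ (-(m : ℤ))) :
    MemLp (fun x => resonance m x - (a + b)) 2 volume := by
  refine (memLp_congr_ae (Eventually.of_forall fun x => ?_)).1
    (((memLp_cay_sub_one m).const_mul a).add ((memLp_cay_sub_one (-m)).const_mul b))
  simp only [Pi.add_apply, h]
  ring

/-- Its difference from its value at infinity is square integrable, and a nonzero constant is not.
-/
lemma not_memLp_resonance (m : ℕ) : ¬ MemLp (resonance m) 2 volume := by
  obtain ⟨a, b, hab, h⟩ := exists_resonance_eq m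
  intro hm
  have h1 : MemLp (fun _ : ℝ => a + b) 2 volume := by
    refine (memLp_congr_ae (Eventually.of_forall fun x => ?_)).1 (hm.sub (memLp_resonance_sub h))
    simp
  rw [memLp_const_iff (by norm_num) (by norm_num)] at h1
  simp [hab] at h1

/-- R detects only frequencies of modulus less than m, and the resonance has only ±m. So the two
zero-energy equations coincide for it. -/
lemma RFun_resonance (m : ℕ) (x : ℝ) : RFun m (resonance m) x = 0 := by
  obtain ⟨a, b, -, h⟩ := exists_resonance_eq m
  rw [RFun_eq m (integrable_resonance_mul_wt m)]
  refine Finset.sum_eq_zero fun j hj => Finset.sum_eq_zero fun l hl => ?_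
  have hj' := Finset.mem_range.1 hj
  have hl' := Finset.mem_range.1 hl
  have e : ∀ y, resonance m y * (wt y * cay y ^ (-((j : ℤ) - l))) =
      a * (wt y * cay y ^ ((m : ℤ) - (j - l))) + b * (wt y * cay y ^ (-(m : ℤ) - (j - l))) := by
    intro y
    rw [h, sub_eq_add_neg (m : ℤ), sub_eq_add_neg (-(m : ℤ)), zpow_add₀ (cay_ne_zero y),
      zpow_add₀ (cay_ne_zero y)]
    ring
  have hz : moment (resonance m) ((j : ℤ) - l) = 0 := by
    rw [moment]
    simp only [e]
    rw [integral_add ((integrable_cay_zpow_mul_wt _).const_mul _)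
      ((integrable_cay_zpow_mul_wt _).const_mul _), integral_const_mul, integral_const_mul,
      integral_wt_mul_cay_zpow, integral_wt_mul_cay_zpow, if_neg (by omega), if_neg (by omega)]
    simp
  rw [hz]
  simp

lemma LPlusDist_resonance (m : ℕ) (ψ : 𝓢(ℝ, ℂ)) : LPlusDist m (resonance m) ψ = 0 := by
  obtain ⟨a, b, -, h⟩ := exists_resonance_eq m
  have i1 : ∀ k : ℤ, Integrable fun x => cay x ^ k * absGradS ψ x := fun k =>
    integrable_mul_absGradS (by simpa only [mul_comm] using integrable_cay_zpow_mul_wt k) ψ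
  have i2 : ∀ k : ℤ, Integrable fun x => wt x * cay x ^ k * ψ x := by
    intro k
    refine (ψ.integrable.norm.const_mul 2).mono' ((((Complex.continuous_ofReal.comp
      continuous_wt).mul (continuous_cay_zpow k)).mul ψ.continuous).aestronglyMeasurable)
      (Eventually.of_forall fun x => ?_)
    rw [norm_mul, norm_mul, norm_cay_zpow, mul_one, Complex.norm_real,
      Real.norm_of_nonneg (wt_pos x).le]
    exact mul_le_mul_of_nonneg_right (wt_le x) (norm_nonneg _)
  have e1 : ∀ x, resonance m x * absGradS ψ x =
      a * (cay x ^ (m : ℤ) * absGradS ψ x) + b * (cay x ^ (-(m : ℤ)) * absGradS ψ x) := fun x => by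
    rw [h]; ring
  have e2 : ∀ x, (V m x : ℂ) * resonance m x * ψ x = a * m * (wt x * cay x ^ (m : ℤ) * ψ x) +
      b * m * (wt x * cay x ^ (-(m : ℤ)) * ψ x) := fun x => by
    rw [h, V_eq_cast]; ring
  rw [LPlusDist]
  simp only [e1, e2]
  rw [integral_add ((i1 _).const_mul _) ((i1 _).const_mul _),
    integral_add ((i2 _).const_mul _) ((i2 _).const_mul _)]
  simp only [integral_const_mul, integral_cay_zpow_mul_absGradS, Int.natAbs_neg, Int.natAbs_natCast]
  ring

lemma LMinusDist_resonance (m : ℕ) (ψ : 𝓢(ℝ, ℂ)) : LMinusDist m (resonance m) ψ = 0 := by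
  have h := LPlusDist_resonance m ψ
  rw [LPlusDist] at h
  simp [LMinusDist, RFun_resonance, h]

lemma memHHalf_zero : MemHHalf 0 := by
  constructor <;> simp

lemma LPlusDist_zero (m : ℕ) (ψ : 𝓢(ℝ, ℂ)) : LPlusDist m 0 ψ = 0 := by simp [LPlusDist]

lemma LMinusDist_zero (m : ℕ) (ψ : 𝓢(ℝ, ℂ)) : LMinusDist m 0 ψ = 0 := by
  simp [LMinusDist, RFun]

lemma isResonance_left (m : ℕ) : IsResonance m (resonance m, 0) :=
  ⟨⟨memHHalf_resonance m, memHHalf_zero, fun ψ => by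
    simp [LPlusDist_resonance, LMinusDist_zero]⟩, fun h => not_memLp_resonance m h.1⟩

lemma isResonance_right (m : ℕ) : IsResonance m (0, resonance m) :=
  ⟨⟨memHHalf_zero, memHHalf_resonance m, fun ψ => by
    simp [LMinusDist_resonance, LPlusDist_zero]⟩, fun h => not_memLp_resonance m h.2⟩

lemma linearIndependent_resonance (m : ℕ) : LinearIndependent ℂ
    ![(resonance m, (0 : ℝ → ℂ)), ((0 : ℝ → ℂ), resonance m)] := by
  have h0 : resonance m ≠ 0 := fun h => not_memLp_resonance m (h ▸ MemLp.zero)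
  rw [LinearIndependent.pair_iff]
  intro s t hst
  have h1 := congrArg Prod.fst hst
  have h2 := congrArg Prod.snd hst
  simp at h1 h2
  exact ⟨h1.resolve_right h0, h2.resolve_right h0⟩

/-! ### Schwartz functions with Fourier transform supported on a half-line -/

/-- The Fourier transform of `ψ` vanishes on the negative half-line. -/
def IsHardy (ψ : 𝓢(ℝ, ℂ)) : Prop := ∀ ξ < 0, 𝓕 (ψ : ℝ → ℂ) ξ = 0

lemma IsHardy.add {φ ψ : 𝓢(ℝ, ℂ)} (hφ : IsHardy φ) (hψ : IsHardy ψ) : IsHardy (φ + ψ) := by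
  intro ξ hξ
  rw [← SchwartzMap.fourier_coe, FourierTransform.fourier_add, add_apply,
    SchwartzMap.fourier_coe, SchwartzMap.fourier_coe, hφ ξ hξ, hψ ξ hξ, add_zero]

lemma IsHardy.smul {ψ : 𝓢(ℝ, ℂ)} (c : ℂ) (hψ : IsHardy ψ) : IsHardy (c • ψ) := by
  intro ξ hξ
  rw [← SchwartzMap.fourier_coe, FourierTransform.fourier_smul, smul_apply,
    SchwartzMap.fourier_coe, hψ ξ hξ, smul_zero]

/-- On nonnegative frequencies |ξ| = ξ, so |∇| becomes a local operator whose values can be computed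
by the product rule. -/
lemma IsHardy.absGradS_eq {ψ : 𝓢(ℝ, ℂ)} (hψ : IsHardy ψ) (x : ℝ) :
    absGradS ψ x = -I * deriv ψ x := by
  have h1 := Real.fourier_deriv ψ.integrable ψ.differentiable
    (SchwartzMap.derivCLM ℂ ℂ ψ).integrable
  have h2 : (fun ξ : ℝ => absSymbol ξ * 𝓕 (ψ : ℝ → ℂ) ξ) = fun ξ => -I * 𝓕 (deriv ψ) ξ := by
    funext ξ
    rw [h1, absSymbol]
    simp only [smul_eq_mul]
    rcases lt_or_ge ξ 0 with h | h
    · rw [hψ ξ h]; ring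
    · rw [abs_of_nonneg h]
      push_cast
      linear_combination (2 * Real.pi * ξ * 𝓕 (ψ : ℝ → ℂ) ξ) * Complex.I_sq
  rw [absGradS, h2, fourierInv_const_mul]
  congr 1
  have h3 : 𝓕⁻ (𝓕 (SchwartzMap.derivCLM ℂ ℂ ψ : ℝ → ℂ)) x = SchwartzMap.derivCLM ℂ ℂ ψ x := by
    rw [← SchwartzMap.fourier_coe, ← SchwartzMap.fourierInv_coe,
      FourierTransform.fourierInv_fourier_eq]
  exact h3

lemma hasTemperateGrowth_pole : pole.HasTemperateGrowth := by
  have h : pole = fun x : ℝ => (I * (x - I)) * (((1 + ‖x‖ ^ 2) ^ (-1 : ℝ) : ℝ) : ℂ) := by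
    funext x
    have h1 := xaddI_ne x
    have h2 := xsubI_ne x
    rw [Real.rpow_neg_one, Real.norm_eq_abs, sq_abs, pole]
    push_cast
    rw [← xsubI_mul_xaddI]
    field_simp
  rw [h]
  fun_prop

/-- With g the product, (x + i) g = i ψ becomes on negative frequencies the equation ĝ' = -2π ĝ. So
e^{2πξ} ĝ is constant there, and it tends to 0 at -∞. -/
lemma IsHardy.pole_mul {ψ : 𝓢(ℝ, ℂ)} (hψ : IsHardy ψ) :
    IsHardy (SchwartzMap.smulLeftCLM ℂ pole ψ) := by
  set g := SchwartzMap.smulLeftCLM ℂ pole ψ with hg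
  have hgx : ∀ x, g x = pole x * ψ x := fun x => by
    rw [hg, SchwartzMap.smulLeftCLM_apply_apply hasTemperateGrowth_pole, smul_eq_mul]
  have h1 : mulX g + I • g = I • ψ := by
    ext x
    simp only [add_apply, smul_apply, mulX_apply, hgx, smul_eq_mul, pole]
    have := xaddI_ne x
    field_simp
  have h2 : ∀ ξ < 0, 𝓕 (mulX g : ℝ → ℂ) ξ = -I * 𝓕 (g : ℝ → ℂ) ξ := by
    intro ξ hξ
    have h3 := hψ.smul I ξ hξ
    rw [← h1, ← SchwartzMap.fourier_coe, FourierTransform.fourier_add,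
      FourierTransform.fourier_smul, add_apply, smul_apply,
      SchwartzMap.fourier_coe, SchwartzMap.fourier_coe, smul_eq_mul] at h3
    linear_combination h3
  have hd : ∀ ξ < 0, HasDerivAt (𝓕 (g : ℝ → ℂ)) (-(2 * Real.pi) * 𝓕 (g : ℝ → ℂ) ξ) ξ := by
    intro ξ hξ
    have hx : Integrable fun x : ℝ => x • g x := by
      refine (mulX g).integrable.congr (Eventually.of_forall fun x => ?_)
      simp only [mulX_apply, Complex.real_smul]
    have h3 := Real.hasDerivAt_fourier g.integrable hx ξ
    have h4 : (fun x : ℝ => (-2 * Real.pi * I * x : ℂ) • g x) =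
        ((-2 * Real.pi * I : ℂ) • mulX g : 𝓢(ℝ, ℂ)) := by
      funext x
      rw [smul_apply, mulX_apply, smul_eq_mul, smul_eq_mul]
      ring
    rw [h4, ← SchwartzMap.fourier_coe (_ • mulX g), FourierTransform.fourier_smul, smul_apply,
      SchwartzMap.fourier_coe, h2 ξ hξ] at h3
    convert! h3 using 1
    rw [smul_eq_mul]
    linear_combination (-2 * Real.pi * 𝓕 (g : ℝ → ℂ) ξ) * Complex.I_sq
  intro ξ hξ
  have hd2 : ∀ t ∈ Set.Iic ξ, HasDerivAt (fun t : ℝ => cexp (2 * Real.pi * t) * 𝓕 (g : ℝ → ℂ) t)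
      0 t := by
    intro t ht
    have e1 : HasDerivAt (fun y : ℝ => (y : ℂ)) 1 t := Complex.ofRealCLM.hasDerivAt
    have e2 := ((e1.const_mul (2 * Real.pi : ℂ)).cexp).mul (hd t (lt_of_le_of_lt ht hξ))
    convert! e2 using 1
    ring
  have hl : Tendsto (fun t : ℝ => cexp (2 * Real.pi * t) * 𝓕 (g : ℝ → ℂ) t) atBot (𝓝 0) := by
    have e1 : Tendsto (𝓕 (g : ℝ → ℂ)) atBot (𝓝 0) :=
      (𝓕 g : 𝓢(ℝ, ℂ)).tendsto_cocompact.mono_left atBot_le_cocompact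
    rw [tendsto_zero_iff_norm_tendsto_zero] at e1 ⊢
    refine squeeze_zero' (Eventually.of_forall fun t => norm_nonneg _) ?_ e1
    filter_upwards [eventually_le_atBot 0] with t ht
    rw [norm_mul, show (2 * Real.pi * t : ℂ) = ((2 * Real.pi * t : ℝ) : ℂ) by push_cast; ring,
      Complex.norm_exp_ofReal]
    refine mul_le_of_le_one_left (norm_nonneg _) (Real.exp_le_one_iff.2 ?_)
    exact mul_nonpos_of_nonneg_of_nonpos (by positivity) ht
  have h := integral_Iic_of_hasDerivAt_of_tendsto' hd2 (by simp) hl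
  rw [integral_zero, sub_zero] at h
  exact (mul_eq_zero.1 h.symm).resolve_left (Complex.exp_ne_zero _)

lemma IsHardy.exists_cay_pow_mul {ψ : 𝓢(ℝ, ℂ)} (hψ : IsHardy ψ) (k : ℕ) :
    ∃ φ : 𝓢(ℝ, ℂ), IsHardy φ ∧ ∀ x, φ x = cay x ^ k * ψ x := by
  induction k with
  | zero => exact ⟨ψ, hψ, fun x => by simp⟩
  | succ k ih =>
    obtain ⟨φ, hφ, h⟩ := ih
    refine ⟨φ + (-2 : ℂ) • SchwartzMap.smulLeftCLM ℂ pole φ, hφ.add (hφ.pole_mul.smul _),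
      fun x => ?_⟩
    rw [add_apply, smul_apply,
      SchwartzMap.smulLeftCLM_apply_apply hasTemperateGrowth_pole, h, cay_eq_pole, smul_eq_mul,
      smul_eq_mul]
    ring

/-! ### Schwartz approximations of `cay ^ k - 1` with control of |∇|. -/

/-- The dilation `x ↦ ψ (c x)`. -/
noncomputable def dilate (c : ℝ) (hc : c ≠ 0) (ψ : 𝓢(ℝ, ℂ)) : 𝓢(ℝ, ℂ) :=
  SchwartzMap.compCLMOfContinuousLinearEquiv ℂ
    (ContinuousLinearEquiv.unitsEquivAut ℝ (Units.mk0 c hc)) ψ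

lemma dilate_apply {c : ℝ} (hc : c ≠ 0) (ψ : 𝓢(ℝ, ℂ)) (x : ℝ) : dilate c hc ψ x = ψ (c * x) := by
  rw [mul_comm]; rfl

lemma fourier_dilate {c : ℝ} (hc : c ≠ 0) (ψ : 𝓢(ℝ, ℂ)) (ξ : ℝ) :
    𝓕 (dilate c hc ψ : ℝ → ℂ) ξ = |c⁻¹| * 𝓕 (ψ : ℝ → ℂ) (ξ / c) := by
  rw [Real.fourier_eq', Real.fourier_eq', ← Complex.real_smul]
  rw [← Measure.integral_comp_mul_left]
  congr 1
  funext x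
  rw [dilate_apply]
  congr 4
  simp only [RCLike.inner_apply, conj_trivial]
  field_simp

lemma absGradS_dilate_neg_one (ψ : 𝓢(ℝ, ℂ)) (x : ℝ) :
    absGradS (dilate (-1) (by norm_num) ψ) x = absGradS ψ (-x) := by
  rw [absGradS, absGradS, ← fourierInv_comp_neg]
  refine congrFun (congrArg _ (funext fun ξ => ?_)) x
  rw [fourier_dilate, absSymbol_neg]
  simp [div_neg]

lemma exists_isHardy_eq_one : ∃ η : 𝓢(ℝ, ℂ), IsHardy η ∧ η 0 = 1 := by
  -- A normalized bump supported in positive frequencies; its integral 1 is the value at 0 of its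
  -- inverse transform.
  let f : ContDiffBump (2 : ℝ) := ⟨1 / 2, 1, by norm_num, by norm_num⟩
  let b : 𝓢(ℝ, ℂ) := HasCompactSupport.toSchwartzMap (f := fun x => (f.normed volume x : ℂ))
    (f.hasCompactSupport_normed.comp_left (g := fun r : ℝ => (r : ℂ)) (by simp))
    (Complex.ofRealCLM.contDiff.comp f.contDiff_normed)
  have hb : ∀ x, b x = f.normed volume x := fun x => rfl
  refine ⟨𝓕⁻ b, fun ξ hξ => ?_, ?_⟩
  · rw [← SchwartzMap.fourier_coe, FourierTransform.fourier_fourierInv_eq, hb]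
    have : ξ ∉ Function.support (f.normed volume) := by
      rw [f.support_normed_eq, Metric.mem_ball, Real.dist_eq, not_lt]
      change 1 ≤ _
      rw [abs_of_neg (by linarith)]
      linarith
    rw [Function.notMem_support.1 this, Complex.ofReal_zero]
  · rw [SchwartzMap.fourierInv_coe, Real.fourierInv_eq']
    simp only [hb]
    simp [integral_complex_ofReal, f.integral_normed]

lemma IsHardy.dilate {ψ : 𝓢(ℝ, ℂ)} (hψ : IsHardy ψ) {c : ℝ} (hc : 0 < c) :
    IsHardy (dilate c hc.ne' ψ) := by
  intro ξ hξ
  rw [fourier_dilate, hψ _ (div_neg_of_neg_of_pos hξ hc), mul_zero]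

lemma norm_cay_sub_one_eq (x : ℝ) : ‖cay x - 1‖ = wt x * √(1 + x ^ 2) := by
  have h : (0 : ℝ) < 1 + x ^ 2 := by positivity
  rw [← sq_eq_sq₀ (norm_nonneg _) (mul_nonneg (wt_pos x).le (Real.sqrt_nonneg _)),
    norm_cay_sub_one_sq, mul_pow, Real.sq_sqrt h.le, wt]
  field_simp

lemma norm_cay_pow_sub_one_le (k : ℕ) (x : ℝ) : ‖cay x ^ k - 1‖ ≤ k * (wt x * √(1 + x ^ 2)) := by
  have h := norm_pow_sub_le k (norm_cay x) norm_one
  rwa [one_pow, norm_cay_sub_one_eq] at h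

lemma mul_sqrt_mul_norm_deriv_le {ψ : 𝓢(ℝ, ℂ)} {B D c : ℝ} (hB : ∀ x, ‖deriv ψ x‖ ≤ B)
    (hD : ∀ x, |x| * ‖deriv ψ x‖ ≤ D) (hc0 : 0 ≤ c) (hc1 : c ≤ 1) (x : ℝ) :
    √(1 + x ^ 2) * (c * ‖deriv ψ (c * x)‖) ≤ B + D := by
  have h1 : √(1 + x ^ 2) ≤ 1 + |x| := by
    refine Real.sqrt_le_iff.2 ⟨by positivity, ?_⟩
    nlinarith [abs_nonneg x, sq_abs x]
  have h2 := hB (c * x)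
  have h3 := hD (c * x)
  rw [abs_mul, abs_of_nonneg hc0] at h3
  have h4 : c * ‖deriv ψ (c * x)‖ ≤ ‖deriv ψ (c * x)‖ :=
    mul_le_of_le_one_left (norm_nonneg _) hc1
  calc √(1 + x ^ 2) * (c * ‖deriv ψ (c * x)‖)
      ≤ (1 + |x|) * (c * ‖deriv ψ (c * x)‖) := by gcongr
    _ = c * ‖deriv ψ (c * x)‖ + c * |x| * ‖deriv ψ (c * x)‖ := by ring
    _ ≤ B + D := by linarith

/-- The functions `(cay ^ k - 1) η(x / (n + 1))` with η a Hardy cutoff stay Hardy, so |∇| is -i d/dx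
on them. In the product rule the cutoff term is also O(wt), because `cay ^ k - 1` is O(wt √(1 + x²))
and the growing factor is absorbed by the scale-invariant bound on the derivative of η. -/
lemma exists_approx_cay_pow (k : ℕ) : ∃ (ψ : ℕ → 𝓢(ℝ, ℂ)) (C : ℝ),
    (∀ n x, ‖ψ n x‖ ≤ C) ∧ (∀ n x, ‖absGradS (ψ n) x‖ ≤ C * wt x) ∧
    (∀ x, Tendsto (fun n => ψ n x) atTop (𝓝 (cay x ^ k - 1))) ∧
    ∀ x, Tendsto (fun n => absGradS (ψ n) x) atTop (𝓝 (k * (wt x * cay x ^ k))) := by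
  obtain ⟨η, hη, hη0⟩ := exists_isHardy_eq_one
  obtain ⟨A, hA⟩ : ∃ A, ∀ x, ‖η x‖ ≤ A := ⟨_, SchwartzMap.norm_le_seminorm ℂ η⟩
  obtain ⟨B, hB⟩ : ∃ B, ∀ x, ‖deriv η x‖ ≤ B :=
    ⟨_, SchwartzMap.norm_le_seminorm ℂ (SchwartzMap.derivCLM ℂ ℂ η)⟩
  obtain ⟨D, hD⟩ : ∃ D, ∀ x, |x| * ‖deriv η x‖ ≤ D := by
    refine ⟨SchwartzMap.seminorm ℂ 1 0 (SchwartzMap.derivCLM ℂ ℂ η), fun x => ?_⟩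
    have := SchwartzMap.norm_pow_mul_le_seminorm ℂ (SchwartzMap.derivCLM ℂ ℂ η) 1 x
    rw [pow_one] at this
    exact this
  have hA0 : 0 ≤ A := (norm_nonneg _).trans (hA 0)
  have hBD : 0 ≤ B + D := add_nonneg ((norm_nonneg _).trans (hB 0))
    (le_trans (by positivity) (hD 0))
  let c : ℕ → ℝ := fun n => 1 / ((n : ℝ) + 1)
  have hc : ∀ n, 0 < c n := fun n => Nat.one_div_pos_of_nat
  have hc1 : ∀ n, c n ≤ 1 := fun n => by
    rw [div_le_one (by positivity)]
    linarith [Nat.cast_nonneg (α := ℝ) n]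
  have hcl : Tendsto c atTop (𝓝 0) := tendsto_one_div_add_atTop_nhds_zero_nat
  have hex : ∀ n, ∃ φ : 𝓢(ℝ, ℂ), IsHardy φ ∧ ∀ x, φ x = (cay x ^ k - 1) * η (c n * x) := by
    intro n
    have h1 := hη.dilate (hc n)
    obtain ⟨φ, hφ, h⟩ := h1.exists_cay_pow_mul k
    refine ⟨φ + (-1 : ℂ) • dilate (c n) (hc n).ne' η, hφ.add (h1.smul _), fun x => ?_⟩
    rw [add_apply, smul_apply, h, dilate_apply, smul_eq_mul]
    ring
  choose ψ hψ hψx using hex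
  have hder : ∀ n x, deriv (ψ n) x = I * k * (wt x * cay x ^ k) * η (c n * x) +
      (cay x ^ k - 1) * (c n * deriv η (c n * x)) := by
    intro n x
    have h1 := hasDerivAt_cay_zpow k x
    simp only [zpow_natCast, Int.cast_natCast] at h1
    have h2 : HasDerivAt (fun y => η (c n * y)) (c n • deriv η (c n * x)) x := by
      have h3 : HasDerivAt (fun y : ℝ => c n * y) (c n) x := by
        simpa using (hasDerivAt_id x).const_mul (c n)
      exact (η.hasDerivAt (c n * x)).scomp x h3
    have h4 := (h1.sub_const 1).mul h2
    rw [show (ψ n : ℝ → ℂ) = fun x => (cay x ^ k - 1) * η (c n * x) from funext (hψx n)]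
    rw [Complex.real_smul] at h4
    exact h4.deriv
  refine ⟨ψ, max (2 * A) (k * A + k * (B + D)), fun n x => ?_, fun n x => ?_, fun x => ?_,
    fun x => ?_⟩
  · refine le_trans ?_ (le_max_left _ _)
    rw [hψx, norm_mul]
    refine mul_le_mul ?_ (hA _) (norm_nonneg _) (by norm_num)
    refine (norm_sub_le _ _).trans ?_
    rw [norm_pow, norm_cay, one_pow, norm_one]
    norm_num
  · refine le_trans ?_ (mul_le_mul_of_nonneg_right (le_max_right _ _) (wt_pos x).le)
    rw [(hψ n).absGradS_eq, norm_mul, norm_neg, Complex.norm_I, one_mul, hder]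
    have h1 := mul_sqrt_mul_norm_deriv_le hB hD (hc n).le (hc1 n) x
    have h2 := norm_cay_pow_sub_one_le k x
    have h3 := hA (c n * x)
    have hw := (wt_pos x).le
    calc _ ≤ k * wt x * ‖η (c n * x)‖ + ‖cay x ^ k - 1‖ * (c n * ‖deriv η (c n * x)‖) := by
          refine (norm_add_le _ _).trans (le_of_eq ?_)
          simp only [norm_mul, Complex.norm_I, Complex.norm_natCast, Complex.norm_real, norm_pow,
            norm_cay, one_pow, Real.norm_of_nonneg hw, Real.norm_of_nonneg (hc n).le]
          ring
      _ ≤ k * wt x * A + k * (wt x * √(1 + x ^ 2)) * (c n * ‖deriv η (c n * x)‖) := by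
          have := (hc n).le
          gcongr
      _ = k * wt x * A + k * wt x * (√(1 + x ^ 2) * (c n * ‖deriv η (c n * x)‖)) := by ring
      _ ≤ k * wt x * A + k * wt x * (B + D) := by gcongr
      _ = _ := by ring
  · have h1 : Tendsto (fun n => η (c n * x)) atTop (𝓝 1) := by
      rw [← hη0]
      refine (η.continuous.tendsto 0).comp ?_
      simpa using hcl.mul_const x
    simp only [hψx]
    simpa using h1.const_mul (cay x ^ k - 1)
  · have h1 : Tendsto (fun n => η (c n * x)) atTop (𝓝 1) := by
      rw [← hη0]
      refine (η.continuous.tendsto 0).comp ?_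
      simpa using hcl.mul_const x
    have h2 : Tendsto (fun n => (c n : ℂ) * deriv η (c n * x)) atTop (𝓝 0) := by
      rw [tendsto_zero_iff_norm_tendsto_zero]
      refine squeeze_zero (fun n => norm_nonneg _) (fun n => ?_)
        (by simpa using hcl.mul_const B)
      rw [norm_mul, Complex.norm_real, Real.norm_of_nonneg (hc n).le]
      exact mul_le_mul_of_nonneg_left (hB _) (hc n).le
    simp only [(hψ _).absGradS_eq, hder]
    convert! ((h1.const_mul (I * k * (wt x * cay x ^ k))).add
      (h2.const_mul (cay x ^ k - 1))).const_mul (-I) using 2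
    linear_combination (k * (wt x * cay x ^ k)) * Complex.I_sq

/-- Schwartz functions approximating `cay ^ k - 1`, together with `|∇|`, boundedly and
pointwise. -/
lemma exists_approx_cay_zpow (k : ℤ) : ∃ (ψ : ℕ → 𝓢(ℝ, ℂ)) (C : ℝ),
    (∀ n x, ‖ψ n x‖ ≤ C) ∧ (∀ n x, ‖absGradS (ψ n) x‖ ≤ C * wt x) ∧
    (∀ x, Tendsto (fun n => ψ n x) atTop (𝓝 (cay x ^ k - 1))) ∧
    ∀ x, Tendsto (fun n => absGradS (ψ n) x) atTop
      (𝓝 ((k.natAbs : ℂ) * (wt x * cay x ^ k))) := by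
  obtain ⟨ψ, C, h1, h2, h3, h4⟩ := exists_approx_cay_pow k.natAbs
  rcases Int.natAbs_eq k with hk | hk
  · have e : ∀ x, cay x ^ k = cay x ^ k.natAbs := fun x => by
      conv_lhs => rw [hk]
      exact zpow_natCast _ _
    simp only [e]
    exact ⟨ψ, C, h1, h2, h3, h4⟩
  · have e : ∀ x, cay x ^ k = cay (-x) ^ k.natAbs := fun x => by
      conv_lhs => rw [hk]
      rw [zpow_neg, zpow_natCast, cay_neg, inv_pow]
    refine ⟨fun n => dilate (-1) (by norm_num) (ψ n), C, fun n x => ?_, fun n x => ?_, fun x => ?_,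
      fun x => ?_⟩
    · rw [dilate_apply]
      exact h1 n _
    · rw [absGradS_dilate_neg_one, ← wt_neg]
      exact h2 n _
    · simp only [dilate_apply, e, neg_one_mul]
      exact h3 _
    · simp only [absGradS_dilate_neg_one, e]
      rw [← wt_neg]
      exact h4 _

/-! ### Classification of the zero-energy solutions -/

lemma tendsto_integral_mul_of_bound {f : ℝ → ℂ} {g : ℝ → ℝ} {φ : ℕ → ℝ → ℂ} {φ' : ℝ → ℂ} {C : ℝ}
    (hf : AEStronglyMeasurable f volume) (hfg : Integrable fun x => f x * g x)
    (hg : ∀ x, 0 ≤ g x) (hc : ∀ n, Continuous (φ n)) (hb : ∀ n x, ‖φ n x‖ ≤ C * g x)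
    (hl : ∀ x, Tendsto (fun n => φ n x) atTop (𝓝 (φ' x))) :
    Tendsto (fun n => ∫ x, f x * φ n x) atTop (𝓝 (∫ x, f x * φ' x)) := by
  refine tendsto_integral_of_dominated_convergence (fun x => C * ‖f x * g x‖)
    (fun n => hf.mul (hc n).aestronglyMeasurable) (hfg.norm.const_mul C)
    (fun n => Eventually.of_forall fun x => ?_)
    (Eventually.of_forall fun x => (hl x).const_mul (f x))
  rw [norm_mul, norm_mul, Complex.norm_real, Real.norm_of_nonneg (hg x)]
  calc ‖f x‖ * ‖φ n x‖ ≤ ‖f x‖ * (C * g x) := by gcongr; exact hb n x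
    _ = _ := by ring

lemma tendsto_integral_mul_absGradS {u : ℝ → ℂ} (hu : Integrable (fun y => u y * wt y))
    {φ : ℕ → 𝓢(ℝ, ℂ)} {C : ℝ} {k : ℤ}
    (hb : ∀ n x, ‖absGradS (φ n) x‖ ≤ C * wt x)
    (hl : ∀ x, Tendsto (fun n => absGradS (φ n) x) atTop
      (𝓝 ((k.natAbs : ℂ) * (wt x * cay x ^ k)))) :
    Tendsto (fun n => ∫ x, u x * absGradS (φ n) x) atTop
      (𝓝 ((k.natAbs : ℂ) * moment u (-k))) := by
  have h := tendsto_integral_mul_of_bound (aestronglyMeasurable_of_integrable_mul_wt hu) hu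
    (fun x => (wt_pos x).le) (fun n => continuous_absGradS (φ n)) hb hl
  convert! h using 2
  rw [moment, ← integral_const_mul, neg_neg]
  congr 1
  funext x
  ring

lemma tendsto_integral_V_mul {u : ℝ → ℂ} (hu : Integrable (fun y => u y * wt y))
    (m : ℕ) {φ : ℕ → 𝓢(ℝ, ℂ)} {C : ℝ} {k : ℤ}
    (hb : ∀ n x, ‖φ n x‖ ≤ C) (hl : ∀ x, Tendsto (fun n => φ n x) atTop (𝓝 (cay x ^ k - 1))) :
    Tendsto (fun n => ∫ x, (V m x : ℂ) * u x * φ n x) atTop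
      (𝓝 (m * (moment u (-k) - moment u 0))) := by
  have hi : Integrable fun x => (V m x : ℂ) * u x := by
    refine (hu.const_mul (m : ℂ)).congr (Eventually.of_forall fun x => ?_)
    simp only [V_eq_cast]
    ring
  have h := tendsto_integral_mul_of_bound (g := fun _ => 1) hi.aestronglyMeasurable
    (by simpa using hi) (fun _ => zero_le_one) (fun n => (φ n).continuous)
    (by simpa using hb) hl
  convert! h using 2
  rw [moment, moment, ← integral_sub (integrable_mul_wt_cay hu _) (integrable_mul_wt_cay hu _),
    ← integral_const_mul]
  congr 1
  funext x
  rw [V_eq_cast, neg_neg, neg_zero, zpow_zero]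
  ring

lemma integrable_RFun {u : ℝ → ℂ} (hu : Integrable (fun y => u y * wt y))
    (m : ℕ) : Integrable (RFun m u) := by
  rw [show RFun m u = _ from funext (RFun_eq m hu)]
  exact integrable_finsetSum _ fun j _ => integrable_finsetSum _ fun l _ =>
    (integrable_cay_zpow_mul_wt _).const_mul _

lemma integral_RFun_mul {u : ℝ → ℂ} (hu : Integrable (fun y => u y * wt y))
    (m : ℕ) (k : ℤ) : ∫ x, RFun m u x * (cay x ^ k - 1) =
    ((m - k.natAbs : ℕ) : ℂ) * moment u (-k) - m * moment u 0 := by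
  have hpi := two_pi_ne
  have e : ∀ x, RFun m u x * (cay x ^ k - 1) = ∑ j ∈ Finset.range m, ∑ l ∈ Finset.range m,
      (1 / (2 * (Real.pi : ℂ)) * moment u ((j : ℤ) - l)) *
        (wt x * cay x ^ ((j : ℤ) - l + k) - wt x * cay x ^ ((j : ℤ) - l)) := by
    intro x
    rw [RFun_eq m hu, Finset.sum_mul]
    refine Finset.sum_congr rfl fun j _ => ?_
    rw [Finset.sum_mul]
    refine Finset.sum_congr rfl fun l _ => ?_
    rw [zpow_add₀ (cay_ne_zero x)]
    ring
  have hi : ∀ j l : ℕ, Integrable fun x => (1 / (2 * (Real.pi : ℂ)) * moment u ((j : ℤ) - l)) *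
      (wt x * cay x ^ ((j : ℤ) - l + k) - wt x * cay x ^ ((j : ℤ) - l)) := fun j l =>
    ((integrable_cay_zpow_mul_wt _).sub (integrable_cay_zpow_mul_wt _)).const_mul _
  simp only [e]
  rw [integral_finsetSum _ fun j _ => integrable_finsetSum _ fun l _ => hi j l]
  have e2 : ∀ j ∈ Finset.range m, ∫ x, ∑ l ∈ Finset.range m,
      (1 / (2 * (Real.pi : ℂ)) * moment u ((j : ℤ) - l)) *
        (wt x * cay x ^ ((j : ℤ) - l + k) - wt x * cay x ^ ((j : ℤ) - l)) =
      ∑ l ∈ Finset.range m, (moment u (-k) * (if (j : ℤ) - l = -k then 1 else 0) -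
        moment u 0 * (if (j : ℤ) - l = 0 then 1 else 0)) := by
    intro j _
    rw [integral_finsetSum _ fun l _ => hi j l]
    refine Finset.sum_congr rfl fun l _ => ?_
    rw [integral_const_mul, integral_sub (integrable_cay_zpow_mul_wt _)
      (integrable_cay_zpow_mul_wt _), integral_wt_mul_cay_zpow, integral_wt_mul_cay_zpow]
    by_cases h1 : (j : ℤ) - l = -k
    · rw [if_pos (by omega : (j : ℤ) - l + k = 0), if_pos h1]
      by_cases h2 : (j : ℤ) - l = 0
      · have : k = 0 := by omega
        rw [if_pos h2, if_pos h2, this]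
        simp
      · rw [if_neg h2, if_neg h2, h1]
        field_simp
        ring
    · rw [if_neg (by omega : ¬ (j : ℤ) - l + k = 0), if_neg h1]
      by_cases h2 : (j : ℤ) - l = 0
      · rw [if_pos h2, if_pos h2, h2]
        field_simp
        ring
      · rw [if_neg h2, if_neg h2]
        simp
  rw [Finset.sum_congr rfl e2]
  simp only [Finset.sum_sub_distrib, ← Finset.mul_sum, sum_sum_ite_sub_eq]
  simp only [Int.natAbs_neg, Int.natAbs_zero, tsub_zero]
  ring

lemma tendsto_integral_RFun_mul {u : ℝ → ℂ} (hu : Integrable (fun y => u y * wt y))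
    (m : ℕ) {φ : ℕ → 𝓢(ℝ, ℂ)} {C : ℝ} {k : ℤ}
    (hb : ∀ n x, ‖φ n x‖ ≤ C) (hl : ∀ x, Tendsto (fun n => φ n x) atTop (𝓝 (cay x ^ k - 1))) :
    Tendsto (fun n => ∫ x, RFun m u x * φ n x) atTop
      (𝓝 (((m - k.natAbs : ℕ) : ℂ) * moment u (-k) - m * moment u 0)) := by
  have hi := integrable_RFun hu m
  rw [← integral_RFun_mul hu]
  exact tendsto_integral_mul_of_bound (g := fun _ => 1) hi.aestronglyMeasurable
    (by simpa using hi) (fun _ => zero_le_one) (fun n => (φ n).continuous)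
    (by simpa using hb) hl

/-- Passing to the limit along the Schwartz approximations amounts to testing the equation with `cay
^ k - 1`. Only integrability against the weight is used. -/
lemma moment_of_LPlusDist {u : ℝ → ℂ} (hu : Integrable (fun y => u y * wt y))
    {m : ℕ} (h : ∀ ψ, LPlusDist m u ψ = 0) (k : ℤ) :
    (k.natAbs : ℂ) * moment u (-k) = m * (moment u (-k) - moment u 0) := by
  obtain ⟨φ, C, h1, h2, h3, h4⟩ := exists_approx_cay_zpow k
  have t := (tendsto_integral_mul_absGradS hu h2 h4).sub (tendsto_integral_V_mul hu m h1 h3)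
  have e : ∀ n, (∫ x, u x * absGradS (φ n) x) - ∫ x, (V m x : ℂ) * u x * φ n x = 0 :=
    fun n => h (φ n)
  simp only [e] at t
  exact (sub_eq_zero.1 (tendsto_nhds_unique t tendsto_const_nhds))

lemma moment_of_LMinusDist {u : ℝ → ℂ} (hu : Integrable (fun y => u y * wt y))
    {m : ℕ} (h : ∀ ψ, LMinusDist m u ψ = 0) (k : ℤ) :
    ((k.natAbs : ℂ) - m + ((m - k.natAbs : ℕ) : ℂ)) * moment u (-k) = 0 := by
  obtain ⟨φ, C, h1, h2, h3, h4⟩ := exists_approx_cay_zpow k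
  have t := ((tendsto_integral_mul_absGradS hu h2 h4).sub
    (tendsto_integral_V_mul hu m h1 h3)).add (tendsto_integral_RFun_mul hu m h1 h3)
  have e : ∀ n, ((∫ x, u x * absGradS (φ n) x) - ∫ x, (V m x : ℂ) * u x * φ n x) +
      ∫ x, RFun m u x * φ n x = 0 := fun n => h (φ n)
  simp only [e] at t
  have t' := tendsto_nhds_unique t tendsto_const_nhds
  linear_combination t'

lemma moment_eq_zero_of_LPlusDist {u : ℝ → ℂ} (hu : Integrable (fun y => u y * wt y))
    {m : ℕ} (hm : 1 ≤ m) (h : ∀ ψ, LPlusDist m u ψ = 0) {k : ℤ}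
    (hk : m < k.natAbs) : moment u k = 0 := by
  -- At frequency m the two multiples of `moment u (-m)` cancel, which forces the moment of order
  -- zero to vanish.
  have h0 := moment_of_LPlusDist hu h m
  have hm0 : (m : ℂ) ≠ 0 := by exact_mod_cast (by omega : m ≠ 0)
  have h1 : moment u 0 = 0 := by
    rw [Int.natAbs_natCast] at h0
    refine (mul_eq_zero.1 (?_ : (m : ℂ) * moment u 0 = 0)).resolve_left hm0
    linear_combination h0
  have h2 := moment_of_LPlusDist hu h (-k)
  rw [h1, neg_neg, Int.natAbs_neg] at h2
  refine (mul_eq_zero.1 (?_ : ((k.natAbs : ℂ) - m) * moment u k = 0)).resolve_left ?_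
  · linear_combination h2
  · refine sub_ne_zero.2 ?_
    exact_mod_cast hk.ne'

lemma moment_eq_zero_of_LMinusDist {u : ℝ → ℂ} (hu : Integrable (fun y => u y * wt y))
    {m : ℕ} (h : ∀ ψ, LMinusDist m u ψ = 0) {k : ℤ}
    (hk : m < k.natAbs) : moment u k = 0 := by
  have h2 := moment_of_LMinusDist hu h (-k)
  rw [neg_neg, Int.natAbs_neg, Nat.sub_eq_zero_of_le hk.le, Nat.cast_zero, add_zero] at h2
  refine (mul_eq_zero.1 h2).resolve_left ?_
  refine sub_ne_zero.2 ?_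
  exact_mod_cast hk.ne'

/-- The polynomial built from the remaining moments has the same moments as u, and moments determine
a function integrable against the weight. -/
lemma ae_eq_sum_of_moment_eq_zero {u : ℝ → ℂ} (hu : Integrable (fun y => u y * wt y))
    {m : ℕ} (h : ∀ k : ℤ, m < k.natAbs → moment u k = 0) :
    ∀ᵐ x, u x = ∑ k ∈ Finset.Icc (-(m : ℤ)) m, moment u k / (2 * Real.pi) * cay x ^ k := by
  have hpi := two_pi_ne
  set p : ℝ → ℂ := fun x => ∑ k ∈ Finset.Icc (-(m : ℤ)) m, moment u k / (2 * Real.pi) * cay x ^ k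
    with hp
  have hpc : ∀ (l : ℤ) (x : ℝ), p x * (wt x * cay x ^ l) = ∑ k ∈ Finset.Icc (-(m : ℤ)) m,
      moment u k / (2 * Real.pi) * (wt x * cay x ^ (k + l)) := by
    intro l x
    rw [hp, Finset.sum_mul]
    refine Finset.sum_congr rfl fun k _ => ?_
    rw [zpow_add₀ (cay_ne_zero x)]
    ring
  have hpi2 : ∀ l : ℤ, Integrable fun x => p x * (wt x * cay x ^ l) := by
    intro l
    simp only [hpc]
    exact integrable_finsetSum _ fun k _ => (integrable_cay_zpow_mul_wt _).const_mul _
  have hpm : ∀ l : ℤ, ∫ x, p x * (wt x * cay x ^ l) = moment u (-l) := by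
    intro l
    simp only [hpc]
    rw [integral_finsetSum _ fun k _ => (integrable_cay_zpow_mul_wt _).const_mul _]
    simp only [integral_const_mul, integral_wt_mul_cay_zpow]
    have e : ∀ k ∈ Finset.Icc (-(m : ℤ)) m, moment u k / (2 * Real.pi) *
        (if k + l = 0 then 2 * (Real.pi : ℂ) else 0) = if k = -l then moment u (-l) else 0 := by
      intro k _
      by_cases hk : k = -l
      · rw [if_pos (by omega), if_pos hk, hk]
        field_simp
      · rw [if_neg (by omega), if_neg hk, mul_zero]
    rw [Finset.sum_congr rfl e, Finset.sum_ite_eq']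
    split_ifs with hl
    · rfl
    · refine (h _ ?_).symm
      rw [Finset.mem_Icc] at hl
      omega
  have hi : Integrable fun x => (u x - p x) * wt x := by
    have h2 := hu.sub (hpi2 0)
    refine h2.congr (Eventually.of_forall fun x => ?_)
    simp only [Pi.sub_apply, zpow_zero]
    ring
  have hz := ae_eq_zero_of_integral_cay_zpow hi fun l => by
    have e : ∀ x, cay x ^ l * ((u x - p x) * wt x) =
        u x * (wt x * cay x ^ l) - p x * (wt x * cay x ^ l) := fun x => by ring
    simp only [e]
    rw [integral_sub (integrable_mul_wt_cay hu l) (hpi2 l), hpm, moment, neg_neg, sub_self]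
  filter_upwards [hz] with x hx
  have hw : (wt x : ℂ) ≠ 0 := by exact_mod_cast (wt_pos x).ne'
  exact sub_eq_zero.1 ((mul_eq_zero.1 hx).resolve_right hw)

lemma exists_memLp_sub_resonance {u : ℝ → ℂ} (hu : Integrable (fun y => u y * wt y))
    {m : ℕ} (h : ∀ k : ℤ, m < k.natAbs → moment u k = 0) :
    ∃ c : ℂ, MemLp (u - c • resonance m) 2 volume := by
  obtain ⟨a, b, hab, hr⟩ := exists_resonance_eq m
  set d : ℤ → ℂ := fun k => moment u k / (2 * Real.pi)
  set s := ∑ k ∈ Finset.Icc (-(m : ℤ)) m, d k with hs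
  -- Here s is the value at infinity of the polynomial and a + b that of the resonance. With this
  -- multiple the constants cancel and combinations of `cay ^ k - 1` remain.
  refine ⟨s / (a + b), ?_⟩
  have h1 : MemLp (fun x => ∑ k ∈ Finset.Icc (-(m : ℤ)) m, d k * (cay x ^ k - 1)) 2 volume :=
    memLp_finsetSum _ fun k _ => (memLp_cay_sub_one k).const_mul (d k)
  refine (memLp_congr_ae ?_).1 (h1.sub ((memLp_resonance_sub hr).const_mul (s / (a + b))))
  filter_upwards [ae_eq_sum_of_moment_eq_zero hu h] with x hx
  simp only [Pi.sub_apply, Pi.smul_apply, smul_eq_mul, hx, mul_sub, Finset.sum_sub_distrib, mul_one]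
  rw [← hs, div_mul_cancel₀ _ hab]
  ring

lemma IsZeroState.exists_sub_memL2Pair {m : ℕ} (hm : 1 ≤ m) {p : (ℝ → ℂ) × (ℝ → ℂ)}
    (hp : IsZeroState m p) : ∃ a b : ℂ,
      MemL2Pair (p - a • (resonance m, (0 : ℝ → ℂ)) - b • ((0 : ℝ → ℂ), resonance m)) := by
  obtain ⟨h1, h2, h3⟩ := hp
  have i1 := integrable_mul_wt_iff.2 h1.1
  have i2 := integrable_mul_wt_iff.2 h2.1
  obtain ⟨a, ha⟩ := exists_memLp_sub_resonance i1 fun k hk =>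
    moment_eq_zero_of_LPlusDist i1 hm (fun ψ => congrArg Prod.snd (h3 ψ)) hk
  obtain ⟨b, hb⟩ := exists_memLp_sub_resonance i2 fun k hk =>
    moment_eq_zero_of_LMinusDist i2 (fun ψ => neg_eq_zero.1 (congrArg Prod.fst (h3 ψ))) hk
  refine ⟨a, b, ?_, ?_⟩
  · simpa using ha
  · simpa using hb

end HalfHarmonic

theorem theorem6 (m : ℕ) (hm : 1 ≤ m) :
    -- (i) the spectrum is the imaginary axis
    pspectrum (JL m) = {z : ℂ | z.re = 0} ∧
    -- (ii) zero is the only eigenvalue, its eigenspace has dimension 2m+1,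
    -- and there is no embedded eigenvalue
    (pointSpectrum (JL m) = {0} ∧
      Module.finrank ℂ (pker (JL m)) = 2 * m + 1 ∧
      ∀ z ∈ pspectrum (JL m), z ≠ 0 → z ∉ pointSpectrum (JL m)) ∧
    -- (iii) the generalized nullspace, in terms of the eigenfunctions of `L₊`
    ((∃ (E : Fin (2 * m) → ℝ) (φ : Fin (2 * m) → L2), IsEigenSystem m E φ) ∧
      ∀ (E : Fin (2 * m) → ℝ) (φ : Fin (2 * m) → L2), IsEigenSystem m E φ →
        (⋃ n ≥ 1, (pker (ppow (JL m) n) : Set (L2 × L2))) = pker (ppow (JL m) 2) ∧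
        pker (ppow (JL m) 2) =
          Submodule.span ℂ
            (Set.range (fun k => (φ k, (0 : L2))) ∪ Set.range (fun k => ((0 : L2), φ k)))) ∧
    -- (iv) the two resonances at energy zero
    (MemHHalf (resonance m) ∧ ¬ MemLp (resonance m) 2 MeasureTheory.volume ∧
      IsResonance m (resonance m, 0) ∧ IsResonance m (0, resonance m) ∧
      LinearIndependent ℂ
        ![(resonance m, (0 : ℝ → ℂ)), ((0 : ℝ → ℂ), resonance m)] ∧
      ∀ p : (ℝ → ℂ) × (ℝ → ℂ), IsZeroState m p →
        ∃ a b : ℂ,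
          MemL2Pair (p - a • (resonance m, (0 : ℝ → ℂ)) - b • ((0 : ℝ → ℂ), resonance m))) := by
  refine ⟨pspectrum_JL m, ⟨pointSpectrum_JL hm, finrank_pker_JL hm, fun z _ hz h => hz ?_⟩,
    ⟨exists_isEigenSystem hm, fun E φ h => ⟨iUnion_pker_ppow_JL m, h.pker_ppow_two⟩⟩,
    memHHalf_resonance m, not_memLp_resonance m, isResonance_left m, isResonance_right m,
    linearIndependent_resonance m, fun p hp => hp.exists_sub_memL2Pair hm⟩
  rw [pointSpectrum_JL hm] at h
  exact h
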